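/- Let $G$ be a compact quantum group, and let $(\mathbb C[G],\Delta,\varepsilon)$ be its Hopf $*$-algebra of matrix coefficients of finite dimensional corepresentations; thus $\mathbb C[G]$ is a Hopf $*$-algebra linearly spanned by the matrix coefficients of its finite dimensional unitary corepresentations. Let $C_u(G)$ be the universal enveloping C$^*$-algebra of $\mathbb C[G]$ (its completion in the norm $\|a\|_u=\sup_\pi\|\pi(a)\|$ over all unital $*$-homomorphisms $\pi$ into C$^*$-algebras). Let $h$ be the Haar state on $C_u(G)$, i.e. the unique state with $(\iota\otimes h)\Delta(a)=h(a)1=(h\otimes\iota)\Delta(a)$ for $a\in\mathbb C[G]$, let $\pi_h\colon C_u(G)\to B(L^2(G))$ be its GNS-representation, and put $C_r(G)=\pi_h(C_u(G))$. Let $(U_j)_{j\in I}$ be representatives of the isomorphism classes of irreducible finite dimensional unitary corepresentations of $G$, and let $m_{ij}^k$ be the multiplicity of $U_k$ in $U_i\otimes U_j$, so that the fusion ring of $G$ is $\bigoplus_{j\in I}\mathbb Z j$ with $ij=\sum_k m_{ij}^k k$. Let $\Lambda_j$ be the bounded operator on $\ell^2(I)$ with $\Lambda_j\delta_k=\sum_i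 m_{jk}^i\delta_i$, and for a probability measure $\mu$ on $I$ put $\lambda_\mu=\sum_{j\in I}\frac{\mu(j)}{\dim U_j}\Lambda_j$. The fusion ring of $G$ with the classical dimension function $\dim$ is called amenable if $1\in\operatorname{Sp}\lambda_\mu$ for every probability measure $\mu$ on $I$. Then the following conditions are equivalent: (i) the fusion ring of $G$ with the classical dimension function $\dim$ is amenable; (ii) the counit $\varepsilon\colon\mathbb C[G]\to\mathbb C$ extends to a character of $C_r(G)$, i.e. there is a character $\chi$ of $C_r(G)$ with $\chi(\pi_h(a))=\varepsilon(a)$ for all $a\in\mathbb C[G]$; (iii) the map $\pi_h\colon C_u(G)\to C_r(G)$ is an isomorphism. -/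

import Mathlib

open scoped TensorProduct

noncomputable section

namespace CQG

universe u

section Corepresentations

variable {A : Type u} [Ring A] [StarRing A] [HopfAlgebra ℂ A]

/-- A finite dimensional unitary corepresentation, in matrix form: a unitary matrix
`U ∈ M_ι(ℂ) ⊗ A` with `(id ⊗ Δ)(U) = U₁₂ U₁₃`, i.e. `Δ(u i j) = ∑ k, u i k ⊗ u k j`. -/
structure IsUnitaryCorep {ι : Type*} [Fintype ι] [DecidableEq ι] (U : Matrix ι ι A) : Prop where
  unitary : U ∈ unitary (Matrix ι ι A)
  comul : ∀ i j, Coalgebra.comul (R := ℂ) (U i j) = ∑ k, U i k ⊗ₜ[ℂ] U k j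

/-- `Hom(U, V)`: scalar matrices `T` with `(T ⊗ 1) U = V (T ⊗ 1)`. -/
def intertwiners {ι κ : Type*} [Fintype ι] [Fintype κ]
    (U : Matrix ι ι A) (V : Matrix κ κ A) : Submodule ℂ (Matrix κ ι ℂ) where
  carrier := {T | T.map (algebraMap ℂ A) * U = V * T.map (algebraMap ℂ A)}
  add_mem' {S T} hS hT := by
    change S.map (algebraMap ℂ A) * U = V * S.map (algebraMap ℂ A) at hS
    change T.map (algebraMap ℂ A) * U = V * T.map (algebraMap ℂ A) at hT
    change (S + T).map (algebraMap ℂ A) * U = V * (S + T).map (algebraMap ℂ A)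
    rw [Matrix.map_add _ (map_add _), Matrix.add_mul, Matrix.mul_add, hS, hT]
  zero_mem' := by
    change (0 : Matrix κ ι ℂ).map (algebraMap ℂ A) * U = V * (0 : Matrix κ ι ℂ).map (algebraMap ℂ A)
    simp
  smul_mem' c T hT := by
    change T.map (algebraMap ℂ A) * U = V * T.map (algebraMap ℂ A) at hT
    change (c • T).map (algebraMap ℂ A) * U = V * (c • T).map (algebraMap ℂ A)
    have h : (c • T).map (algebraMap ℂ A) = c • T.map (algebraMap ℂ A) := by
      ext i j
      simp [Algebra.smul_def]
    rw [h, Matrix.smul_mul, Matrix.mul_smul, hT]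

/-- The tensor product `U₁₃ V₂₃` of corepresentations. -/
def tensorCorep {ι κ : Type*} (U : Matrix ι ι A) (V : Matrix κ κ A) :
    Matrix (ι × κ) (ι × κ) A :=
  fun p q => U p.1 q.1 * V p.2 q.2

end Corepresentations

/-- A compact quantum group `G`, given by its Hopf `*`-algebra `A = ℂ[G]`: the comultiplication
is a `*`-homomorphism and `A` is the linear span of the matrix coefficients of its finite
dimensional unitary corepresentations. -/
class CompactQuantumGroup (A : Type u) [Ring A] [StarRing A] [HopfAlgebra ℂ A]
    [StarModule ℂ A] : Prop where
  comul_star : ∀ a : A,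
    Coalgebra.comul (R := ℂ) (star a) = star (Coalgebra.comul (R := ℂ) a : A ⊗[ℂ] A)
  span_coeff : Submodule.span ℂ {a : A | ∃ (n : ℕ) (U : Matrix (Fin n) (Fin n) A),
    IsUnitaryCorep U ∧ ∃ i j, a = U i j} = ⊤

section Fusion

variable (A : Type u) [Ring A] [StarRing A] [HopfAlgebra ℂ A]

/-- Irreducible finite dimensional unitary corepresentations (`End(U) = ℂ`). -/
structure IrredCorep where
  dim : ℕ
  mat : Matrix (Fin dim) (Fin dim) A
  isUnitaryCorep : IsUnitaryCorep mat
  irreducible : Module.finrank ℂ (intertwiners mat mat) = 1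

variable {A}

lemma intertwiners_mul {ι κ l : Type*} [Fintype ι] [Fintype κ] [Fintype l]
    {U : Matrix ι ι A} {V : Matrix κ κ A} {W : Matrix l l A}
    {T : Matrix κ ι ℂ} {S : Matrix l κ ℂ}
    (hT : T ∈ intertwiners U V) (hS : S ∈ intertwiners V W) :
    S * T ∈ intertwiners U W := by
  change T.map (algebraMap ℂ A) * U = V * T.map (algebraMap ℂ A) at hT
  change S.map (algebraMap ℂ A) * V = W * S.map (algebraMap ℂ A) at hS
  change (S * T).map (algebraMap ℂ A) * U = W * (S * T).map (algebraMap ℂ A)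
  rw [Matrix.map_mul, Matrix.mul_assoc, hT, ← Matrix.mul_assoc, hS, Matrix.mul_assoc]

variable (A)

/-- Isomorphism of irreducible corepresentations: an invertible intertwiner. -/
instance irredSetoid : Setoid (IrredCorep A) where
  r U V := ∃ T ∈ intertwiners U.mat V.mat, ∃ S ∈ intertwiners V.mat U.mat,
    T * S = 1 ∧ S * T = 1
  iseqv := by
    refine ⟨fun U => ?_, ?_, ?_⟩
    · have h : (1 : Matrix (Fin U.dim) (Fin U.dim) ℂ) ∈ intertwiners U.mat U.mat := by
        change (1 : Matrix _ _ ℂ).map (algebraMap ℂ A) * U.mat =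
          U.mat * (1 : Matrix _ _ ℂ).map (algebraMap ℂ A)
        simp
      exact ⟨1, h, 1, h, one_mul 1, one_mul 1⟩
    · rintro U V ⟨T, hT, S, hS, h1, h2⟩
      exact ⟨S, hS, T, hT, h2, h1⟩
    · rintro U V W ⟨T, hT, S, hS, h1, h2⟩ ⟨T', hT', S', hS', h1', h2'⟩
      refine ⟨T' * T, intertwiners_mul hT hT', S * S', intertwiners_mul hS' hS, ?_, ?_⟩
      · rw [Matrix.mul_assoc, ← Matrix.mul_assoc T, h1, Matrix.one_mul, h1']
      · rw [Matrix.mul_assoc, ← Matrix.mul_assoc S', h2', Matrix.one_mul, h2]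

/-- The index set `I` of isomorphism classes of irreducible corepresentations. -/
def Irr : Type u := Quotient (irredSetoid A)

variable {A}

/-- The chosen representative `U_j` of the class `j`. -/
def Irr.rep (j : Irr A) : IrredCorep A := Quotient.out j

/-- The classical dimension function on the basis of the fusion ring. -/
def Irr.dim (j : Irr A) : ℝ := (j.rep.dim : ℝ)

/-- The structure constants `m_{ij}^k` of the fusion ring, i.e. the multiplicity of `U_k` in
`U_i ⊗ U_j`. -/
def fusionMult (i j k : Irr A) : ℕ :=
  Module.finrank ℂ (intertwiners k.rep.mat (tensorCorep i.rep.mat j.rep.mat))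

end Fusion

open Classical in
/-- `Λ` is the bounded operator on `ℓ²(I)` of left multiplication by the basis element `j` of the
based ring with structure constants `m`: `Λ δ_k = ∑ i, m_{jk}^i δ_i`. -/
def IsLeftMul {I : Type*} (m : I → I → I → ℕ) (j : I)
    (Λ : lp (fun _ : I => ℂ) 2 →L[ℂ] lp (fun _ : I => ℂ) 2) : Prop :=
  ∀ k i, (Λ (lp.single 2 k (1 : ℂ)) : I → ℂ) i = (m j k i : ℂ)

/-- `T` is the operator `λ_μ = ∑ j, (μ(j) / d(j)) Λ_j` on `ℓ²(I)` (norm convergent series). -/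
def IsMarkovOp {I : Type*} (m : I → I → I → ℕ) (d : I → ℝ) (μ : PMF I)
    (T : lp (fun _ : I => ℂ) 2 →L[ℂ] lp (fun _ : I => ℂ) 2) : Prop :=
  ∃ Λ : I → (lp (fun _ : I => ℂ) 2 →L[ℂ] lp (fun _ : I => ℂ) 2),
    (∀ j, IsLeftMul m j (Λ j)) ∧
    HasSum (fun j => (((μ j).toReal / d j : ℝ) : ℂ) • Λ j) T

/-- Amenability of a based ring (basis `I`, structure constants `m`) with dimension function `d`:
for every probability measure `μ` on `I`, `1` is in the spectrum of `λ_μ`. -/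
def IsAmenableFusion {I : Type*} (m : I → I → I → ℕ) (d : I → ℝ) : Prop :=
  ∀ μ : PMF I, ∃ T, IsMarkovOp m d μ T ∧ (1 : ℂ) ∈ spectrum ℂ T

section Universal

/-- A unital `*`-representation of `A` in a C⋆-algebra. -/
structure CStarRep (A : Type u) [Ring A] [StarRing A] [Algebra ℂ A] where
  alg : Type u
  [inst : CStarAlgebra alg]
  hom : A →⋆ₐ[ℂ] alg

attribute [instance] CStarRep.inst

variable (A : Type u) [Ring A] [StarRing A] [HopfAlgebra ℂ A] [StarModule ℂ A]

variable {A} in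
/-- The largest C⋆-seminorm `‖a‖_u = sup_π ‖π(a)‖`. -/
def univNorm (a : A) : ℝ := ⨆ π : CStarRep A, ‖π.hom a‖

variable {A} in
lemma norm_coeff_le_one {B : Type*} [CStarAlgebra B] {n : ℕ} {U : Matrix (Fin n) (Fin n) B}
    (hU : U ∈ unitary (Matrix (Fin n) (Fin n) B)) (i j : Fin n) : ‖U i j‖ ≤ 1 := by
  let := CStarAlgebra.spectralOrder B
  let := CStarAlgebra.spectralOrderedRing B
  have h : ∑ k, star (U k j) * U k j = 1 := by
    have h0 := congrArg (fun M : Matrix (Fin n) (Fin n) B => M j j)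
      (Unitary.star_mul_self_of_mem hU)
    simpa [Matrix.mul_apply, Matrix.star_apply] using h0
  have h1 : star (U i j) * U i j ≤ 1 := by
    rw [← h]
    exact Finset.single_le_sum (f := fun k => star (U k j) * U k j)
      (fun k _ => star_mul_self_nonneg _) (Finset.mem_univ i)
  have h2 : ‖star (U i j) * U i j‖ ≤ 1 :=
    (CStarAlgebra.norm_le_one_iff_of_nonneg _ (star_mul_self_nonneg _)).2 h1
  rw [CStarRing.norm_star_mul_self] at h2
  nlinarith [norm_nonneg (U i j)]

variable {A} in
lemma bddAbove_univNorm [CompactQuantumGroup A] (a : A) :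
    BddAbove (Set.range fun π : CStarRep A => ‖π.hom a‖) := by
  have ha : a ∈ Submodule.span ℂ {a : A | ∃ (n : ℕ) (U : Matrix (Fin n) (Fin n) A),
      IsUnitaryCorep U ∧ ∃ i j, a = U i j} := by
    rw [CompactQuantumGroup.span_coeff]; trivial
  suffices ∃ C, ∀ π : CStarRep A, ‖π.hom a‖ ≤ C by
    obtain ⟨C, hC⟩ := this
    exact ⟨C, by rintro _ ⟨π, rfl⟩; exact hC π⟩
  induction ha using Submodule.span_induction with
  | mem a h =>
    obtain ⟨n, U, hU, i, j, rfl⟩ := h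
    refine ⟨1, fun π => ?_⟩
    have hV : U.map π.hom ∈ unitary (Matrix (Fin n) (Fin n) π.alg) := by
      have h1 := Unitary.star_mul_self_of_mem hU.unitary
      have h2 := Unitary.mul_star_self_of_mem hU.unitary
      have hs : star (U.map π.hom) = (star U).map π.hom := by
        ext a b; simpa [Matrix.star_apply] using (map_star π.hom (U b a)).symm
      have hm : ∀ V W : Matrix (Fin n) (Fin n) A,
          V.map π.hom * W.map π.hom = (V * W).map π.hom := by
        intro V W; ext a b; simp [Matrix.mul_apply]
      have h3 : (1 : Matrix (Fin n) (Fin n) A).map π.hom = 1 := by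
        simp
      rw [Unitary.mem_iff, hs, hm, hm, h1, h2, h3]
      exact ⟨rfl, rfl⟩
    simpa using norm_coeff_le_one hV i j
  | zero => exact ⟨0, fun π => by simp⟩
  | add x y _ _ hx hy =>
    obtain ⟨C, hC⟩ := hx
    obtain ⟨D, hD⟩ := hy
    exact ⟨C + D, fun π => by
      rw [map_add]; exact (norm_add_le _ _).trans (add_le_add (hC π) (hD π))⟩
  | smul c x _ hx =>
    obtain ⟨C, hC⟩ := hx
    exact ⟨‖c‖ * C, fun π => by
      rw [map_smul, norm_smul]; exact mul_le_mul_of_nonneg_left (hC π) (norm_nonneg c)⟩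

/-- The algebra `A` equipped with the seminorm `univNorm`. -/
def PreUniv : Type u := A

instance : Ring (PreUniv A) := inferInstanceAs (Ring A)
instance : StarRing (PreUniv A) := inferInstanceAs (StarRing A)
instance : Algebra ℂ (PreUniv A) := inferInstanceAs (Algebra ℂ A)
instance : StarModule ℂ (PreUniv A) := inferInstanceAs (StarModule ℂ A)

variable {A} in
lemma le_univNorm [CompactQuantumGroup A] (π : CStarRep A) (a : A) : ‖π.hom a‖ ≤ univNorm a :=
  le_ciSup (bddAbove_univNorm a) π

variable {A} in
lemma univNorm_nonneg (a : A) : 0 ≤ univNorm a :=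
  Real.iSup_nonneg fun _ => norm_nonneg _

variable {A} in
lemma univNorm_le {a : A} {C : ℝ} (hC : 0 ≤ C) (h : ∀ π : CStarRep A, ‖π.hom a‖ ≤ C) :
    univNorm a ≤ C :=
  Real.iSup_le h hC

variable [CompactQuantumGroup A]

variable {A} in
lemma norm_sq_le_univNorm (π : CStarRep A) (a : A) :
    ‖π.hom a‖ ^ 2 ≤ univNorm (star a * a) := by
  have h1 := le_univNorm π (star a * a)
  rwa [map_mul, map_star, CStarRing.norm_star_mul_self, ← sq] at h1

instance : SeminormedRing (PreUniv A) where
  __ := (inferInstance : Ring (PreUniv A))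
  __ := AddGroupSeminorm.toSeminormedAddCommGroup (E := PreUniv A)
    { toFun := univNorm (A := A)
      map_zero' := by
        refine le_antisymm (univNorm_le le_rfl fun π => ?_) (univNorm_nonneg _)
        exact (congrArg norm (map_zero π.hom)).le.trans norm_zero.le
      add_le' := fun a b => univNorm_le (add_nonneg (univNorm_nonneg _) (univNorm_nonneg _))
        fun π => (congrArg norm (map_add π.hom a b)).le.trans ((norm_add_le _ _).trans
          (add_le_add (le_univNorm π a) (le_univNorm π b)))
      neg' := fun a => by
        refine congrArg iSup (funext fun π => ?_)
        exact (congrArg norm (map_neg π.hom a)).trans (norm_neg _) }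
  norm_mul_le a b := univNorm_le (mul_nonneg (univNorm_nonneg _) (univNorm_nonneg _))
    fun π => (congrArg norm (map_mul π.hom a b)).le.trans ((norm_mul_le _ _).trans
      (mul_le_mul (le_univNorm π a) (le_univNorm π b) (norm_nonneg _) (univNorm_nonneg _)))

lemma preUniv_norm_def (a : PreUniv A) : ‖a‖ = univNorm (A := A) a := rfl

instance : NormedAlgebra ℂ (PreUniv A) where
  norm_smul_le c a := univNorm_le (mul_nonneg (norm_nonneg _) (univNorm_nonneg _))
    fun π => (congrArg norm (map_smul π.hom c a)).le.trans ((norm_smul_le _ _).trans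
      (mul_le_mul_of_nonneg_left (le_univNorm π a) (norm_nonneg _)))

lemma preUniv_norm_star (a : PreUniv A) : ‖star a‖ = ‖a‖ :=
  congrArg iSup (funext fun π : CStarRep A =>
    (congrArg norm (map_star π.hom (a : A))).trans (norm_star _))

lemma preUniv_norm_sq_le (a : PreUniv A) : ‖a‖ * ‖a‖ ≤ ‖star a * a‖ := by
  have h : ‖a‖ ≤ √ ‖star a * a‖ := by
    refine univNorm_le (Real.sqrt_nonneg _) fun π => Real.le_sqrt_of_sq_le ?_
    exact norm_sq_le_univNorm (A := A) π a
  calc ‖a‖ * ‖a‖ ≤ √ ‖star a * a‖ * √ ‖star a * a‖ :=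
        mul_self_le_mul_self (norm_nonneg a) h
    _ = _ := Real.mul_self_sqrt (norm_nonneg _)

/-- `C_u(G)`: the universal enveloping C⋆-algebra of `A = ℂ[G]`, i.e. the (separated) completion
of `A` in the largest C⋆-seminorm. -/
def Cu : Type u := UniformSpace.Completion (PreUniv A)

instance : NormedRing (Cu A) :=
  inferInstanceAs (NormedRing (UniformSpace.Completion (PreUniv A)))

instance : NormedAlgebra ℂ (Cu A) where
  __ := (inferInstance : Algebra ℂ (UniformSpace.Completion (PreUniv A)))
  norm_smul_le c x := norm_smul_le (α := ℂ) (β := UniformSpace.Completion (PreUniv A)) c x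

instance : CompleteSpace (Cu A) :=
  inferInstanceAs (CompleteSpace (UniformSpace.Completion (PreUniv A)))

/-- The canonical map `ℂ[G] → C_u(G)` as a map of sets. -/
def toCuFun (a : A) : Cu A := UniformSpace.Completion.coe' (α := PreUniv A) a

variable {A} in
lemma Cu.induction_on {p : Cu A → Prop} (x : Cu A) (hp : IsClosed {x | p x})
    (ih : ∀ a : A, p (toCuFun A a)) : p x :=
  UniformSpace.Completion.induction_on (α := PreUniv A) x hp ih

lemma isometry_star_preUniv : Isometry (star : PreUniv A → PreUniv A) :=
  AddMonoidHomClass.isometry_of_norm (starAddEquiv (R := PreUniv A)) (preUniv_norm_star A)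

instance : Star (Cu A) where
  star := UniformSpace.Completion.map (star : PreUniv A → PreUniv A)

lemma continuous_star_cu : Continuous (star : Cu A → Cu A) :=
  UniformSpace.Completion.continuous_map

lemma star_toCuFun (a : A) : star (toCuFun A a) = toCuFun A (star a) :=
  UniformSpace.Completion.map_coe (isometry_star_preUniv A).uniformContinuous a

lemma toCuFun_mul (a b : A) : toCuFun A (a * b) = toCuFun A a * toCuFun A b :=
  UniformSpace.Completion.coe_mul (α := PreUniv A) a b

lemma toCuFun_add (a b : A) : toCuFun A (a + b) = toCuFun A a + toCuFun A b :=
  UniformSpace.Completion.coe_add (α := PreUniv A) a b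

lemma toCuFun_smul (c : ℂ) (a : A) : toCuFun A (c • a) = c • toCuFun A a :=
  UniformSpace.Completion.coe_smul (X := PreUniv A) c a

lemma norm_toCuFun (a : A) : ‖toCuFun A a‖ = univNorm a :=
  UniformSpace.Completion.norm_coe (E := PreUniv A) a

instance : StarRing (Cu A) where
  star_involutive x := by
    have hs := continuous_star_cu A
    refine Cu.induction_on (p := fun x => star (star x) = x) x
      (isClosed_eq (hs.comp hs) continuous_id) fun a => ?_
    rw [star_toCuFun, star_toCuFun, star_star]
  star_mul x y := by
    have hs := continuous_star_cu A
    refine Cu.induction_on (p := fun x => star (x * y) = star y * star x) x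
      (isClosed_eq (hs.comp (continuous_id.mul continuous_const))
        (continuous_const.mul hs)) fun a => ?_
    refine Cu.induction_on (p := fun y => star (toCuFun A a * y) = star y * star (toCuFun A a)) y
      (isClosed_eq (hs.comp (continuous_const.mul continuous_id))
        (hs.mul continuous_const)) fun b => ?_
    rw [← toCuFun_mul, star_toCuFun, star_toCuFun, star_toCuFun, star_mul, toCuFun_mul]
  star_add x y := by
    have hs := continuous_star_cu A
    refine Cu.induction_on (p := fun x => star (x + y) = star x + star y) x
      (isClosed_eq (hs.comp (continuous_id.add continuous_const))
        (hs.add continuous_const)) fun a => ?_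
    refine Cu.induction_on (p := fun y => star (toCuFun A a + y) = star (toCuFun A a) + star y) y
      (isClosed_eq (hs.comp (continuous_const.add continuous_id))
        (continuous_const.add hs)) fun b => ?_
    rw [← toCuFun_add, star_toCuFun, star_toCuFun, star_toCuFun, star_add, toCuFun_add]

instance : StarModule ℂ (Cu A) where
  star_smul c x := by
    have hs := continuous_star_cu A
    refine Cu.induction_on (p := fun x => star (c • x) = star c • star x) x
      (isClosed_eq (hs.comp (continuous_const_smul c))
        ((continuous_const_smul (star c)).comp hs)) fun a => ?_
    rw [← toCuFun_smul, star_toCuFun, star_toCuFun, star_smul, toCuFun_smul]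

instance : CStarRing (Cu A) where
  norm_mul_self_le x := by
    have hs := continuous_star_cu A
    refine Cu.induction_on (p := fun x => ‖x‖ * ‖x‖ ≤ ‖star x * x‖) x
      (isClosed_le (continuous_norm.mul continuous_norm)
      ((hs.mul continuous_id).norm)) fun a => ?_
    rw [star_toCuFun, ← toCuFun_mul, norm_toCuFun, norm_toCuFun]
    exact preUniv_norm_sq_le A a

instance : CStarAlgebra (Cu A) where

instance : PartialOrder (Cu A) := CStarAlgebra.spectralOrder (Cu A)

instance : StarOrderedRing (Cu A) := CStarAlgebra.spectralOrderedRing (Cu A)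

/-- The canonical `*`-homomorphism `ℂ[G] → C_u(G)`. -/
def toCu : A →⋆ₐ[ℂ] Cu A where
  toFun := toCuFun A
  map_one' := UniformSpace.Completion.coe_one (PreUniv A)
  map_mul' := toCuFun_mul A
  map_zero' := UniformSpace.Completion.coe_zero (α := PreUniv A)
  map_add' := toCuFun_add A
  commutes' r := by
    have h1 : toCuFun A 1 = 1 := UniformSpace.Completion.coe_one (PreUniv A)
    rw [Algebra.algebraMap_eq_smul_one, toCuFun_smul, h1, Algebra.algebraMap_eq_smul_one]
  map_star' a := (star_toCuFun A a).symm

end Universal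

section Reduced

open scoped ComplexOrder

variable (A : Type u) [Ring A] [StarRing A] [HopfAlgebra ℂ A] [StarModule ℂ A]
  [CompactQuantumGroup A]

variable {A} in
/-- `h` is a Haar state on `C_u(G)`: a state with
`(id ⊗ h)Δ(a) = h(a) 1 = (h ⊗ id)Δ(a)` for all `a ∈ ℂ[G]`. -/
structure IsHaarState (h : Cu A →ₚ[ℂ] ℂ) : Prop where
  map_one : h 1 = 1
  right_inv : ∀ a : A,
    TensorProduct.rid ℂ A ((h.toLinearMap ∘ₗ (toCu A).toLinearMap).lTensor A
      (Coalgebra.comul (R := ℂ) a)) = h (toCu A a) • (1 : A)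
  left_inv : ∀ a : A,
    TensorProduct.lid ℂ A ((h.toLinearMap ∘ₗ (toCu A).toLinearMap).rTensor A
      (Coalgebra.comul (R := ℂ) a)) = h (toCu A a) • (1 : A)

lemma denseRange_toCu : DenseRange (toCu A) :=
  UniformSpace.Completion.denseRange_coe (α := PreUniv A)

variable {A} in
lemma IsHaarState.unique {h h' : Cu A →ₚ[ℂ] ℂ} (H : IsHaarState h) (H' : IsHaarState h') :
    h = h' := by
  have key : ∀ a : A, h (toCu A a) = h' (toCu A a) := by
    intro a
    have e1 := congrArg (h'.toLinearMap ∘ₗ (toCu A).toLinearMap) (H.right_inv a)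
    have e2 := congrArg (h.toLinearMap ∘ₗ (toCu A).toLinearMap) (H'.left_inv a)
    have e3 : ∀ t : A ⊗[ℂ] A,
        (h'.toLinearMap ∘ₗ (toCu A).toLinearMap) (TensorProduct.rid ℂ A
          ((h.toLinearMap ∘ₗ (toCu A).toLinearMap).lTensor A t)) =
        (h.toLinearMap ∘ₗ (toCu A).toLinearMap) (TensorProduct.lid ℂ A
          ((h'.toLinearMap ∘ₗ (toCu A).toLinearMap).rTensor A t)) := by
      intro t
      induction t using TensorProduct.induction_on with
      | zero => simp
      | tmul x y => simp [mul_comm]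
      | add x y hx hy => simp only [map_add, hx, hy]
    rw [e3, e2] at e1
    have o1 : h.toLinearMap (toCu A 1) = 1 := by rw [_root_.map_one]; exact H.map_one
    have o2 : h'.toLinearMap (toCu A 1) = 1 := by rw [_root_.map_one]; exact H'.map_one
    have e4 : h' (toCu A a) • h.toLinearMap (toCu A 1) =
        h (toCu A a) • h'.toLinearMap (toCu A 1) := by
      simpa using e1
    rw [o1, o2] at e4
    simpa using e4.symm
  refine DFunLike.ext _ _ fun x => ?_
  exact congrFun ((denseRange_toCu A).equalizer (map_continuous h) (map_continuous h')
    (funext key)) x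

open Classical in
/-- The Haar state on `C_u(G)`. It exists and is unique; the value `0` in the `else` branch is a
placeholder that never occurs. -/
def haar : Cu A →ₚ[ℂ] ℂ :=
  if H : ∃ h : Cu A →ₚ[ℂ] ℂ, IsHaarState h then H.choose else 0

/-- `L²(G)`: the GNS Hilbert space of the Haar state. -/
abbrev L2 : Type u := (haar A).GNS

/-- `C_r(G) = π_h(C_u(G)) ⊆ B(L²(G))`. -/
def Cr : StarSubalgebra ℂ (L2 A →L[ℂ] L2 A) := (haar A).gnsStarAlgHom.range

/-- `π_h`, as a map `C_u(G) → C_r(G)`. -/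
def piH : Cu A →⋆ₐ[ℂ] Cr A := (haar A).gnsStarAlgHom.rangeRestrict

end Reduced

end CQG

end

/-!
The proof runs through the cycle (i) ⇒ (iii) ⇒ (ii) ⇒ (i); its pivot is the existence of almost
invariant vectors in the regular representation on `L²(G)`.

*Groundwork.* Normalised functionals that are invariant on the coefficients of a single unitary
corepresentation exist (`IsUnitaryCorep.exists_invariant`) and agree where they overlap, so they
glue to the Haar functional `haarFun` on `ℂ[G]` (`exists_haarFun`). The coefficients of the
irreducible corepresentations span `ℂ[G]` (`irrSpan_eq_top`); by Schur's lemma they satisfy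
orthogonality relations with respect to `haarFun`, whose matrices are positive
(`IrredCorep.gram_posSemidef`), and so `haarFun` is positive. Hence it extends to the Haar state,
and `⟨π_h(a) 1, π_h(b) 1⟩ = haarFun (a* b)` on `L²(G)`. The multiplicity of `U_i` in `U_j ⊗ U_k`
is `haarFun (χ_i* χ_j χ_k)`. So `δ_j ↦ χ_j` is an isometry `ℓ²(I) → L²(G)` that intertwines `Λ_j`
with left multiplication by `χ_j`; its image contains all cocommutative elements.

*(i) ⇒ (iii).* For a contraction `T`, the number `1` is in the spectrum if and only if
`‖1 + T‖ = 2` (`one_mem_spectrum_iff_two_le_norm`), and then `T` almost fixes some vector. Applied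
to `λ_μ`, with `μ` uniform on a finite set of irreducible corepresentations, this gives a vector of
`L²(G)` almost fixed by an average of normalised characters. The diagonal coefficients of a unitary
corepresentation are contractions, so each of them almost fixes the vector, and then so do, up to
the counit, all coefficients (`hasAlmostInvariantVectors_of_isAmenableFusion`). The isometry
`x ⊗ b ↦ Δ(x)(1 ⊗ b)` intertwines `a ⊗ 1` with `Δ(a)`; therefore `(π_h ⊗ id)Δ(a)` has norm at most
`‖π_h(a)‖`, while its slices by almost invariant vectors tend to `a` in `C_u(G)`. This proves
`‖a‖_u ≤ ‖π_h(a)‖` (`HasAlmostInvariantVectors.norm_toCu_le`), i.e. injectivity of `π_h`.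

*(iii) ⇒ (ii).* The counit always extends to `C_u(G)` (`exists_counit_extension`).

*(ii) ⇒ (i).* A character of `C_r(G)` extending the counit gives `|ε(a)| ≤ ‖π_h(a)‖`
(`norm_counit_le_of_character`). For cocommutative `a`, the norm of `π_h(a)` equals the norm of its
restriction to `ℓ²(I)` (`norm_redRep_le_norm_fusionRep`): the growth of `‖π_h(a* a)ⁿ ξ‖` for `ξ` in
`ℂ[G]` is controlled by that for `ξ = 1`, which lies in `ℓ²(I)`. For the finite sums
`a = 1 + ∑ (μ(j) / dim U_j) χ_j` the counit is `1 + ∑ μ(j)`, so `‖1 + λ_μ‖ = 2` in the limit.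
-/

noncomputable section

namespace CQG

universe u

/-! ### Unitary corepresentations -/

section CorepAlgebra

variable {A : Type u} [Ring A] [StarRing A] [HopfAlgebra ℂ A]
variable {ι κ : Type*} [Fintype ι] [Fintype κ] [DecidableEq ι] [DecidableEq κ]

namespace IsUnitaryCorep

variable {U : Matrix ι ι A} {V : Matrix κ κ A}

lemma sum_star_mul (hU : IsUnitaryCorep U) (i j : ι) :
    ∑ k, star (U k i) * U k j = if i = j then 1 else 0 := by
  have h0 : star U * U = 1 := Unitary.star_mul_self_of_mem hU.unitary
  have h := congrFun (congrFun h0 i) j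
  simpa [Matrix.mul_apply, Matrix.star_apply, Matrix.one_apply] using h

lemma sum_mul_star (hU : IsUnitaryCorep U) (i j : ι) :
    ∑ k, U i k * star (U j k) = if i = j then 1 else 0 := by
  have h0 : U * star U = 1 := Unitary.mul_star_self_of_mem hU.unitary
  have h := congrFun (congrFun h0 i) j
  simpa [Matrix.mul_apply, Matrix.star_apply, Matrix.one_apply] using h

lemma of_sums (h1 : ∀ i j, ∑ k, star (U k i) * U k j = if i = j then 1 else 0)
    (h2 : ∀ i j, ∑ k, U i k * star (U j k) = if i = j then 1 else 0)
    (h3 : ∀ i j, Coalgebra.comul (R := ℂ) (U i j) = ∑ k, U i k ⊗ₜ[ℂ] U k j) :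
    IsUnitaryCorep U := by
  refine ⟨Unitary.mem_iff.2 ⟨?_, ?_⟩, h3⟩
  · ext i j; simpa [Matrix.mul_apply, Matrix.star_apply, Matrix.one_apply] using h1 i j
  · ext i j; simpa [Matrix.mul_apply, Matrix.star_apply, Matrix.one_apply] using h2 i j

/-- Cancellation of `U` on the right: its entries satisfy `∑ k, x k * u k j = y j` for at most one
row `x`. -/
lemma row_ext (hU : IsUnitaryCorep U) {x y : ι → A}
    (h : ∀ j, ∑ k, x k * U k j = ∑ k, y k * U k j) : x = y := by
  have h' : Matrix.vecMul x U = Matrix.vecMul y U := by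
    ext j; simpa [Matrix.vecMul, dotProduct] using h j
  have := congrArg (fun v => Matrix.vecMul v (star U)) h'
  simpa [Matrix.vecMul_vecMul, Unitary.mul_star_self_of_mem hU.unitary] using this

lemma counit_apply (hU : IsUnitaryCorep U) (i j : ι) :
    Coalgebra.counit (R := ℂ) (U i j) = if i = j then 1 else 0 := by
  have key : ∀ i, (fun k => algebraMap ℂ A (Coalgebra.counit (R := ℂ) (U i k))) =
      fun k => if i = k then 1 else 0 := by
    intro i
    refine hU.row_ext fun j => ?_
    have h := Coalgebra.rTensor_counit_comul (R := ℂ) (U i j)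
    rw [hU.comul] at h
    have h2 := congrArg (TensorProduct.lid ℂ A) h
    simpa [Algebra.smul_def] using h2
  have h := congrFun (key i) j
  have h2 := congrArg (Coalgebra.counit (R := ℂ)) h
  by_cases hij : i = j
  · simpa [hij] using h2
  · simpa [hij] using h2

lemma antipode_apply (hU : IsUnitaryCorep U) (i j : ι) :
    HopfAlgebra.antipode ℂ (U i j) = star (U j i) := by
  have key : (fun k => HopfAlgebra.antipode ℂ (U i k)) = fun k => star (U k i) := by
    refine hU.row_ext fun j => ?_
    have h := HopfAlgebra.mul_antipode_rTensor_comul_apply (R := ℂ) (U i j)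
    rw [hU.comul, hU.counit_apply] at h
    rw [hU.sum_star_mul]
    simpa [apply_ite] using h
  exact congrFun key j

lemma reindex (hU : IsUnitaryCorep U) (e : κ ≃ ι) : IsUnitaryCorep (U.submatrix e e) := by
  refine of_sums (fun i j => ?_) (fun i j => ?_) (fun i j => ?_)
  · simpa using (Equiv.sum_comp e (fun k => star (U k (e i)) * U k (e j))).trans
      (hU.sum_star_mul _ _)
  · simpa using (Equiv.sum_comp e (fun k => U (e i) k * star (U (e j) k))).trans
      (hU.sum_mul_star _ _)
  · simpa using (hU.comul (e i) (e j)).trans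
      (Equiv.sum_comp e (fun k => U (e i) k ⊗ₜ[ℂ] U k (e j))).symm

lemma directSum (hU : IsUnitaryCorep U) (hV : IsUnitaryCorep V) :
    IsUnitaryCorep (Matrix.fromBlocks U 0 0 V) := by
  refine of_sums ?_ ?_ ?_
  · rintro (i | i) (j | j) <;> simp [hU.sum_star_mul, hV.sum_star_mul]
  · rintro (i | i) (j | j) <;> simp [hU.sum_mul_star, hV.sum_mul_star]
  · rintro (i | i) (j | j) <;> simp [hU.comul, hV.comul]

lemma tensor (hU : IsUnitaryCorep U) (hV : IsUnitaryCorep V) :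
    IsUnitaryCorep (tensorCorep U V) := by
  refine of_sums ?_ ?_ ?_
  · rintro ⟨i, i'⟩ ⟨j, j'⟩
    simp only [tensorCorep, star_mul, Fintype.sum_prod_type_right, Prod.mk.injEq]
    have : ∀ y, ∑ x, star (V y i') * star (U x i) * (U x j * V y j') =
        star (V y i') * ((if i = j then 1 else 0) * V y j') := by
      intro y
      rw [← hU.sum_star_mul, Finset.sum_mul, Finset.mul_sum]
      exact Finset.sum_congr rfl fun x _ => by noncomm_ring
    simp only [this]
    by_cases h : i = j <;> simp [h, hV.sum_star_mul]
  · rintro ⟨i, i'⟩ ⟨j, j'⟩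
    simp only [tensorCorep, star_mul, Fintype.sum_prod_type, Prod.mk.injEq]
    have : ∀ x, ∑ y, U i x * V i' y * (star (V j' y) * star (U j x)) =
        U i x * ((if i' = j' then 1 else 0) * star (U j x)) := by
      intro x
      rw [← hV.sum_mul_star, Finset.sum_mul, Finset.mul_sum]
      exact Finset.sum_congr rfl fun x _ => by noncomm_ring
    simp only [this]
    by_cases h : i' = j' <;> simp [h, hU.sum_mul_star]
  · rintro ⟨i, i'⟩ ⟨j, j'⟩
    simp only [tensorCorep, Bialgebra.comul_mul, hU.comul, hV.comul, Finset.sum_mul,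
      Finset.mul_sum, Algebra.TensorProduct.tmul_mul_tmul, Fintype.sum_prod_type]
    exact Finset.sum_comm

/-- A unitary corepresentation that is block diagonal with respect to a predicate on the index set
restricts to a unitary corepresentation on each block. -/
lemma restrict (hU : IsUnitaryCorep U) (p : ι → Prop) [DecidablePred p]
    (h1 : ∀ i j, p i → ¬ p j → U i j = 0) (h2 : ∀ i j, p i → ¬ p j → U j i = 0) :
    IsUnitaryCorep (U.submatrix (Subtype.val : {i // p i} → ι) Subtype.val) := by
  have key : ∀ {M : Type u} [AddCommMonoid M] (f : ι → M), (∀ i, ¬ p i → f i = 0) →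
      ∑ k : {i // p i}, f k = ∑ k, f k := by
    intro M _ f hf
    rw [← Finset.sum_subtype (p := p) (Finset.univ.filter p) (by simp) f]
    refine Finset.sum_filter_of_ne fun x _ hx => ?_
    by_contra h
    exact hx (hf x h)
  refine of_sums (fun i j => ?_) (fun i j => ?_) (fun i j => ?_)
  · refine (key (fun k => star (U k i) * U k j) fun k hk => ?_).trans ?_
    · simp [h2 _ _ j.2 hk]
    · simp [hU.sum_star_mul, Subtype.ext_iff]
  · refine (key (fun k => U i k * star (U j k)) fun k hk => ?_).trans ?_
    · simp [h1 _ _ i.2 hk]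
    · simp [hU.sum_mul_star, Subtype.ext_iff]
  · refine (hU.comul i j).trans (key (fun k => U i k ⊗ₜ[ℂ] U k j) fun k hk => ?_).symm
    simp [h1 _ _ i.2 hk]

/-- Conjugation by a scalar unitary matrix. -/
lemma conj [StarModule ℂ A] (hU : IsUnitaryCorep U) {W : Matrix ι ι ℂ}
    (hW : W ∈ _root_.unitary (Matrix ι ι ℂ)) :
    IsUnitaryCorep ((star W).map (algebraMap ℂ A) * U * W.map (algebraMap ℂ A)) := by
  have hs : star (W.map (algebraMap ℂ A)) = (star W).map (algebraMap ℂ A) := by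
    ext i j; exact (algebraMap_star_comm (A := A) (W j i)).symm
  have hm : ∀ X Y : Matrix ι ι ℂ, X.map (algebraMap ℂ A) * Y.map (algebraMap ℂ A) =
      (X * Y).map (algebraMap ℂ A) := fun X Y => by rw [Matrix.map_mul]
  have hWA : W.map (algebraMap ℂ A) ∈ _root_.unitary (Matrix ι ι A) := by
    rw [Unitary.mem_iff, hs, hm, hm, Unitary.star_mul_self_of_mem hW,
      Unitary.mul_star_self_of_mem hW]
    simp
  refine ⟨?_, fun i j => ?_⟩
  · rw [← hs]
    exact mul_mem (mul_mem (Unitary.star_mem hWA) hU.unitary) hWA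
  · have e : ∀ i j, ((star W).map (algebraMap ℂ A) * U * W.map (algebraMap ℂ A)) i j =
        ∑ b, ∑ a, (star W i a * W b j) • U a b := by
      intro i j
      simp only [Matrix.mul_apply, Matrix.map_apply, Finset.sum_mul]
      refine Finset.sum_congr rfl fun b _ => Finset.sum_congr rfl fun a _ => ?_
      rw [← Algebra.smul_def, ← Algebra.commutes, ← Algebra.smul_def, smul_smul, mul_comm]
    have hWW : ∀ b c, ∑ k, W b k * star W k c = if b = c then 1 else 0 := by
      intro b c
      have h0 : W * star W = 1 := Unitary.mul_star_self_of_mem hW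
      have := congrFun (congrFun h0 b) c
      simpa [Matrix.mul_apply, Matrix.one_apply] using this
    simp only [e, map_sum, map_smul, hU.comul, TensorProduct.sum_tmul, TensorProduct.tmul_sum,
      TensorProduct.smul_tmul', TensorProduct.tmul_smul, smul_smul, Finset.smul_sum]
    symm
    calc ∑ k, ∑ d, ∑ c, ∑ b, ∑ a, (star W k c * W d j * (star W i a * W b k)) • (U a b ⊗ₜ[ℂ] U c d)
        = ∑ d, ∑ a, ∑ c, ∑ b, (star W i a * W d j * ∑ k, W b k * star W k c) •
            (U a b ⊗ₜ[ℂ] U c d) := by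
          rw [Finset.sum_comm]
          refine Finset.sum_congr rfl fun d _ => ?_
          rw [Finset.sum_comm, Finset.sum_comm (s := Finset.univ (α := ι)) (t := Finset.univ)
            (f := fun a c => ∑ b, (star W i a * W d j * ∑ k, W b k * star W k c) •
              (U a b ⊗ₜ[ℂ] U c d))]
          refine Finset.sum_congr rfl fun c _ => ?_
          rw [Finset.sum_comm, Finset.sum_comm (f := fun a b =>
            (star W i a * W d j * ∑ k, W b k * star W k c) • (U a b ⊗ₜ[ℂ] U c d))]
          refine Finset.sum_congr rfl fun b _ => ?_
          rw [Finset.sum_comm]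
          refine Finset.sum_congr rfl fun a _ => ?_
          rw [Finset.mul_sum, Finset.sum_smul]
          exact Finset.sum_congr rfl fun k _ => by congr 1; ring
      _ = _ := by
          simp only [hWW]
          simp [TensorProduct.smul_tmul']

end IsUnitaryCorep

/-- The span of the matrix coefficients. -/
def coeffSpan (U : Matrix ι ι A) : Submodule ℂ A :=
  Submodule.span ℂ (Set.range fun p : ι × ι => U p.1 p.2)

lemma mem_coeffSpan (U : Matrix ι ι A) (i j : ι) : U i j ∈ coeffSpan U :=
  Submodule.subset_span ⟨(i, j), rfl⟩

lemma coeffSpan_le {U : Matrix ι ι A} {N : Submodule ℂ A} : coeffSpan U ≤ N ↔ ∀ i j, U i j ∈ N := by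
  rw [coeffSpan, Submodule.span_le]
  exact ⟨fun h i j => h ⟨(i, j), rfl⟩, by rintro h _ ⟨p, rfl⟩; exact h _ _⟩

variable [StarModule ℂ A] [CompactQuantumGroup A]

variable (A) in
/-- Finitely many elements of `A` are coefficients of one unitary corepresentation. -/
lemma exists_isUnitaryCorep_forall_mem (S : Finset A) :
    ∃ (n : ℕ) (U : Matrix (Fin n) (Fin n) A), IsUnitaryCorep U ∧ ∀ a ∈ S, a ∈ coeffSpan U := by
  classical
  have join : ∀ {m n : ℕ} {U : Matrix (Fin m) (Fin m) A} {V : Matrix (Fin n) (Fin n) A},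
      IsUnitaryCorep U → IsUnitaryCorep V → ∃ W : Matrix (Fin (m + n)) (Fin (m + n)) A,
        IsUnitaryCorep W ∧ coeffSpan U ≤ coeffSpan W ∧ coeffSpan V ≤ coeffSpan W := by
    intro m n U V hU hV
    refine ⟨_, (hU.directSum hV).reindex finSumFinEquiv.symm, coeffSpan_le.2 fun i j => ?_,
      coeffSpan_le.2 fun i j => ?_⟩
    · simpa using mem_coeffSpan ((Matrix.fromBlocks U 0 0 V).submatrix finSumFinEquiv.symm
        finSumFinEquiv.symm) (finSumFinEquiv (Sum.inl i)) (finSumFinEquiv (Sum.inl j))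
    · simpa using mem_coeffSpan ((Matrix.fromBlocks U 0 0 V).submatrix finSumFinEquiv.symm
        finSumFinEquiv.symm) (finSumFinEquiv (Sum.inr i)) (finSumFinEquiv (Sum.inr j))
  have triv : ∃ (n : ℕ) (U : Matrix (Fin n) (Fin n) A), IsUnitaryCorep U :=
    ⟨0, 0, IsUnitaryCorep.of_sums (fun i => i.elim0) (fun i => i.elim0) fun i => i.elim0⟩
  have single : ∀ a : A, ∃ (n : ℕ) (U : Matrix (Fin n) (Fin n) A),
      IsUnitaryCorep U ∧ a ∈ coeffSpan U := by
    intro a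
    have ha : a ∈ Submodule.span ℂ {a : A | ∃ (n : ℕ) (U : Matrix (Fin n) (Fin n) A),
        IsUnitaryCorep U ∧ ∃ i j, a = U i j} := by
      rw [CompactQuantumGroup.span_coeff]; trivial
    induction ha using Submodule.span_induction with
    | mem a h =>
      obtain ⟨n, U, hU, i, j, rfl⟩ := h
      exact ⟨n, U, hU, mem_coeffSpan U i j⟩
    | zero =>
      obtain ⟨n, U, hU⟩ := triv
      exact ⟨n, U, hU, zero_mem _⟩
    | add x y _ _ hx hy =>
      obtain ⟨m, U, hU, hx⟩ := hx
      obtain ⟨n, V, hV, hy⟩ := hy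
      obtain ⟨W, hW, h1, h2⟩ := join hU hV
      exact ⟨_, W, hW, add_mem (h1 hx) (h2 hy)⟩
    | smul c x _ hx =>
      obtain ⟨m, U, hU, hx⟩ := hx
      exact ⟨_, U, hU, Submodule.smul_mem _ c hx⟩
  induction S using Finset.induction_on with
  | empty =>
    obtain ⟨n, U, hU⟩ := triv
    exact ⟨n, U, hU, by simp⟩
  | insert a S _ ih =>
    obtain ⟨m, U, hU, hS⟩ := ih
    obtain ⟨n, V, hV, ha⟩ := single a
    obtain ⟨W, hW, h1, h2⟩ := join hU hV
    refine ⟨_, W, hW, fun b hb => ?_⟩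
    rcases Finset.mem_insert.1 hb with rfl | hb
    · exact h2 ha
    · exact h1 (hS b hb)

/-- The counit is a `*`-map: `a ↦ conj ε(a*)` is a counit as well. -/
lemma counit_star (a : A) :
    Coalgebra.counit (R := ℂ) (star a) = star (Coalgebra.counit (R := ℂ) a) := by
  have ha : a ∈ Submodule.span ℂ {a : A | ∃ (n : ℕ) (U : Matrix (Fin n) (Fin n) A),
      IsUnitaryCorep U ∧ ∃ i j, a = U i j} := by
    rw [CompactQuantumGroup.span_coeff]; trivial
  induction ha using Submodule.span_induction with
  | mem a h =>
    obtain ⟨n, U, hU, i, j, rfl⟩ := h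
    have key : (fun k => algebraMap ℂ A (star (Coalgebra.counit (R := ℂ) (star (U i k))))) =
        fun k => if i = k then 1 else 0 := by
      refine hU.row_ext fun j => ?_
      have h := Coalgebra.rTensor_counit_comul (R := ℂ) (star (U i j))
      rw [CompactQuantumGroup.comul_star, hU.comul] at h
      have h2 := congrArg (fun t => star (TensorProduct.lid ℂ A t)) h
      simpa [← Algebra.smul_def] using h2
    have h := congrFun key j
    have h2 := congrArg (fun x => star (Coalgebra.counit (R := ℂ) x)) h
    rw [hU.counit_apply]
    by_cases hij : i = j
    · simpa [hij] using h2
    · simpa [hij] using h2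
  | zero => simp
  | add x y _ _ hx hy => simp [hx, hy]
  | smul c x _ hx => simp [hx]

end CorepAlgebra

/-! ### The Haar functional -/

section HaarFunctional

open scoped ComplexOrder

variable {A : Type u} [Ring A] [StarRing A] [HopfAlgebra ℂ A]

/-- The subspace of elements of `A` on which the functional `f` is left and right invariant. -/
def invariantPart (f : A →ₗ[ℂ] ℂ) : Submodule ℂ A where
  carrier := {a | TensorProduct.rid ℂ A (f.lTensor A (Coalgebra.comul (R := ℂ) a)) = f a • (1 : A) ∧
    TensorProduct.lid ℂ A (f.rTensor A (Coalgebra.comul (R := ℂ) a)) = f a • (1 : A)}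
  add_mem' := by
    rintro a b ⟨h1, h2⟩ ⟨h3, h4⟩
    simp only [Set.mem_ofPred_eq, map_add, h1, h2, h3, h4, add_smul, and_self]
  zero_mem' := by simp
  smul_mem' := by
    rintro c a ⟨h1, h2⟩
    simp only [Set.mem_ofPred_eq, map_smul, h1, h2, smul_assoc, and_self]

lemma mem_invariantPart {f : A →ₗ[ℂ] ℂ} {a : A} : a ∈ invariantPart f ↔
    TensorProduct.rid ℂ A (f.lTensor A (Coalgebra.comul (R := ℂ) a)) = f a • (1 : A) ∧
    TensorProduct.lid ℂ A (f.rTensor A (Coalgebra.comul (R := ℂ) a)) = f a • (1 : A) := Iff.rfl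

/-- Two normalised functionals agree where both are invariant: evaluate `f ⊗ g` on `Δ(a)`. -/
lemma apply_eq_of_mem_invariantPart {f g : A →ₗ[ℂ] ℂ} (hf : f 1 = 1) (hg : g 1 = 1) {a : A}
    (haf : a ∈ invariantPart f) (hag : a ∈ invariantPart g) : f a = g a := by
  have e3 : ∀ t : A ⊗[ℂ] A, f (TensorProduct.rid ℂ A (g.lTensor A t)) =
      g (TensorProduct.lid ℂ A (f.rTensor A t)) := by
    intro t
    induction t using TensorProduct.induction_on with
    | zero => simp
    | tmul x y => simp [mul_comm]
    | add x y hx hy => simp only [map_add, hx, hy]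
  have := e3 (Coalgebra.comul (R := ℂ) a)
  rw [hag.1, haf.2] at this
  simpa [hf, hg] using this.symm

section Matrix

variable {ι : Type*} [Fintype ι] [DecidableEq ι]

/-- The matrix `(id ⊗ f)(U)`. -/
def sliceMatrix (U : Matrix ι ι A) : (A →ₗ[ℂ] ℂ) →ₗ[ℂ] Matrix ι ι ℂ where
  toFun f := Matrix.of fun i j => f (U i j)
  map_add' f g := by ext; simp
  map_smul' c f := by ext; simp

lemma sliceMatrix_apply (U : Matrix ι ι A) (f : A →ₗ[ℂ] ℂ) (i j : ι) :
    sliceMatrix U f i j = f (U i j) := rfl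

/-- The convolution product of functionals. -/
def conv (f g : A →ₗ[ℂ] ℂ) : A →ₗ[ℂ] ℂ :=
  LinearMap.mul' ℂ ℂ ∘ₗ TensorProduct.map f g ∘ₗ Coalgebra.comul

lemma sliceMatrix_conv {U : Matrix ι ι A} (hU : IsUnitaryCorep U) (f g : A →ₗ[ℂ] ℂ) :
    sliceMatrix U (conv f g) = sliceMatrix U f * sliceMatrix U g := by
  ext i j
  simp [sliceMatrix_apply, conv, hU.comul, Matrix.mul_apply]

lemma conv_one (f g : A →ₗ[ℂ] ℂ) : conv f g 1 = f 1 * g 1 := by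
  simp [conv, Algebra.TensorProduct.one_def]

variable [StarModule ℂ A]

/-- The functional `a ↦ conj (f (S(a)*))`. -/
def dualStar (f : A →ₗ[ℂ] ℂ) : A →ₗ[ℂ] ℂ where
  toFun a := star (f (star (HopfAlgebra.antipode ℂ a)))
  map_add' a b := by simp
  map_smul' c a := by simp

lemma sliceMatrix_dualStar {U : Matrix ι ι A} (hU : IsUnitaryCorep U) (f : A →ₗ[ℂ] ℂ) :
    sliceMatrix U (dualStar f) = (sliceMatrix U f).conjTranspose := by
  ext i j
  change star (f (star (HopfAlgebra.antipode ℂ (U i j)))) = _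
  rw [hU.antipode_apply, star_star]
  rfl

/-- Orthogonal decomposition with respect to the trace form on matrices. -/
lemma exists_sub_orthogonal_of_submodule (J : Submodule ℂ (Matrix ι ι ℂ)) (e : Matrix ι ι ℂ) :
    ∃ y ∈ J, ∀ x ∈ J, (x * (e - y).conjTranspose).trace = 0 := by
  let _ : NormedAddCommGroup (Matrix ι ι ℂ) :=
    Matrix.toMatrixNormedAddCommGroup (1 : Matrix ι ι ℂ) Matrix.PosDef.one
  let _ : InnerProductSpace ℂ (Matrix ι ι ℂ) :=
    Matrix.toMatrixInnerProductSpace (1 : Matrix ι ι ℂ) Matrix.PosSemidef.one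
  obtain ⟨y, hy, z, hz, rfl⟩ := J.exists_add_mem_mem_orthogonal e
  refine ⟨y, hy, fun x hx => ?_⟩
  have h : inner ℂ z x = (0 : ℂ) := by
    rw [← inner_conj_symm, (J.mem_orthogonal z).1 hz x hx, map_zero]
  have h2 : (x * (1 : Matrix ι ι ℂ) * z.conjTranspose).trace = 0 := h
  simpa using h2

/-- For a unitary corepresentation `U` there is a normalised functional invariant on the
coefficients of `U`: in the `*`-algebra of all matrices `(id ⊗ f)(U)`, the component of `1`
orthogonal to the two-sided ideal `{(id ⊗ f)(U) | f(1) = 0}` is annihilated by that ideal. -/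
lemma IsUnitaryCorep.exists_invariant {U : Matrix ι ι A} (hU : IsUnitaryCorep U) :
    ∃ f : A →ₗ[ℂ] ℂ, f 1 = 1 ∧ ∀ i j, U i j ∈ invariantPart f := by
  let J : Submodule ℂ (Matrix ι ι ℂ) :=
    (LinearMap.ker (LinearMap.applyₗ (1 : A) : (A →ₗ[ℂ] ℂ) →ₗ[ℂ] ℂ)).map (sliceMatrix U)
  have memJ : ∀ f : A →ₗ[ℂ] ℂ, f 1 = 0 → sliceMatrix U f ∈ J := fun f hf => ⟨f, hf, rfl⟩
  obtain ⟨y, ⟨g, hg, rfl⟩, hy⟩ := exists_sub_orthogonal_of_submodule J 1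
  have hg : g 1 = 0 := hg
  have hε : sliceMatrix U (Coalgebra.counit (R := ℂ)) = 1 := by
    ext i j
    rw [sliceMatrix_apply, hU.counit_apply, Matrix.one_apply]
  let f₀ : A →ₗ[ℂ] ℂ := Coalgebra.counit (R := ℂ) - g
  have hf₀ : f₀ 1 = 1 := by simp [f₀, hg]
  have hx : 1 - sliceMatrix U g = sliceMatrix U f₀ := by simp [f₀, hε]
  rw [hx] at hy
  have hJ0 : ∀ m ∈ J, (∀ x ∈ J, (x * m.conjTranspose).trace = 0) → m = 0 := fun m hm h => by
    have := h m hm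
    rwa [Matrix.trace_mul_conjTranspose_self_eq_zero_iff] at this
  have hl : ∀ f : A →ₗ[ℂ] ℂ, f 1 = 0 → sliceMatrix U f * sliceMatrix U f₀ = 0 := by
    intro f hf
    refine hJ0 _ ?_ ?_
    · rw [← sliceMatrix_conv hU]
      exact memJ _ (by rw [conv_one, hf, zero_mul])
    · rintro _ ⟨k, hk, rfl⟩
      have hk : k 1 = 0 := hk
      rw [Matrix.conjTranspose_mul, ← Matrix.mul_assoc, Matrix.trace_mul_comm, ← Matrix.mul_assoc,
        ← sliceMatrix_dualStar hU f, ← sliceMatrix_conv hU]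
      exact hy _ (memJ _ (by rw [conv_one, hk, mul_zero]))
  have hr : ∀ f : A →ₗ[ℂ] ℂ, f 1 = 0 → sliceMatrix U f₀ * sliceMatrix U f = 0 := by
    intro f hf
    refine hJ0 _ ?_ ?_
    · rw [← sliceMatrix_conv hU]
      exact memJ _ (by rw [conv_one, hf, mul_zero])
    · rintro _ ⟨k, hk, rfl⟩
      have hk : k 1 = 0 := hk
      rw [Matrix.conjTranspose_mul, ← Matrix.mul_assoc,
        ← sliceMatrix_dualStar hU f, ← sliceMatrix_conv hU]
      exact hy _ (memJ _ (by rw [conv_one, hk, zero_mul]))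
  have hl' : ∀ f : A →ₗ[ℂ] ℂ, sliceMatrix U f * sliceMatrix U f₀ = f 1 • sliceMatrix U f₀ := by
    intro f
    have := hl (f - f 1 • Coalgebra.counit (R := ℂ)) (by simp)
    rw [(sliceMatrix U).map_sub, map_smul, hε, sub_mul, smul_mul_assoc, one_mul, sub_eq_zero] at this
    exact this
  have hr' : ∀ f : A →ₗ[ℂ] ℂ, sliceMatrix U f₀ * sliceMatrix U f = f 1 • sliceMatrix U f₀ := by
    intro f
    have := hr (f - f 1 • Coalgebra.counit (R := ℂ)) (by simp)
    rw [(sliceMatrix U).map_sub f, map_smul, hε, mul_sub, mul_smul_comm, mul_one, sub_eq_zero] at this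
    exact this
  refine ⟨f₀, hf₀, fun i j => mem_invariantPart.2 ⟨?_, ?_⟩⟩
  · rw [← sub_eq_zero, ← Module.forall_dual_apply_eq_zero_iff ℂ]
    intro f
    have := congrFun (congrFun (hl' f) i) j
    rw [Matrix.mul_apply] at this
    simp only [sliceMatrix_apply, Matrix.smul_apply, smul_eq_mul] at this
    rw [hU.comul]
    simp only [map_sum, LinearMap.lTensor_tmul, TensorProduct.rid_tmul, map_sub, map_smul,
      smul_eq_mul, sub_eq_zero]
    rw [mul_comm, ← this]
    exact Finset.sum_congr rfl fun k _ => mul_comm _ _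
  · rw [← sub_eq_zero, ← Module.forall_dual_apply_eq_zero_iff ℂ]
    intro f
    have := congrFun (congrFun (hr' f) i) j
    rw [Matrix.mul_apply] at this
    simp only [sliceMatrix_apply, Matrix.smul_apply, smul_eq_mul] at this
    rw [hU.comul]
    simp only [map_sum, LinearMap.rTensor_tmul, TensorProduct.lid_tmul, map_sub, map_smul,
      smul_eq_mul, sub_eq_zero]
    rw [mul_comm, ← this]

end Matrix

variable [StarModule ℂ A] [CompactQuantumGroup A]

variable (A) in
lemma exists_haarFun : ∃ h : A →ₗ[ℂ] ℂ, h 1 = 1 ∧ ∀ a, a ∈ invariantPart h := by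
  classical
  have key : ∀ S : Finset A, ∃ f : A →ₗ[ℂ] ℂ, f 1 = 1 ∧ ∀ a ∈ S, a ∈ invariantPart f := by
    intro S
    obtain ⟨n, U, hU, hS⟩ := exists_isUnitaryCorep_forall_mem A S
    obtain ⟨f, hf1, hf⟩ := hU.exists_invariant
    exact ⟨f, hf1, fun a ha => coeffSpan_le.2 hf (hS a ha)⟩
  choose F hF1 hF using key
  have agree : ∀ (S : Finset A) (a : A), a ∈ S → F {a} a = F S a := fun S a ha =>
    apply_eq_of_mem_invariantPart (hF1 _) (hF1 _) (hF {a} a (Finset.mem_singleton_self a)) (hF S a ha)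
  let h : A →ₗ[ℂ] ℂ :=
    { toFun := fun a => F {a} a
      map_add' := fun a b => by
        rw [agree {a, b, a + b} a (by simp), agree {a, b, a + b} b (by simp),
          agree {a, b, a + b} (a + b) (by simp), map_add]
      map_smul' := fun c a => by
        rw [agree {a, c • a} a (by simp), agree {a, c • a} (c • a) (by simp), map_smul]
        rfl }
  refine ⟨h, hF1 _, fun a => ?_⟩
  -- `Δ(a)` involves only the coefficients of a corepresentation containing `a`, and on these `h`
  -- coincides with an invariant functional.
  obtain ⟨n, U, hU, ha⟩ := exists_isUnitaryCorep_forall_mem A {a}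
  refine coeffSpan_le.2 (fun i j => ?_) (ha a (Finset.mem_singleton_self a))
  let S : Finset A := Finset.univ.image fun p : Fin n × Fin n => U p.1 p.2
  have hmem : ∀ i j, U i j ∈ S := fun i j => Finset.mem_image.2 ⟨(i, j), Finset.mem_univ _, rfl⟩
  have hval : ∀ i j, h (U i j) = F S (U i j) := fun i j => agree S _ (hmem i j)
  have := hF S _ (hmem i j)
  rw [mem_invariantPart, hU.comul] at this ⊢
  simpa [hval] using this

variable (A) in
/-- The Haar functional on `A`. -/
def haarFun : A →ₗ[ℂ] ℂ := (exists_haarFun A).choose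

lemma haarFun_one : haarFun A 1 = 1 := (exists_haarFun A).choose_spec.1

lemma haarFun_right_inv (a : A) : TensorProduct.rid ℂ A ((haarFun A).lTensor A
    (Coalgebra.comul (R := ℂ) a)) = haarFun A a • (1 : A) :=
  ((exists_haarFun A).choose_spec.2 a).1

lemma haarFun_left_inv (a : A) : TensorProduct.lid ℂ A ((haarFun A).rTensor A
    (Coalgebra.comul (R := ℂ) a)) = haarFun A a • (1 : A) :=
  ((exists_haarFun A).choose_spec.2 a).2

lemma eq_haarFun {f : A →ₗ[ℂ] ℂ} (h1 : f 1 = 1) (hf : ∀ a, a ∈ invariantPart f) :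
    f = haarFun A :=
  LinearMap.ext fun a => apply_eq_of_mem_invariantPart h1 haarFun_one (hf a)
    ((exists_haarFun A).choose_spec.2 a)

lemma haarFun_star (a : A) : haarFun A (star a) = star (haarFun A a) := by
  let f : A →ₗ[ℂ] ℂ :=
    { toFun := fun a => star (haarFun A (star a))
      map_add' := fun a b => by simp
      map_smul' := fun c a => by simp }
  have happ : ∀ a, f a = star (haarFun A (star a)) := fun a => rfl
  have hr : ∀ t : A ⊗[ℂ] A, TensorProduct.rid ℂ A (f.lTensor A t) =
      star (TensorProduct.rid ℂ A ((haarFun A).lTensor A (star t))) := by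
    intro t
    induction t using TensorProduct.induction_on with
    | zero => simp
    | tmul x y => simp [happ]
    | add x y hx hy => simp only [map_add, star_add, hx, hy]
  have hl : ∀ t : A ⊗[ℂ] A, TensorProduct.lid ℂ A (f.rTensor A t) =
      star (TensorProduct.lid ℂ A ((haarFun A).rTensor A (star t))) := by
    intro t
    induction t using TensorProduct.induction_on with
    | zero => simp
    | tmul x y => simp [happ]
    | add x y hx hy => simp only [map_add, star_add, hx, hy]
  have hf : f = haarFun A := by
    refine eq_haarFun (by simp [happ, haarFun_one]) fun a => mem_invariantPart.2 ⟨?_, ?_⟩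
    · rw [hr, ← CompactQuantumGroup.comul_star, haarFun_right_inv, star_smul, star_one, happ]
    · rw [hl, ← CompactQuantumGroup.comul_star, haarFun_left_inv, star_smul, star_one, happ]
  have := happ a
  rw [hf] at this
  rw [this, star_star]

end HaarFunctional

/-! ### Intertwiners and orthogonality relations -/

section Orthogonality

open scoped ComplexOrder

variable {A : Type u} [Ring A] [StarRing A] [HopfAlgebra ℂ A]
variable {ι κ : Type*} [Fintype ι] [Fintype κ]

lemma mem_intertwiners_iff {U : Matrix ι ι A} {V : Matrix κ κ A} {T : Matrix κ ι ℂ} :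
    T ∈ intertwiners U V ↔ ∀ k j, ∑ i, T k i • U i j = ∑ l, T l j • V k l := by
  change T.map (algebraMap ℂ A) * U = V * T.map (algebraMap ℂ A) ↔ _
  rw [← Matrix.ext_iff]
  refine forall_congr' fun k => forall_congr' fun j => ?_
  simp only [Matrix.mul_apply, Matrix.map_apply, ← Algebra.commutes, ← Algebra.smul_def]

lemma one_mem_intertwiners [DecidableEq ι] (U : Matrix ι ι A) :
    (1 : Matrix ι ι ℂ) ∈ intertwiners U U := by
  rw [mem_intertwiners_iff]
  intro k j
  simp [Matrix.one_apply, ite_smul]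

lemma map_algebraMap_conjTranspose [StarModule ℂ A] (T : Matrix κ ι ℂ) :
    (T.map (algebraMap ℂ A)).conjTranspose = T.conjTranspose.map (algebraMap ℂ A) := by
  ext i j
  exact (algebraMap_star_comm (A := A) (T j i)).symm

lemma conjTranspose_mem_intertwiners [StarModule ℂ A] [DecidableEq ι] [DecidableEq κ]
    {U : Matrix ι ι A} {V : Matrix κ κ A} (hU : IsUnitaryCorep U) (hV : IsUnitaryCorep V)
    {T : Matrix κ ι ℂ} (hT : T ∈ intertwiners U V) : T.conjTranspose ∈ intertwiners V U := by
  change T.map (algebraMap ℂ A) * U = V * T.map (algebraMap ℂ A) at hT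
  change T.conjTranspose.map (algebraMap ℂ A) * V = U * T.conjTranspose.map (algebraMap ℂ A)
  have h1 := congrArg Matrix.conjTranspose hT
  rw [Matrix.conjTranspose_mul, Matrix.conjTranspose_mul, map_algebraMap_conjTranspose] at h1
  have hU' : U * U.conjTranspose = 1 := Unitary.mul_star_self_of_mem hU.unitary
  have hV' : V.conjTranspose * V = 1 := Unitary.star_mul_self_of_mem hV.unitary
  calc T.conjTranspose.map (algebraMap ℂ A) * V
      = (U * U.conjTranspose) * T.conjTranspose.map (algebraMap ℂ A) * V := by rw [hU', Matrix.one_mul]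
    _ = U * (U.conjTranspose * T.conjTranspose.map (algebraMap ℂ A)) * V := by
        simp only [Matrix.mul_assoc]
    _ = U * T.conjTranspose.map (algebraMap ℂ A) * (V.conjTranspose * V) := by
        rw [h1]; simp only [Matrix.mul_assoc]
    _ = _ := by rw [hV', Matrix.mul_one]

namespace IrredCorep

lemma dim_pos (U : IrredCorep A) : 0 < U.dim := by
  rcases Nat.eq_zero_or_pos U.dim with h | h
  · have : IsEmpty (Fin U.dim) := by rw [h]; infer_instance
    have h1 := U.irreducible
    rw [Module.finrank_zero_of_subsingleton] at h1
    exact absurd h1 zero_ne_one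
  · exact h

lemma schur_self (U : IrredCorep A) {T : Matrix (Fin U.dim) (Fin U.dim) ℂ}
    (hT : T ∈ intertwiners U.mat U.mat) : ∃ c : ℂ, T = c • 1 := by
  have : Nonempty (Fin U.dim) := ⟨⟨0, U.dim_pos⟩⟩
  have h1 : (⟨1, one_mem_intertwiners U.mat⟩ : intertwiners U.mat U.mat) ≠ 0 := fun h =>
    one_ne_zero (congrArg Subtype.val h)
  obtain ⟨c, hc⟩ := (finrank_eq_one_iff_of_nonzero' _ h1).1 U.irreducible ⟨T, hT⟩
  exact ⟨c, (congrArg Subtype.val hc).symm⟩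

lemma schur [StarModule ℂ A] {U V : IrredCorep A} (h : ¬ U ≈ V)
    {T : Matrix (Fin V.dim) (Fin U.dim) ℂ} (hT : T ∈ intertwiners U.mat V.mat) : T = 0 := by
  have hT' := conjTranspose_mem_intertwiners U.isUnitaryCorep V.isUnitaryCorep hT
  obtain ⟨c, hc⟩ := U.schur_self (intertwiners_mul hT hT')
  obtain ⟨d, hd⟩ := V.schur_self (intertwiners_mul hT' hT)
  by_contra hT0
  have hcd : c = d := by
    have : T * (T.conjTranspose * T) = T * T.conjTranspose * T := (Matrix.mul_assoc _ _ _).symm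
    rw [hc, hd, Matrix.mul_smul, Matrix.smul_mul, Matrix.mul_one, Matrix.one_mul] at this
    by_contra hne
    have h3 : (c - d) • T = 0 := by rw [sub_smul, this, sub_self]
    exact (smul_eq_zero.1 h3).elim (fun h => hne (sub_eq_zero.1 h)) hT0
  have hc0 : c ≠ 0 := by
    rintro rfl
    rw [zero_smul, Matrix.conjTranspose_mul_self_eq_zero] at hc
    exact hT0 hc
  refine h ⟨T, hT, c⁻¹ • T.conjTranspose, Submodule.smul_mem _ _ hT', ?_, ?_⟩
  · rw [Matrix.mul_smul, hd, ← hcd, smul_smul, inv_mul_cancel₀ hc0, one_smul]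
  · rw [Matrix.smul_mul, hc, smul_smul, inv_mul_cancel₀ hc0, one_smul]

end IrredCorep

variable [StarModule ℂ A] [CompactQuantumGroup A]

lemma comul_mapStar {U : Matrix ι ι A}
    (hU : ∀ i j, Coalgebra.comul (R := ℂ) (U i j) = ∑ k, U i k ⊗ₜ[ℂ] U k j) (i j : ι) :
    Coalgebra.comul (R := ℂ) (star (U i j)) = ∑ k, star (U i k) ⊗ₜ[ℂ] star (U k j) := by
  rw [CompactQuantumGroup.comul_star, hU, star_sum]
  simp

section Invariance

variable {X : Matrix ι ι A} {Y : Matrix κ κ A}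

lemma haarFun_mul_left_inv
    (hX : ∀ i j, Coalgebra.comul (R := ℂ) (X i j) = ∑ k, X i k ⊗ₜ[ℂ] X k j)
    (hY : ∀ i j, Coalgebra.comul (R := ℂ) (Y i j) = ∑ k, Y i k ⊗ₜ[ℂ] Y k j)
    (i j : ι) (k l : κ) :
    ∑ p, ∑ q, haarFun A (X i p * Y k q) • (X p j * Y q l) = haarFun A (X i j * Y k l) • (1 : A) := by
  rw [← haarFun_left_inv, Bialgebra.comul_mul, hX, hY]
  simp [Finset.sum_mul, Finset.mul_sum, Algebra.TensorProduct.tmul_mul_tmul]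
  rw [Finset.sum_comm]

lemma haarFun_mul_right_inv
    (hX : ∀ i j, Coalgebra.comul (R := ℂ) (X i j) = ∑ k, X i k ⊗ₜ[ℂ] X k j)
    (hY : ∀ i j, Coalgebra.comul (R := ℂ) (Y i j) = ∑ k, Y i k ⊗ₜ[ℂ] Y k j)
    (i j : ι) (k l : κ) :
    ∑ p, ∑ q, haarFun A (X p j * Y q l) • (X i p * Y k q) = haarFun A (X i j * Y k l) • (1 : A) := by
  rw [← haarFun_right_inv, Bialgebra.comul_mul, hX, hY]
  simp [Finset.sum_mul, Finset.mul_sum, Algebra.TensorProduct.tmul_mul_tmul]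
  rw [Finset.sum_comm]

end Invariance

variable [DecidableEq ι] [DecidableEq κ]

/-- For fixed `i`, `k` the matrix `h(u*_{ip} v_{kq})` is an intertwiner: it is the average
`(id ⊗ h)(U* E_{ik} V)`. -/
lemma haarFun_star_mul_mem {U : Matrix ι ι A} {V : Matrix κ κ A} (hU : IsUnitaryCorep U)
    (hV : IsUnitaryCorep V) (i : ι) (k : κ) :
    (Matrix.of fun p q => haarFun A (star (U i p) * V k q)) ∈ intertwiners V U := by
  rw [mem_intertwiners_iff]
  intro r l
  simp only [Matrix.of_apply]
  have h : ∀ j, haarFun A (star (U i j) * V k l) • U r j =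
      ∑ p, ∑ q, haarFun A (star (U i p) * V k q) • (U r j * star (U p j) * V q l) := by
    intro j
    have := congrArg (fun x => U r j * x)
      (haarFun_mul_left_inv (X := U.map star) (comul_mapStar hU.comul) hV.comul i j k l)
    simp only [Matrix.map_apply, mul_smul_comm, mul_one, Finset.mul_sum, ← mul_assoc] at this
    exact this.symm
  simp only [h]
  rw [Finset.sum_comm]
  have h2 : ∀ p, ∑ j, ∑ q, haarFun A (star (U i p) * V k q) • (U r j * star (U p j) * V q l) =
      if r = p then ∑ q, haarFun A (star (U i p) * V k q) • V q l else 0 := by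
    intro p
    rw [Finset.sum_comm]
    simp only [← Finset.smul_sum, ← Finset.sum_mul, hU.sum_mul_star]
    split_ifs <;> simp
  simp [h2]

lemma haarFun_mul_star_mem {U : Matrix ι ι A} {V : Matrix κ κ A}
    (hU : ∀ i j, Coalgebra.comul (R := ℂ) (U i j) = ∑ k, U i k ⊗ₜ[ℂ] U k j)
    (hV : IsUnitaryCorep V) (j : ι) (l : κ) :
    (Matrix.of fun p q => haarFun A (U p j * star (V q l))) ∈ intertwiners V U := by
  rw [mem_intertwiners_iff]
  intro i r
  simp only [Matrix.of_apply]
  have h : ∀ k, haarFun A (U i j * star (V k l)) • V k r =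
      ∑ p, ∑ q, haarFun A (U p j * star (V q l)) • (U i p * (star (V k q) * V k r)) := by
    intro k
    have := congrArg (fun x => x * V k r)
      (haarFun_mul_right_inv (Y := V.map star) hU (comul_mapStar hV.comul) i j k l)
    simp only [Matrix.map_apply, smul_mul_assoc, one_mul, Finset.sum_mul, mul_assoc] at this
    exact this.symm
  simp only [h]
  rw [Finset.sum_comm]
  refine Finset.sum_congr rfl fun p _ => ?_
  rw [Finset.sum_comm]
  simp only [← Finset.smul_sum, ← Finset.mul_sum, hV.sum_star_mul]
  simp

namespace IrredCorep

lemma haarFun_star_mul_eq_zero {U V : IrredCorep A} (h : ¬ U ≈ V) (i j k l) :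
    haarFun A (star (U.mat i j) * V.mat k l) = 0 :=
  congrFun (congrFun (schur (fun h' => h (Setoid.symm h'))
    (haarFun_star_mul_mem U.isUnitaryCorep V.isUnitaryCorep i k)) j) l

lemma haarFun_mul_star_eq_zero {U V : IrredCorep A} (h : ¬ U ≈ V) (i j k l) :
    haarFun A (U.mat i j * star (V.mat k l)) = 0 :=
  congrFun (congrFun (schur (fun h' => h (Setoid.symm h'))
    (haarFun_mul_star_mem U.isUnitaryCorep.comul V.isUnitaryCorep j l)) i) k

lemma exists_haarFun_star_mul (U : IrredCorep A) :
    ∃ Q : Matrix (Fin U.dim) (Fin U.dim) ℂ, ∀ i j k l,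
      haarFun A (star (U.mat i j) * U.mat k l) = if j = l then Q i k else 0 := by
  have h : ∀ i k, ∃ c : ℂ, ∀ j l,
      haarFun A (star (U.mat i j) * U.mat k l) = if j = l then c else 0 := by
    intro i k
    obtain ⟨c, hc⟩ := U.schur_self (haarFun_star_mul_mem U.isUnitaryCorep U.isUnitaryCorep i k)
    refine ⟨c, fun j l => ?_⟩
    have := congrFun (congrFun hc j) l
    simpa [Matrix.one_apply] using this
  choose c hc using h
  exact ⟨Matrix.of c, fun i j k l => hc i k j l⟩

lemma exists_haarFun_mul_star (U : IrredCorep A) :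
    ∃ Q : Matrix (Fin U.dim) (Fin U.dim) ℂ, ∀ i j k l,
      haarFun A (U.mat i j * star (U.mat k l)) = if i = k then Q j l else 0 := by
  have h : ∀ j l, ∃ c : ℂ, ∀ i k,
      haarFun A (U.mat i j * star (U.mat k l)) = if i = k then c else 0 := by
    intro j l
    obtain ⟨c, hc⟩ := U.schur_self
      (haarFun_mul_star_mem U.isUnitaryCorep.comul U.isUnitaryCorep j l)
    refine ⟨c, fun i k => ?_⟩
    have := congrFun (congrFun hc i) k
    simpa [Matrix.one_apply] using this
  choose c hc using h
  exact ⟨Matrix.of c, fun i j k l => hc j l i k⟩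

/-- The matrix `Q` of the orthogonality relations `h(u*_{ij} u_{kl}) = δ_{jl} Q_{ik}`. -/
def gram (U : IrredCorep A) : Matrix (Fin U.dim) (Fin U.dim) ℂ := U.exists_haarFun_star_mul.choose

lemma haarFun_star_mul (U : IrredCorep A) (i j k l) :
    haarFun A (star (U.mat i j) * U.mat k l) = if j = l then U.gram i k else 0 :=
  U.exists_haarFun_star_mul.choose_spec i j k l

lemma sum_gram (U : IrredCorep A) : ∑ i, U.gram i i = 1 := by
  have h := congrArg (haarFun A) (U.isUnitaryCorep.sum_star_mul ⟨0, U.dim_pos⟩ ⟨0, U.dim_pos⟩)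
  simpa [map_sum, haarFun_star_mul, haarFun_one] using h

/-- The key point for the positivity of the Haar functional. If `T` intertwines a unitary `V` and
the conjugate of `U`, then `Y = T Tᴴ` satisfies `Ū Y Ūᴴ = Y`, and applying the Haar functional to
this equation gives `tr(Y) Q = Y`. -/
lemma gram_posSemidef (U : IrredCorep A) : U.gram.PosSemidef := by
  classical
  obtain ⟨n, V, hV, hS⟩ := exists_isUnitaryCorep_forall_mem A
    (Finset.univ.image fun p : Fin U.dim × Fin U.dim => star (U.mat p.1 p.2))
  have hS : ∀ i j, star (U.mat i j) ∈ coeffSpan V := fun i j =>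
    hS _ (Finset.mem_image.2 ⟨(i, j), Finset.mem_univ _, rfl⟩)
  let T : Fin U.dim → Fin n → Matrix (Fin U.dim) (Fin n) ℂ := fun a b =>
    Matrix.of fun p q => haarFun A (star (U.mat p a) * star (V q b))
  have hT : ∀ a b, T a b ∈ intertwiners V (U.mat.map star) := fun a b =>
    haarFun_mul_star_mem (U := U.mat.map star) (comul_mapStar U.isUnitaryCorep.comul) hV a b
  -- `V` contains the entries of the conjugate of `U`, so if all `T a b` vanished, `Q` would be traceless
  obtain ⟨a, b, hab⟩ : ∃ a b, T a b ≠ 0 := by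
    by_contra! hcon
    have h0 : ∀ p a, ∀ v ∈ coeffSpan V, haarFun A (star (U.mat p a) * star v) = 0 := by
      intro p a v hv
      refine Submodule.span_induction ?_ (by simp) ?_ ?_ hv
      · rintro _ ⟨⟨q, b⟩, rfl⟩
        exact congrFun (congrFun (hcon a b) p) q
      · intro x y _ _ hx hy
        rw [star_add, mul_add, map_add, hx, hy, add_zero]
      · intro c x _ hx
        rw [star_smul, mul_smul_comm, map_smul, hx, smul_zero]
    have h1 := U.sum_gram
    rw [Finset.sum_eq_zero] at h1
    · exact zero_ne_one h1
    · intro i _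
      have := h0 i ⟨0, U.dim_pos⟩ _ (hS i ⟨0, U.dim_pos⟩)
      rwa [star_star, haarFun_star_mul, if_pos rfl] at this
  set M := T a b with hM
  have hMT : M.map (algebraMap ℂ A) * V = U.mat.map star * M.map (algebraMap ℂ A) := hT a b
  have hVV : V * V.conjTranspose = 1 := Unitary.mul_star_self_of_mem hV.unitary
  have hfix : U.mat.map star * (M * M.conjTranspose).map (algebraMap ℂ A) *
      (U.mat.map star).conjTranspose = (M * M.conjTranspose).map (algebraMap ℂ A) := by
    rw [Matrix.map_mul, ← map_algebraMap_conjTranspose, ← Matrix.mul_assoc, ← hMT, Matrix.mul_assoc,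
      ← Matrix.conjTranspose_mul, ← hMT, Matrix.conjTranspose_mul, Matrix.mul_assoc,
      ← Matrix.mul_assoc V, hVV, Matrix.one_mul]
  have hgram : M * M.conjTranspose = (M * M.conjTranspose).trace • U.gram := by
    ext p q
    have h := congrArg (haarFun A) (congrFun (congrFun hfix p) q)
    have h2 : ∀ r s, U.mat.map star p s * (M * M.conjTranspose).map (algebraMap ℂ A) s r *
        (U.mat.map star).conjTranspose r q =
        (M * M.conjTranspose) s r • (star (U.mat p s) * U.mat q r) := by
      intro r s
      simp only [Matrix.map_apply, Matrix.conjTranspose_apply, star_star]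
      rw [← Algebra.commutes, ← Algebra.smul_def, smul_mul_assoc]
    simp only [Matrix.mul_apply (M := U.mat.map star * _), Matrix.mul_apply (M := U.mat.map star),
      Finset.sum_mul, h2, map_sum, map_smul, haarFun_star_mul] at h
    rw [Matrix.map_apply, Algebra.algebraMap_eq_smul_one, map_smul, haarFun_one, smul_eq_mul,
      mul_one] at h
    rw [← h, Matrix.smul_apply, Matrix.trace, Finset.sum_smul]
    simp
  have hpsd := Matrix.posSemidef_self_mul_conjTranspose M
  have htr : (M * M.conjTranspose).trace ≠ 0 := fun h0 => by
    rw [h0, zero_smul, Matrix.self_mul_conjTranspose_eq_zero] at hgram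
    exact hab hgram
  have : U.gram = (M * M.conjTranspose).trace⁻¹ • (M * M.conjTranspose) :=
    ((inv_smul_eq_iff₀ htr).2 hgram).symm
  rw [this]
  exact hpsd.smul (inv_nonneg.2 hpsd.trace_nonneg)

end IrredCorep

end Orthogonality

/-! ### Decomposition into irreducible corepresentations -/

section PeterWeyl

open scoped ComplexOrder

variable {A : Type u} [Ring A] [StarRing A] [HopfAlgebra ℂ A] [StarModule ℂ A]

variable (A) in
/-- The span of the matrix coefficients of the chosen irreducible corepresentations. -/
def irrSpan : Submodule ℂ A :=
  Submodule.span ℂ (Set.range fun x : Σ j : Irr A, Fin j.rep.dim × Fin j.rep.dim =>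
    x.1.rep.mat x.2.1 x.2.2)

lemma mem_irrSpan (j : Irr A) (p q) : j.rep.mat p q ∈ irrSpan A :=
  Submodule.subset_span ⟨⟨j, p, q⟩, rfl⟩

/-- The entries of a product `S V T` with scalar matrices `S`, `T` are combinations of those of
`V`. -/
lemma conj_apply_mem {ι κ : Type*} [Fintype ι] [Fintype κ] {N : Submodule ℂ A} {V : Matrix κ κ A}
    (hV : ∀ i j, V i j ∈ N) (S : Matrix ι κ ℂ) (T : Matrix κ ι ℂ) (i j : ι) :
    (S.map (algebraMap ℂ A) * V * T.map (algebraMap ℂ A)) i j ∈ N := by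
  simp only [Matrix.mul_apply, Matrix.map_apply, Finset.sum_mul]
  refine sum_mem fun b _ => sum_mem fun a _ => ?_
  rw [← Algebra.smul_def, ← Algebra.commutes, ← Algebra.smul_def]
  exact N.smul_mem _ (N.smul_mem _ (hV a b))

lemma IrredCorep.mat_mem_irrSpan (U : IrredCorep A) (i j) : U.mat i j ∈ irrSpan A := by
  obtain ⟨j₀, hj₀⟩ : ∃ j : Irr A, j.rep ≈ U := ⟨Quotient.mk _ U, Quotient.mk_out U⟩
  obtain ⟨T, hT, S, hS, h1, h2⟩ := hj₀
  change T.map (algebraMap ℂ A) * j₀.rep.mat = U.mat * T.map (algebraMap ℂ A) at hT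
  have e : U.mat = T.map (algebraMap ℂ A) * j₀.rep.mat * S.map (algebraMap ℂ A) := by
    rw [hT, Matrix.mul_assoc, ← Matrix.map_mul, h1]
    simp
  rw [e]
  exact conj_apply_mem (fun p q => mem_irrSpan _ p q) _ _ _ _

/-- If `End(U)` is not one-dimensional, it contains a hermitian matrix that is not scalar. -/
lemma exists_isHermitian_mem_intertwiners {ι : Type} [Fintype ι] [DecidableEq ι] [Nonempty ι]
    {U : Matrix ι ι A} (hU : IsUnitaryCorep U) (h : Module.finrank ℂ (intertwiners U U) ≠ 1) :
    ∃ H ∈ intertwiners U U, H.IsHermitian ∧ ∀ c : ℂ, H ≠ c • 1 := by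
  by_contra! hcon
  refine h (finrank_eq_one (⟨1, one_mem_intertwiners U⟩ : intertwiners U U)
    (fun h => one_ne_zero (congrArg Subtype.val h)) ?_)
  rintro ⟨T, hT⟩
  have hT' := conjTranspose_mem_intertwiners hU hU hT
  obtain ⟨c, hc⟩ := hcon (T + T.conjTranspose) (add_mem hT hT')
    (by rw [Matrix.IsHermitian, Matrix.conjTranspose_add, Matrix.conjTranspose_conjTranspose,
      add_comm])
  obtain ⟨d, hd⟩ := hcon (Complex.I • (T - T.conjTranspose))
    (Submodule.smul_mem _ _ (sub_mem hT hT'))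
    (by
      rw [Matrix.IsHermitian, Matrix.conjTranspose_smul, Matrix.conjTranspose_sub,
        Matrix.conjTranspose_conjTranspose]
      simp [smul_sub]
      abel)
  refine ⟨(1 / 2 : ℂ) * (c - Complex.I * d), Subtype.ext ?_⟩
  change ((1 / 2 : ℂ) * (c - Complex.I * d)) • (1 : Matrix ι ι ℂ) = T
  rw [mul_smul, sub_smul, mul_smul, ← hc, ← hd, smul_smul, Complex.I_mul_I]
  rw [neg_one_smul, sub_neg_eq_add]
  rw [show T + T.conjTranspose + (T - T.conjTranspose) = (2 : ℂ) • T by rw [two_smul]; abel,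
    smul_smul]
  norm_num

/-- Complete reducibility, in terms of coefficients. -/
lemma IsUnitaryCorep.mem_irrSpan {ι : Type} [Fintype ι] [DecidableEq ι] {U : Matrix ι ι A}
    (hU : IsUnitaryCorep U) (i j : ι) : U i j ∈ irrSpan A := by
  induction h : Fintype.card ι using Nat.strong_induction_on generalizing ι with
  | _ n ih =>
  have : Nonempty ι := ⟨i⟩
  by_cases h1 : Module.finrank ℂ (intertwiners U U) = 1
  · let e : Fin (Fintype.card ι) ≃ ι := (Fintype.equivFin ι).symm
    have hU' := hU.reindex e
    have hmem : ∀ T : Matrix ι ι ℂ, T ∈ intertwiners U U ↔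
        T.submatrix e e ∈ intertwiners (U.submatrix e e) (U.submatrix e e) := by
      intro T
      simp only [mem_intertwiners_iff, Matrix.submatrix_apply]
      constructor
      · intro h k j
        exact (Equiv.sum_comp e fun i => T (e k) i • U i (e j)).trans ((h _ _).trans
          (Equiv.sum_comp e fun i => T i (e j) • U (e k) i).symm)
      · intro h k j
        have := h (e.symm k) (e.symm j)
        simp only [Equiv.apply_symm_apply] at this
        exact (Equiv.sum_comp e fun i => T k i • U i j).symm.trans (this.trans
          (Equiv.sum_comp e fun i => T i j • U k i))
    have hmap : (intertwiners U U).map (Matrix.reindexLinearEquiv ℂ ℂ e.symm e.symm).toLinearMap =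
        intertwiners (U.submatrix e e) (U.submatrix e e) := by
      ext T
      rw [Submodule.mem_map_equiv, hmem]
      simp [Matrix.reindexLinearEquiv]
    let W : IrredCorep A := ⟨_, U.submatrix e e, hU', by
      rw [← hmap, LinearEquiv.finrank_map_eq]; exact h1⟩
    simpa [W] using W.mat_mem_irrSpan (e.symm i) (e.symm j)
  -- otherwise diagonalise a non-scalar hermitian intertwiner and split `U` along an eigenspace
  · obtain ⟨H, hH, hherm, hns⟩ := exists_isHermitian_mem_intertwiners hU h1
    let W : Matrix ι ι ℂ := hherm.eigenvectorUnitary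
    have hW : W ∈ _root_.unitary (Matrix ι ι ℂ) := hherm.eigenvectorUnitary.2
    have hW1 : star W * W = 1 := Unitary.star_mul_self_of_mem hW
    have hW2 : W * star W = 1 := Unitary.mul_star_self_of_mem hW
    let d := hherm.eigenvalues
    have hdiag : star W * H * W = Matrix.diagonal fun i => (d i : ℂ) := by
      have := hherm.conjStarAlgAut_star_eigenvectorUnitary
      rw [Unitary.conjStarAlgAut_star_apply] at this
      exact this
    set U' := (star W).map (algebraMap ℂ A) * U * W.map (algebraMap ℂ A) with hU'def
    have hU' : IsUnitaryCorep U' := hU.conj hW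
    have hUU' : U = W.map (algebraMap ℂ A) * U' * (star W).map (algebraMap ℂ A) := by
      have e1 : W.map (algebraMap ℂ A) * (star W).map (algebraMap ℂ A) = 1 := by
        rw [← Matrix.map_mul, hW2]; simp
      rw [hU'def, ← Matrix.mul_assoc, ← Matrix.mul_assoc, e1, Matrix.one_mul, Matrix.mul_assoc, e1,
        Matrix.mul_one]
    have hW_mem : W ∈ intertwiners U' U := by
      change W.map (algebraMap ℂ A) * U' = U * W.map (algebraMap ℂ A)
      have e1 : W.map (algebraMap ℂ A) * (star W).map (algebraMap ℂ A) = 1 := by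
        rw [← Matrix.map_mul, hW2]; simp
      rw [hU'def, ← Matrix.mul_assoc, ← Matrix.mul_assoc, e1, Matrix.one_mul]
    have hD : (Matrix.diagonal fun i => (d i : ℂ)) ∈ intertwiners U' U' := by
      rw [← hdiag]
      exact intertwiners_mul hW_mem (intertwiners_mul hH
        (conjTranspose_mem_intertwiners hU' hU hW_mem))
    have hoff : ∀ i j, d i ≠ d j → U' i j = 0 := by
      intro i j hij
      have := mem_intertwiners_iff.1 hD i j
      simp only [Matrix.diagonal_apply, ite_smul, zero_smul, Finset.sum_ite_eq, Finset.sum_ite_eq',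
        Finset.mem_univ, if_true] at this
      rw [← sub_eq_zero, ← sub_smul, smul_eq_zero, sub_eq_zero] at this
      exact this.resolve_left fun h => hij (by exact_mod_cast h)
    obtain ⟨i₁, hi₁⟩ : ∃ i₁, d i₁ ≠ d i := by
      by_contra! hcon
      refine hns (d i) ?_
      have : H = W * (Matrix.diagonal fun i => (d i : ℂ)) * star W := by
        rw [← hdiag, ← Matrix.mul_assoc, ← Matrix.mul_assoc, hW2, Matrix.one_mul, Matrix.mul_assoc,
          hW2, Matrix.mul_one]
      rw [this]
      simp only [hcon]
      rw [← Matrix.smul_one_eq_diagonal, Matrix.mul_smul, Matrix.mul_one, Matrix.smul_mul, hW2]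
    have hr1 := hU'.restrict (fun k => d k = d i)
      (fun a b ha hb => hoff a b fun h => hb (h ▸ ha))
      (fun a b ha hb => hoff b a fun h => hb (h.trans ha))
    have hr2 := hU'.restrict (fun k => d k ≠ d i)
      (fun a b ha hb => hoff a b fun h => hb (h ▸ ha))
      (fun a b ha hb => hoff b a fun h => hb (h.symm ▸ ha))
    have hall : ∀ a b, U' a b ∈ irrSpan A := by
      intro a b
      by_cases ha : d a = d i
      · by_cases hb : d b = d i
        · exact ih _ (by rw [← h]; exact Fintype.card_subtype_lt (x := i₁) hi₁) hr1
            ⟨a, ha⟩ ⟨b, hb⟩ rfl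
        · rw [hoff a b fun h => hb (h ▸ ha)]
          exact zero_mem _
      · by_cases hb : d b = d i
        · rw [hoff a b fun h => ha (h.trans hb)]
          exact zero_mem _
        · exact ih _ (by rw [← h]; exact Fintype.card_subtype_lt (x := i) (by simp)) hr2
            ⟨a, ha⟩ ⟨b, hb⟩ rfl
    rw [hUU']
    exact conj_apply_mem hall _ _ _ _

variable [CompactQuantumGroup A]

lemma irrSpan_eq_top : irrSpan A = ⊤ := by
  rw [eq_top_iff, ← CompactQuantumGroup.span_coeff, Submodule.span_le]
  rintro _ ⟨n, U, hU, i, j, rfl⟩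
  exact hU.mem_irrSpan i j

lemma exists_eq_sum_coeff (a : A) :
    ∃ (F : Finset (Irr A)) (c : ∀ j : Irr A, Fin j.rep.dim → Fin j.rep.dim → ℂ),
      a = ∑ j ∈ F, ∑ p, ∑ q, c j p q • j.rep.mat p q := by
  classical
  have ha : a ∈ irrSpan A := by rw [irrSpan_eq_top]; trivial
  obtain ⟨c, rfl⟩ := Finsupp.mem_span_range_iff_exists_finsupp.1 ha
  refine ⟨c.support.image Sigma.fst, fun j p q => c ⟨j, p, q⟩, ?_⟩
  rw [Finsupp.sum_of_support_subset c (s := (c.support.image Sigma.fst).sigma fun _ => Finset.univ)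
    (fun x hx => Finset.mem_sigma.2 ⟨Finset.mem_image_of_mem _ hx, Finset.mem_univ _⟩) _ (by simp),
    Finset.sum_sigma]
  exact Finset.sum_congr rfl fun j _ => Fintype.sum_prod_type _

lemma Irr.not_rep_equiv {j k : Irr A} (h : j ≠ k) : ¬ j.rep ≈ k.rep := fun h' =>
  h (by rw [← Quotient.out_eq j, ← Quotient.out_eq k]; exact Quotient.sound h')

lemma IrredCorep.haarFun_star_mul_self_nonneg (U : IrredCorep A)
    (c : Fin U.dim → Fin U.dim → ℂ) :
    0 ≤ haarFun A (star (∑ p, ∑ q, c p q • U.mat p q) * ∑ p, ∑ q, c p q • U.mat p q) := by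
  have : haarFun A (star (∑ p, ∑ q, c p q • U.mat p q) * ∑ p, ∑ q, c p q • U.mat p q) =
      ∑ q, dotProduct (star fun p => c p q) (U.gram.mulVec fun p => c p q) := by
    simp only [star_sum, star_smul, Finset.sum_mul, Finset.mul_sum, smul_mul_smul_comm, map_sum,
      map_smul, haarFun_star_mul, smul_eq_mul, dotProduct, Matrix.mulVec, Pi.star_apply]
    rw [Finset.sum_comm]
    refine Finset.sum_congr rfl fun q _ => ?_
    rw [Finset.sum_comm]
    refine Finset.sum_congr rfl fun p _ => Finset.sum_congr rfl fun r _ => ?_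
    simp only [mul_ite, mul_zero, Finset.sum_ite_eq', Finset.mem_univ, if_true]
    ring
  rw [this]
  exact Finset.sum_nonneg fun q _ => U.gram_posSemidef.dotProduct_mulVec_nonneg _

lemma haarFun_star_mul_self_nonneg (a : A) : 0 ≤ haarFun A (star a * a) := by
  classical
  obtain ⟨F, c, rfl⟩ := exists_eq_sum_coeff a
  rw [star_sum, Finset.sum_mul, map_sum]
  refine Finset.sum_nonneg fun j hj => ?_
  rw [Finset.mul_sum, map_sum, Finset.sum_eq_single_of_mem j hj]
  · exact j.rep.haarFun_star_mul_self_nonneg (c j)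
  · intro k _ hkj
    simp only [star_sum, star_smul, Finset.sum_mul, Finset.mul_sum, smul_mul_smul_comm, map_sum,
      map_smul, IrredCorep.haarFun_star_mul_eq_zero (Irr.not_rep_equiv hkj.symm), smul_zero,
      Finset.sum_const_zero]

variable (A) in
/-- The semi-inner product `⟨a, b⟩ = h(a* b)` on `A`. -/
@[reducible]
def haarCore : PreInnerProductSpace.Core ℂ A where
  inner a b := haarFun A (star a * b)
  conj_inner_symm a b := by
    change star (haarFun A (star b * a)) = haarFun A (star a * b)
    rw [← haarFun_star, star_mul, star_star]
  re_inner_nonneg a := (Complex.nonneg_iff.1 (haarFun_star_mul_self_nonneg a)).1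
  add_left a b c := by simp [add_mul]
  smul_left a b c := by simp

lemma haarFun_mul_eq_zero {a : A} (ha : haarFun A (star a * a) = 0) (b : A) :
    haarFun A (b * a) = 0 := by
  have h := @InnerProductSpace.Core.inner_mul_inner_self_le ℂ A _ _ _ (haarCore A) (star b) a
  have h2 : ‖haarFun A (star (star b) * a)‖ * ‖haarFun A (star a * star b)‖ ≤
      RCLike.re (haarFun A (star (star b) * star b)) * RCLike.re (haarFun A (star a * a)) := h
  rw [ha, map_zero, mul_zero, ← star_mul, haarFun_star, norm_star, star_star] at h2
  have := mul_self_eq_zero.1 (le_antisymm h2 (mul_self_nonneg _))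
  exact norm_eq_zero.1 this

/-- The matrix `Q` is invertible: otherwise the left ideal of all `a` with `h(a* a) = 0` would
contain a row `a = wᵗ U` with `w ≠ 0`, and hence, by a left inverse of `Uᵗ` built from the antipode,
the unit. -/
lemma IrredCorep.isUnit_gram (U : IrredCorep A) : IsUnit U.gram := by
  rw [← Matrix.mulVec_injective_iff_isUnit]
  refine (injective_iff_map_eq_zero U.gram.mulVecLin).2 fun w hw => ?_
  have hw : U.gram.mulVec w = 0 := hw
  let a : Fin U.dim → A := fun j => ∑ k, w k • U.mat k j
  have ha : ∀ j, haarFun A (star (a j) * a j) = 0 := by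
    intro j
    have : haarFun A (star (a j) * a j) = dotProduct (star w) (U.gram.mulVec w) := by
      simp only [a, star_sum, star_smul, Finset.sum_mul, Finset.mul_sum, smul_mul_smul_comm,
        map_sum, map_smul, haarFun_star_mul, if_true, smul_eq_mul, dotProduct, Matrix.mulVec,
        Pi.star_apply]
      rw [Finset.sum_comm]
      exact Finset.sum_congr rfl fun p _ => Finset.sum_congr rfl fun r _ => by ring
    rw [this, hw, dotProduct_zero]
  have hinv : ∀ i j, ∑ k, star (HopfAlgebra.antipode ℂ (star (U.mat k j))) * U.mat i k =
      if i = j then 1 else 0 := by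
    intro i j
    have h := HopfAlgebra.mul_antipode_lTensor_comul_apply (R := ℂ) (star (U.mat i j))
    rw [comul_mapStar U.isUnitaryCorep.comul, counit_star, U.isUnitaryCorep.counit_apply] at h
    have h2 := congrArg star h
    simpa [apply_ite] using h2
  ext j
  have h1 : ∑ l, star (HopfAlgebra.antipode ℂ (star (U.mat l j))) * a l = w j • (1 : A) := by
    simp only [a, Finset.mul_sum, mul_smul_comm]
    rw [Finset.sum_comm]
    simp only [← Finset.smul_sum, hinv]
    simp
  have h2 := congrArg (haarFun A) h1
  simpa [map_sum, haarFun_mul_eq_zero (ha _), haarFun_one] using h2.symm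

/-- For every `x` there is a `z` with `h(x a) = h(a z)` for all `a`: on the coefficients of the
conjugate of each irreducible corepresentation the two functionals can be matched because the
orthogonality matrices are invertible. -/
lemma exists_haarFun_mul_comm (x : A) : ∃ z : A, ∀ a, haarFun A (x * a) = haarFun A (a * z) := by
  have hx : x ∈ irrSpan A := by rw [irrSpan_eq_top]; trivial
  refine Submodule.span_induction (p := fun x _ => ∃ z : A, ∀ a,
    haarFun A (x * a) = haarFun A (a * z)) ?_ ⟨0, by simp⟩ ?_ ?_ hx
  · rintro _ ⟨⟨J, i, j⟩, rfl⟩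
    obtain ⟨M, hM⟩ := J.rep.exists_haarFun_mul_star
    let E : Matrix (Fin J.rep.dim) (Fin J.rep.dim) ℂ := Matrix.of fun k l => if i = k then M j l else 0
    let c := J.rep.gram⁻¹ * E
    have hc : J.rep.gram * c = E := by
      rw [← Matrix.mul_assoc, Matrix.mul_nonsing_inv _ ((Matrix.isUnit_iff_isUnit_det _).1
        J.rep.isUnit_gram), Matrix.one_mul]
    refine ⟨∑ p, ∑ q, c p q • J.rep.mat p q, fun a => ?_⟩
    have key : ∀ b ∈ irrSpan A, haarFun A (J.rep.mat i j * star b) =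
        haarFun A (star b * ∑ p, ∑ q, c p q • J.rep.mat p q) := by
      intro b hb
      refine Submodule.span_induction ?_ (by simp) ?_ ?_ hb
      · rintro _ ⟨⟨K, k, l⟩, rfl⟩
        dsimp only
        simp only [Finset.mul_sum, mul_smul_comm, map_sum, map_smul]
        by_cases hJK : K = J
        · subst hJK
          simp only [hM, IrredCorep.haarFun_star_mul, smul_ite, smul_zero, Finset.sum_ite_eq,
            Finset.mem_univ, if_true]
          have := congrFun (congrFun hc k) l
          rw [Matrix.mul_apply] at this
          rw [show (if i = k then M j l else 0) = E k l from rfl, ← this]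
          exact Finset.sum_congr rfl fun p _ => by rw [smul_eq_mul, mul_comm]
        · simp only [IrredCorep.haarFun_star_mul_eq_zero (Irr.not_rep_equiv hJK),
            IrredCorep.haarFun_mul_star_eq_zero (Irr.not_rep_equiv (Ne.symm hJK)), smul_zero,
            Finset.sum_const_zero]
      · intro x y _ _ hx hy
        simp only [star_add, mul_add, add_mul, map_add, hx, hy]
      · intro c x _ hx
        simp only [star_smul, smul_mul_assoc, mul_smul_comm, map_smul, hx]
    have := key (star a) (by rw [irrSpan_eq_top]; trivial)
    rwa [star_star] at this
  · rintro x y _ _ ⟨z, hz⟩ ⟨w, hw⟩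
    exact ⟨z + w, fun a => by rw [add_mul, mul_add, map_add, map_add, hz, hw]⟩
  · rintro c x _ ⟨z, hz⟩
    exact ⟨c • z, fun a => by rw [smul_mul_assoc, mul_smul_comm, map_smul, map_smul, hz]⟩

end PeterWeyl

/-! ### Characters and cocommutative elements -/

section Characters

variable {A : Type u} [Ring A] [StarRing A] [HopfAlgebra ℂ A] [StarModule ℂ A]
  [CompactQuantumGroup A]

section Average

variable {ι κ : Type*} [Fintype ι] [Fintype κ] [DecidableEq ι] [DecidableEq κ]

/-- The map `X ↦ (id ⊗ h)(U* X V)` on scalar matrices. -/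
def average (U : Matrix ι ι A) (V : Matrix κ κ A) : Matrix ι κ ℂ →ₗ[ℂ] Matrix ι κ ℂ where
  toFun X := ∑ i, ∑ k, X i k • Matrix.of fun p q => haarFun A (star (U i p) * V k q)
  map_add' X Y := by
    simp only [Matrix.add_apply, add_smul, Finset.sum_add_distrib]
  map_smul' c X := by
    simp only [Matrix.smul_apply, smul_assoc, Finset.smul_sum, RingHom.id_apply]

lemma average_apply (U : Matrix ι ι A) (V : Matrix κ κ A) (X : Matrix ι κ ℂ) (p q) :
    average U V X p q = ∑ i, ∑ k, X i k * haarFun A (star (U i p) * V k q) := by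
  simp [average, Matrix.sum_apply]

lemma average_isProj {U : Matrix ι ι A} {V : Matrix κ κ A} (hU : IsUnitaryCorep U)
    (hV : IsUnitaryCorep V) : LinearMap.IsProj (intertwiners V U) (average U V) where
  map_mem X := sum_mem fun i _ => sum_mem fun k _ =>
    Submodule.smul_mem _ _ (haarFun_star_mul_mem hU hV i k)
  map_id X hX := by
    ext p q
    have h := mem_intertwiners_iff.1 hX
    rw [average_apply]
    calc ∑ i, ∑ k, X i k * haarFun A (star (U i p) * V k q)
        = haarFun A (∑ i, star (U i p) * ∑ k, X i k • V k q) := by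
          simp [Finset.mul_sum, map_sum]
      _ = haarFun A (∑ l, X l q • ∑ i, star (U i p) * U i l) := by
          simp only [h, Finset.mul_sum, mul_smul_comm, Finset.smul_sum]
          rw [Finset.sum_comm]
      _ = X p q := by
          simp [hU.sum_star_mul, haarFun_one]

/-- The number of intertwiners is an inner product of characters: it is the trace of the averaging
projection. -/
lemma haarFun_star_trace_mul_trace {U : Matrix ι ι A} {V : Matrix κ κ A} (hU : IsUnitaryCorep U)
    (hV : IsUnitaryCorep V) :
    haarFun A (star U.trace * V.trace) = Module.finrank ℂ (intertwiners V U) := by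
  rw [← (average_isProj hU hV).trace, LinearMap.trace_eq_matrix_trace ℂ (Matrix.stdBasis ℂ ι κ)]
  have : ∀ x : ι × κ, (LinearMap.toMatrix (Matrix.stdBasis ℂ ι κ) (Matrix.stdBasis ℂ ι κ)
      (average U V)) x x = haarFun A (star (U x.1 x.1) * V x.2 x.2) := by
    rintro ⟨i, k⟩
    rw [LinearMap.toMatrix_apply, Matrix.stdBasis_eq_single]
    change average U V (Matrix.single i k 1) i k = _
    rw [average_apply]
    simp [Matrix.single_apply, ite_and]
  simp only [Matrix.trace, Matrix.diag_apply, this, star_sum, Finset.sum_mul, Finset.mul_sum,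
    map_sum, Fintype.sum_prod_type]
  rw [Finset.sum_comm]

lemma trace_tensorCorep (U : Matrix ι ι A) (V : Matrix κ κ A) :
    (tensorCorep U V).trace = U.trace * V.trace := by
  simp [Matrix.trace, tensorCorep, Fintype.sum_prod_type, Finset.sum_mul, Finset.mul_sum]
  rw [Finset.sum_comm]

end Average

/-- The character of the irreducible corepresentation `U_j`. -/
def Irr.chr (j : Irr A) : A := j.rep.mat.trace

lemma haarFun_star_chr_mul_chr_mul_chr (i j k : Irr A) :
    haarFun A (star i.chr * (j.chr * k.chr)) = fusionMult j k i := by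
  have h := haarFun_star_trace_mul_trace
    (j.rep.isUnitaryCorep.tensor k.rep.isUnitaryCorep) i.rep.isUnitaryCorep
  rw [trace_tensorCorep] at h
  have h2 := congrArg star h
  rw [← haarFun_star, star_mul, star_star] at h2
  simpa [fusionMult, Irr.chr] using h2

open Classical in
lemma haarFun_star_chr_mul_chr (j k : Irr A) :
    haarFun A (star j.chr * k.chr) = if j = k then 1 else 0 := by
  have h := haarFun_star_trace_mul_trace j.rep.isUnitaryCorep k.rep.isUnitaryCorep
  rw [Irr.chr, Irr.chr, h]
  split_ifs with hjk
  · subst hjk; rw [j.rep.irreducible]; simp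
  · have : intertwiners k.rep.mat j.rep.mat = ⊥ := by
      rw [eq_bot_iff]
      intro T hT
      exact IrredCorep.schur (Irr.not_rep_equiv (Ne.symm hjk)) hT
    rw [this]; simp

variable (A) in
/-- The `*`-algebra of cocommutative elements of `A`, the span of the characters. -/
def cocomm : StarSubalgebra ℂ A where
  carrier := {a | TensorProduct.comm ℂ A A (Coalgebra.comul (R := ℂ) a) = Coalgebra.comul (R := ℂ) a}
  mul_mem' {a b} ha hb := by
    have h : ∀ s t : A ⊗[ℂ] A, TensorProduct.comm ℂ A A (s * t) =
      TensorProduct.comm ℂ A A s * TensorProduct.comm ℂ A A t :=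
        map_mul (Algebra.TensorProduct.comm ℂ A A)
    change TensorProduct.comm ℂ A A _ = _ at ha hb
    change TensorProduct.comm ℂ A A _ = _
    rw [Bialgebra.comul_mul, h, ha, hb]
  add_mem' {a b} ha hb := by
    change TensorProduct.comm ℂ A A _ = _ at ha hb
    change TensorProduct.comm ℂ A A _ = _
    rw [map_add, map_add, ha, hb]
  algebraMap_mem' r := by
    change TensorProduct.comm ℂ A A _ = _
    rw [Algebra.algebraMap_eq_smul_one, map_smul, map_smul, Bialgebra.comul_one]
    simp [Algebra.TensorProduct.one_def]
  star_mem' {a} ha := by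
    have h : ∀ t : A ⊗[ℂ] A, TensorProduct.comm ℂ A A (star t) =
        star (TensorProduct.comm ℂ A A t) := by
      intro t
      induction t using TensorProduct.induction_on with
      | zero => simp
      | tmul x y => simp
      | add x y hx hy => simp only [map_add, star_add, hx, hy]
    change TensorProduct.comm ℂ A A _ = _ at ha
    change TensorProduct.comm ℂ A A _ = _
    rw [CompactQuantumGroup.comul_star, h, ha]

lemma mem_cocomm {a : A} : a ∈ cocomm A ↔
    TensorProduct.comm ℂ A A (Coalgebra.comul (R := ℂ) a) = Coalgebra.comul (R := ℂ) a := Iff.rfl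

lemma Irr.chr_mem_cocomm (j : Irr A) : j.chr ∈ cocomm A := by
  rw [mem_cocomm, Irr.chr]
  simp only [Matrix.trace, Matrix.diag_apply, map_sum, j.rep.isUnitaryCorep.comul,
    TensorProduct.comm_tmul]
  rw [Finset.sum_comm]

/-- The functionals dual to the coefficients of irreducible corepresentations. -/
lemma Irr.exists_dual (j : Irr A) (k l : Fin j.rep.dim) : ∃ φ : A →ₗ[ℂ] ℂ,
    (∀ p q, φ (j.rep.mat p q) = if p = k then (if q = l then 1 else 0) else 0) ∧
      ∀ i : Irr A, i ≠ j → ∀ p q, φ (i.rep.mat p q) = 0 := by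
  refine ⟨∑ i, j.rep.gram⁻¹ k i • (haarFun A ∘ₗ LinearMap.mulLeft ℂ (star (j.rep.mat i l))),
    fun p q => ?_, fun i hi p q => ?_⟩
  · simp only [LinearMap.sum_apply, LinearMap.smul_apply, LinearMap.comp_apply,
      LinearMap.mulLeft_apply, IrredCorep.haarFun_star_mul, smul_eq_mul]
    have h := congrFun (congrFun (Matrix.nonsing_inv_mul j.rep.gram
      ((Matrix.isUnit_iff_isUnit_det _).1 j.rep.isUnit_gram)) k) p
    rw [Matrix.mul_apply, Matrix.one_apply] at h
    by_cases hq : l = q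
    · subst hq; simp [h, eq_comm]
    · simp [hq, Ne.symm hq]
  · simp [IrredCorep.haarFun_star_mul_eq_zero (Irr.not_rep_equiv hi.symm)]

lemma mem_span_chr_of_mem_cocomm {a : A} (ha : a ∈ cocomm A) :
    a ∈ Submodule.span ℂ (Set.range (Irr.chr (A := A))) := by
  classical
  obtain ⟨F, c, rfl⟩ := exists_eq_sum_coeff a
  rw [mem_cocomm] at ha
  have key : ∀ j ∈ F, ∀ k l n, c j k n = if k = n then c j l l else 0 := by
    intro j hj k l n
    obtain ⟨φ, hφ, hφ'⟩ := j.exists_dual k l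
    obtain ⟨ψ, hψ, hψ'⟩ := j.exists_dual l n
    have h := congrArg (fun t => LinearMap.mul' ℂ ℂ (TensorProduct.map φ ψ t)) ha
    simp only [map_sum, map_smul, IsUnitaryCorep.comul (IrredCorep.isUnitaryCorep _),
      TensorProduct.comm_tmul, TensorProduct.map_tmul, LinearMap.mul'_apply] at h
    rw [Finset.sum_eq_single_of_mem j hj fun i _ hi => by simp [hφ' i hi],
      Finset.sum_eq_single_of_mem j hj fun i _ hi => by simp [hφ' i hi]] at h
    simp only [hφ, hψ] at h
    simp at h
    rw [← h]
    simp only [eq_comm]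
  refine sum_mem fun j hj => ?_
  have : ∑ p, ∑ q, c j p q • j.rep.mat p q =
      c j ⟨0, j.rep.dim_pos⟩ ⟨0, j.rep.dim_pos⟩ • j.chr := by
    rw [Irr.chr, Matrix.trace, Finset.smul_sum]
    refine Finset.sum_congr rfl fun p _ => ?_
    simp only [key j hj p ⟨0, j.rep.dim_pos⟩]
    simp
  rw [this]
  exact Submodule.smul_mem _ _ (Submodule.subset_span ⟨j, rfl⟩)

lemma Irr.counit_chr (j : Irr A) : Coalgebra.counit (R := ℂ) j.chr = (j.dim : ℂ) := by
  simp [Irr.chr, Matrix.trace, j.rep.isUnitaryCorep.counit_apply, Irr.dim]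

lemma Irr.dim_pos (j : Irr A) : 0 < j.dim := Nat.cast_pos.2 j.rep.dim_pos

end Characters

/-! ### The Haar state and the counit on the universal algebra -/

section HaarState

open scoped ComplexOrder InnerProductSpace

variable (A : Type u) [Ring A] [StarRing A] [HopfAlgebra ℂ A] [StarModule ℂ A]
  [CompactQuantumGroup A]

/-- The algebra `A` with the semi-inner product `⟨a, b⟩ = h(a* b)`. -/
def HaarPre : Type u := A

instance : AddCommGroup (HaarPre A) := inferInstanceAs (AddCommGroup A)
instance : Module ℂ (HaarPre A) := inferInstanceAs (Module ℂ A)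

/-- The semi-inner product on `HaarPre A`. -/
abbrev haarPreCore : PreInnerProductSpace.Core ℂ (HaarPre A) := haarCore A

instance : SeminormedAddCommGroup (HaarPre A) :=
  InnerProductSpace.Core.toSeminormedAddCommGroup (c := haarPreCore A)
instance : InnerProductSpace ℂ (HaarPre A) := InnerProductSpace.ofCore (haarPreCore A)

/-- The identity map from `A` to `HaarPre A`. -/
def toHaarPre : A ≃ₗ[ℂ] HaarPre A := LinearEquiv.refl ℂ A

variable {A}

lemma haarPre_inner (a b : A) : ⟪toHaarPre A a, toHaarPre A b⟫_ℂ = haarFun A (star a * b) := rfl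

lemma haarPre_norm_sq (a : A) : ((‖toHaarPre A a‖ ^ 2 : ℝ) : ℂ) = haarFun A (star a * a) := by
  rw [← haarPre_inner, inner_self_eq_norm_sq_to_K]
  norm_cast

/-- Left multiplication is bounded: for a coefficient of a unitary `U` because the sum of the
`‖u_{kj} x‖²` over a column is `‖x‖²`. -/
lemma exists_norm_mul_le (a : A) :
    ∃ C : ℝ, ∀ x : A, ‖toHaarPre A (a * x)‖ ≤ C * ‖toHaarPre A x‖ := by
  have ha : a ∈ irrSpan A := by rw [irrSpan_eq_top]; trivial
  induction ha using Submodule.span_induction with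
  | mem a h =>
    obtain ⟨⟨J, i, j⟩, rfl⟩ := h
    refine ⟨1, fun x => ?_⟩
    have h : ∑ k, ‖toHaarPre A (J.rep.mat k j * x)‖ ^ 2 = ‖toHaarPre A x‖ ^ 2 := by
      rw [← Complex.ofReal_inj, Complex.ofReal_sum]
      simp only [haarPre_norm_sq, star_mul]
      rw [← map_sum]
      congr 1
      have := congrArg (fun y => star x * y * x) (J.rep.isUnitaryCorep.sum_star_mul j j)
      simpa [Finset.mul_sum, Finset.sum_mul, mul_assoc] using this
    rw [one_mul, ← sq_le_sq₀ (norm_nonneg _) (norm_nonneg _), ← h]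
    exact Finset.single_le_sum (f := fun k => ‖toHaarPre A (J.rep.mat k j * x)‖ ^ 2)
      (fun k _ => sq_nonneg _) (Finset.mem_univ i)
  | zero => exact ⟨0, fun x => by simp⟩
  | add a b _ _ ha hb =>
    obtain ⟨C, hC⟩ := ha
    obtain ⟨D, hD⟩ := hb
    exact ⟨C + D, fun x => by
      rw [add_mul, map_add, add_mul]
      exact (norm_add_le _ _).trans (add_le_add (hC x) (hD x))⟩
  | smul c a _ ha =>
    obtain ⟨C, hC⟩ := ha
    exact ⟨‖c‖ * C, fun x => by
      rw [smul_mul_assoc, map_smul, norm_smul, mul_assoc]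
      exact mul_le_mul_of_nonneg_left (hC x) (norm_nonneg c)⟩

/-- Left multiplication by `a` as a bounded operator. -/
def haarPreMul (a : A) : HaarPre A →L[ℂ] HaarPre A :=
  LinearMap.mkContinuousOfExistsBound
    ((toHaarPre A).toLinearMap ∘ₗ LinearMap.mulLeft ℂ a ∘ₗ (toHaarPre A).symm.toLinearMap)
    (exists_norm_mul_le a)

@[simp]
lemma haarPreMul_apply (a x : A) : haarPreMul a (toHaarPre A x) = toHaarPre A (a * x) := rfl

open UniformSpace in
lemma completion_clm_ext {S T : Completion (HaarPre A) →L[ℂ] Completion (HaarPre A)}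
    (h : ∀ x : A, S (toHaarPre A x : Completion (HaarPre A)) =
      T (toHaarPre A x : Completion (HaarPre A))) : S = T := by
  ext y
  induction y using Completion.induction_on with
  | hp => exact isClosed_eq S.continuous T.continuous
  | ih y => exact h y

open UniformSpace in
variable (A) in
/-- The GNS representation of `A` defined by the Haar functional. -/
def haarRep : A →⋆ₐ[ℂ] (Completion (HaarPre A) →L[ℂ] Completion (HaarPre A)) where
  toFun a := (haarPreMul a).completion
  map_one' := completion_clm_ext fun x => by simp
  map_mul' a b := completion_clm_ext fun x => by simp [mul_assoc]
  map_zero' := completion_clm_ext fun x => by simp [Completion.coe_zero]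
  map_add' a b := completion_clm_ext fun x => by simp [add_mul, Completion.coe_add]
  commutes' r := completion_clm_ext fun x => by
    simp [Algebra.algebraMap_eq_smul_one, Completion.coe_smul]
  map_star' a := by
    rw [ContinuousLinearMap.star_eq_adjoint, ContinuousLinearMap.eq_adjoint_iff]
    intro x y
    induction x, y using Completion.induction_on₂ with
    | hp => apply isClosed_eq <;> fun_prop
    | ih x y =>
      rw [ContinuousLinearMap.completion_apply_coe, ContinuousLinearMap.completion_apply_coe,
        Completion.inner_coe, Completion.inner_coe]
      obtain ⟨x, rfl⟩ := (toHaarPre A).surjective x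
      obtain ⟨y, rfl⟩ := (toHaarPre A).surjective y
      rw [haarPreMul_apply, haarPreMul_apply, haarPre_inner, haarPre_inner, star_mul, star_star,
        mul_assoc]

lemma norm_haarFun_le (a : A) : ‖haarFun A a‖ ≤ univNorm a := by
  let Ω : UniformSpace.Completion (HaarPre A) := (toHaarPre A 1 : HaarPre A)
  have hΩ : ‖Ω‖ = 1 := by
    have h := haarPre_norm_sq (1 : A)
    rw [star_one, one_mul, haarFun_one] at h
    have h1 : ‖toHaarPre A (1 : A)‖ ^ 2 = 1 := by exact_mod_cast h
    rw [UniformSpace.Completion.norm_coe]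
    exact (pow_eq_one_iff_of_nonneg (norm_nonneg _) two_ne_zero).1 h1
  have h1 : haarFun A a = ⟪Ω, haarRep A a Ω⟫_ℂ := by
    change _ = ⟪Ω, (haarPreMul a).completion Ω⟫_ℂ
    rw [ContinuousLinearMap.completion_apply_coe, UniformSpace.Completion.inner_coe,
      haarPreMul_apply, haarPre_inner, star_one, one_mul, mul_one]
  have h2 : ‖haarRep A a‖ ≤ univNorm a := le_univNorm ⟨_, haarRep A⟩ a
  calc ‖haarFun A a‖ ≤ ‖Ω‖ * ‖haarRep A a Ω‖ := by rw [h1]; exact norm_inner_le_norm _ _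
    _ ≤ ‖Ω‖ * (‖haarRep A a‖ * ‖Ω‖) := by gcongr; exact ContinuousLinearMap.le_opNorm _ _
    _ ≤ univNorm a := by rw [hΩ]; simpa using h2

/-- A functional dominated by the universal norm extends to `C_u(G)`. -/
lemma exists_extension (f : A →ₗ[ℂ] ℂ) (hf : ∀ a, ‖f a‖ ≤ univNorm a) :
    ∃ F : Cu A →L[ℂ] ℂ, ∀ a, F (toCu A a) = f a := by
  let f₀ : PreUniv A →L[ℂ] ℂ := LinearMap.mkContinuous
    { toFun := fun a => f a
      map_add' := f.map_add
      map_smul' := f.map_smul } 1 fun a => by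
      rw [one_mul]; exact hf a
  let F₀ : UniformSpace.Completion (PreUniv A) →L[ℂ] ℂ := f₀.fromCompletion
  have hF₀ : Continuous fun x : Cu A => F₀ x := F₀.continuous
  have hval : ∀ a : A, F₀ (toCuFun A a) = f a := fun a => f₀.fromCompletion_apply_coe a
  refine ⟨⟨{ toFun := fun x => F₀ x, map_add' := fun x y => F₀.map_add x y
             map_smul' := fun c x => ?_ }, hF₀⟩, hval⟩
  refine Cu.induction_on (p := fun x => F₀ (c • x : Cu A) = c • F₀ x) x
    (isClosed_eq (hF₀.comp (continuous_const_smul c)) (hF₀.const_smul c)) fun a => ?_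
  rw [← toCuFun_smul, hval, hval, map_smul]

variable (A) in
lemma exists_isHaarState : ∃ h : Cu A →ₚ[ℂ] ℂ, IsHaarState h := by
  obtain ⟨F, hF⟩ := exists_extension (haarFun A) norm_haarFun_le
  have hpos : ∀ x : Cu A, 0 ≤ x → 0 ≤ F x := by
    intro x hx
    obtain ⟨y, rfl⟩ := CStarAlgebra.nonneg_iff_eq_star_mul_self.1 hx
    refine Cu.induction_on (p := fun y => 0 ≤ F (star y * y)) y ?_ fun a => ?_
    · exact isClosed_le continuous_const
        (F.continuous.comp ((continuous_star_cu A).mul continuous_id))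
    · have h1 := hF (star a * a)
      rw [map_mul, map_star] at h1
      exact h1.symm ▸ haarFun_star_mul_self_nonneg a
  let h : Cu A →ₚ[ℂ] ℂ := PositiveLinearMap.mk₀ F.toLinearMap hpos
  have hh : ∀ a, h (toCu A a) = haarFun A a := hF
  have hcomp : h.toLinearMap ∘ₗ (toCu A).toLinearMap = haarFun A := LinearMap.ext hh
  refine ⟨h, ?_, fun a => ?_, fun a => ?_⟩
  · rw [← map_one (toCu A), hh, haarFun_one]
  · rw [hcomp, hh, haarFun_right_inv]
  · rw [hcomp, hh, haarFun_left_inv]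

lemma isHaarState_haar : IsHaarState (haar A) := by
  have H := exists_isHaarState A
  rw [haar, dif_pos H]
  exact H.choose_spec

@[simp]
lemma haar_toCu (a : A) : haar A (toCu A a) = haarFun A a := by
  have H := isHaarState_haar (A := A)
  have : (haar A).toLinearMap ∘ₗ (toCu A).toLinearMap = haarFun A :=
    eq_haarFun (by simpa using H.map_one) fun a => ⟨H.right_inv a, H.left_inv a⟩
  exact LinearMap.congr_fun this a

lemma norm_counit_le (a : A) : ‖Coalgebra.counit (R := ℂ) a‖ ≤ univNorm a := by
  -- `C(PUnit, ℂ)` is a copy of `ℂ` in the universe of `A`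
  let π : CStarRep A :=
    { alg := C(PUnit.{u + 1}, ℂ)
      hom :=
        { toAlgHom := (Algebra.ofId ℂ C(PUnit.{u + 1}, ℂ)).comp (Bialgebra.counitAlgHom ℂ A)
          map_star' := fun a => by
            ext
            exact counit_star a } }
  have h := le_univNorm π a
  exact (ContinuousMap.norm_coe_le_norm (π.hom a) PUnit.unit).trans h

variable (A) in
lemma exists_counit_extension : ∃ e : Cu A →⋆ₐ[ℂ] ℂ, Continuous e ∧
    ∀ a, e (toCu A a) = Coalgebra.counit (R := ℂ) a := by
  obtain ⟨F, hF⟩ := exists_extension (Coalgebra.counit (R := ℂ) (A := A)) norm_counit_le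
  have hs := continuous_star_cu A
  have h1 : F 1 = 1 := by rw [← map_one (toCu A), hF, Bialgebra.counit_one]
  have hmul : ∀ x y, F (x * y) = F x * F y := by
    intro x y
    refine Cu.induction_on (p := fun x => F (x * y) = F x * F y) x
      (isClosed_eq (F.continuous.comp (continuous_id.mul continuous_const))
        (F.continuous.mul continuous_const)) fun a => ?_
    refine Cu.induction_on (p := fun y => F (toCuFun A a * y) = F (toCuFun A a) * F y) y
      (isClosed_eq (F.continuous.comp (continuous_const.mul continuous_id))
        (continuous_const.mul F.continuous)) fun b => ?_
    change F (toCu A a * toCu A b) = F (toCu A a) * F (toCu A b)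
    rw [← map_mul, hF, hF, hF, Bialgebra.counit_mul]
  have hstar : ∀ x, F (star x) = star (F x) := by
    intro x
    refine Cu.induction_on (p := fun x => F (star x) = star (F x)) x
      (isClosed_eq (F.continuous.comp hs) F.continuous.star) fun a => ?_
    change F (star (toCu A a)) = star (F (toCu A a))
    rw [← map_star, hF, hF, counit_star]
  exact ⟨{ toFun := F, map_one' := h1, map_mul' := hmul, map_zero' := map_zero F,
           map_add' := map_add F, commutes' := fun r => by
            rw [Algebra.algebraMap_eq_smul_one, map_smul, h1, Algebra.algebraMap_eq_smul_one]
           map_star' := hstar }, F.continuous, hF⟩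

end HaarState

/-! ### Contractions on a Hilbert space -/

section Contractions

open scoped InnerProductSpace

variable {H : Type*} [NormedAddCommGroup H] [InnerProductSpace ℂ H]

/-- If `‖1 + T‖ = 2` for a contraction `T`, then `T` has almost fixed vectors. -/
lemma exists_re_inner_gt_of_two_le_norm {T : H →L[ℂ] H} (hT : ‖T‖ ≤ 1) (h2 : 2 ≤ ‖1 + T‖)
    {δ : ℝ} (hδ : 0 < δ) : ∃ ξ : H, (1 - δ) * ‖ξ‖ ^ 2 < RCLike.re ⟪ξ, T ξ⟫_ℂ := by
  by_contra! hcon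
  have hle : ∀ ξ, ‖T ξ‖ ≤ ‖ξ‖ := fun ξ => by simpa using T.le_of_opNorm_le hT ξ
  have hb : ‖1 + T‖ ≤ √(4 - 2 * min δ 1) := by
    refine ContinuousLinearMap.opNorm_le_bound _ (Real.sqrt_nonneg _) fun ξ => ?_
    rw [← sq_le_sq₀ (norm_nonneg _) (by positivity), mul_pow,
      Real.sq_sqrt (by linarith [min_le_right δ 1])]
    have h1 : ‖(1 + T) ξ‖ ^ 2 = ‖ξ‖ ^ 2 + 2 * RCLike.re ⟪ξ, T ξ⟫_ℂ + ‖T ξ‖ ^ 2 := by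
      simpa using norm_add_sq (𝕜 := ℂ) ξ (T ξ)
    have h3 : ‖T ξ‖ ^ 2 ≤ ‖ξ‖ ^ 2 := by gcongr; exact hle ξ
    have h4 : min δ 1 * ‖ξ‖ ^ 2 ≤ δ * ‖ξ‖ ^ 2 := by gcongr; exact min_le_left _ _
    rw [h1]
    linarith [hcon ξ]
  have hlt : √(4 - 2 * min δ 1) < 2 := by
    rw [Real.sqrt_lt' two_pos]
    have : 0 < min δ 1 := lt_min hδ one_pos
    linarith
  linarith

lemma norm_sub_sq_le_of_re_inner {T : H →L[ℂ] H} (hT : ‖T‖ ≤ 1) {δ : ℝ} {ξ : H}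
    (h : (1 - δ) * ‖ξ‖ ^ 2 ≤ RCLike.re ⟪ξ, T ξ⟫_ℂ) : ‖T ξ - ξ‖ ^ 2 ≤ 2 * δ * ‖ξ‖ ^ 2 := by
  have hle : ‖T ξ‖ ≤ ‖ξ‖ := by simpa using T.le_of_opNorm_le hT ξ
  have h3 : ‖T ξ‖ ^ 2 ≤ ‖ξ‖ ^ 2 := by gcongr
  rw [norm_sub_rev, norm_sub_sq (𝕜 := ℂ)]
  linarith

/-- For a contraction `T`, the number `1` is in the spectrum if and only if `‖1 + T‖ = 2`. -/
lemma one_mem_spectrum_iff_two_le_norm [CompleteSpace H] {T : H →L[ℂ] H} (hT : ‖T‖ ≤ 1) :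
    (1 : ℂ) ∈ spectrum ℂ T ↔ 2 ≤ ‖1 + T‖ := by
  rw [spectrum.mem_iff, map_one]
  constructor
  · intro h
    by_contra! hlt
    refine h ?_
    have h1 : ‖(2⁻¹ : ℂ) • (1 + T)‖ < 1 := by
      rw [norm_smul, norm_inv, Complex.norm_ofNat]
      linarith
    have h3 : (1 : H →L[ℂ] H) - T = (2 : ℂ) • (1 - (2⁻¹ : ℂ) • (1 + T)) := by
      rw [smul_sub, smul_smul]
      rw [mul_inv_cancel₀ two_ne_zero, one_smul, two_smul]
      abel
    rw [h3]
    exact (isUnit_one_sub_of_norm_lt_one h1).smul (Units.mk0 (2 : ℂ) two_ne_zero)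
  · intro h2 hu
    obtain ⟨u, hu⟩ := hu
    set R : H →L[ℂ] H := ↑u⁻¹
    have hR : ∀ ξ, R (T ξ - ξ) = -ξ := by
      intro ξ
      have h := congrArg (fun S : H →L[ℂ] H => S ξ) u.inv_mul
      rw [hu] at h
      have h' : R (ξ - T ξ) = ξ := by simpa using h
      rw [← h', ← map_neg, neg_sub, h']
    obtain ⟨ξ, hξ⟩ := exists_re_inner_gt_of_two_le_norm hT h2
      (show 0 < 1 / (4 * (‖R‖ ^ 2 + 1)) by positivity)
    have hξ0 : 0 < ‖ξ‖ ^ 2 := by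
      rcases eq_or_ne ξ 0 with rfl | h0
      · simp at hξ
      · positivity
    have h1 := norm_sub_sq_le_of_re_inner hT hξ.le
    have h3 : ‖ξ‖ ≤ ‖R‖ * ‖T ξ - ξ‖ := by
      have := R.le_opNorm (T ξ - ξ)
      rwa [hR, norm_neg] at this
    have h4 : ‖ξ‖ ^ 2 ≤ ‖R‖ ^ 2 * (2 * (1 / (4 * (‖R‖ ^ 2 + 1))) * ‖ξ‖ ^ 2) := by
      calc ‖ξ‖ ^ 2 ≤ (‖R‖ * ‖T ξ - ξ‖) ^ 2 := by gcongr
        _ = ‖R‖ ^ 2 * ‖T ξ - ξ‖ ^ 2 := mul_pow _ _ _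
        _ ≤ _ := by gcongr
    have h5 : ‖R‖ ^ 2 * (2 * (1 / (4 * (‖R‖ ^ 2 + 1))) * ‖ξ‖ ^ 2) =
        (‖R‖ ^ 2 / (‖R‖ ^ 2 + 1)) * (‖ξ‖ ^ 2 / 2) := by
      field_simp
      ring
    have h6 : ‖R‖ ^ 2 / (‖R‖ ^ 2 + 1) ≤ 1 := by
      rw [div_le_one (by positivity)]; linarith
    have h7 : (‖R‖ ^ 2 / (‖R‖ ^ 2 + 1)) * (‖ξ‖ ^ 2 / 2) ≤ 1 * (‖ξ‖ ^ 2 / 2) := by gcongr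
    linarith

/-- Logarithmic convexity: for self-adjoint `T` the growth rate of `‖T ^ n v‖` bounds `‖T v‖`. -/
lemma norm_apply_le_of_forall_pow [CompleteSpace H] {T : H →L[ℂ] H} (hT : IsSelfAdjoint T)
    {M K : ℝ} (hM : 0 ≤ M) {v : H} (h : ∀ n : ℕ, ‖(T ^ n) v‖ ≤ K * M ^ n) :
    ‖T v‖ ≤ M * ‖v‖ := by
  rcases eq_or_ne v 0 with rfl | hv
  · simp
  have hv' : 0 < ‖v‖ := norm_pos_iff.2 hv
  have hsq : ∀ n : ℕ, ‖(T ^ n) v‖ ^ 2 ≤ ‖(T ^ (2 * n)) v‖ * ‖v‖ := by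
    intro n
    have h1 : ⟪(T ^ (2 * n)) v, v⟫_ℂ = ⟪(T ^ n) v, (T ^ n) v⟫_ℂ := by
      rw [two_mul, pow_add, mul_apply_eq_comp]
      have := ContinuousLinearMap.adjoint_inner_left (T ^ n) v ((T ^ n) v)
      rw [← this, ← ContinuousLinearMap.star_eq_adjoint, (hT.pow n).star_eq]
    have h2 := norm_inner_le_norm (𝕜 := ℂ) ((T ^ (2 * n)) v) v
    rw [h1, inner_self_eq_norm_sq_to_K] at h2
    simpa using h2
  by_contra! hlt
  set r := ‖T v‖ / ‖v‖ with hr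
  have hMr : M < r := by rwa [hr, lt_div_iff₀ hv']
  have hr0 : 0 < r := hM.trans_lt hMr
  have hpow : ∀ k : ℕ, r ^ (2 ^ k) * ‖v‖ ≤ ‖(T ^ (2 ^ k)) v‖ := by
    intro k
    induction k with
    | zero => simp [hr, div_mul_cancel₀ _ hv'.ne']
    | succ k ih =>
      have h1 := hsq (2 ^ k)
      rw [← pow_succ'] at h1
      have h2 : (r ^ 2 ^ k * ‖v‖) ^ 2 ≤ ‖(T ^ 2 ^ (k + 1)) v‖ * ‖v‖ :=
        (pow_le_pow_left₀ (by positivity) ih 2).trans h1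
      rw [mul_pow, ← pow_mul, ← pow_succ, sq ‖v‖, ← mul_assoc] at h2
      exact le_of_mul_le_mul_right h2 hv'
  have hK : 0 ≤ K := by simpa using (norm_nonneg _).trans (h 0)
  have hq : M / r < 1 := (div_lt_one hr0).2 hMr
  obtain ⟨n, hn⟩ := exists_pow_lt_of_lt_one (show 0 < ‖v‖ / (K + 1) by positivity) hq
  have hn2 : (M / r) ^ (2 ^ n) < ‖v‖ / (K + 1) :=
    (pow_le_pow_of_le_one (div_nonneg hM hr0.le) hq.le n.lt_two_pow_self.le).trans_lt hn
  have h1 := (hpow n).trans (h _)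
  rw [div_pow, div_lt_div_iff₀ (by positivity) (by positivity)] at hn2
  have h3 : 0 ≤ M ^ 2 ^ n := by positivity
  nlinarith

end Contractions

/-! ### The regular representation -/

section RegularRepresentation

open scoped ComplexOrder InnerProductSpace

variable (A : Type u) [Ring A] [StarRing A] [HopfAlgebra ℂ A] [StarModule ℂ A]
  [CompactQuantumGroup A]

/-- The canonical map `A → L²(G)`. -/
def vec : A →ₗ[ℂ] L2 A where
  toFun a := ((haar A).toPreGNS (toCu A a) : (haar A).PreGNS)
  map_add' a b := by simp [UniformSpace.Completion.coe_add]
  map_smul' c a := by simp [UniformSpace.Completion.coe_smul]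

/-- The representation of `A` on `L²(G)`. -/
def redRep : A →⋆ₐ[ℂ] (L2 A →L[ℂ] L2 A) := (haar A).gnsStarAlgHom.comp (toCu A)

variable {A}

lemma vec_apply (a : A) : vec A a = ((haar A).toPreGNS (toCu A a) : (haar A).PreGNS) := rfl

lemma coe_piH (x : Cu A) : (piH A x : L2 A →L[ℂ] L2 A) = (haar A).gnsStarAlgHom x := rfl

lemma redRep_eq (a : A) : redRep A a = (haar A).gnsStarAlgHom (toCu A a) := rfl

lemma gns_apply_coe (x y : Cu A) :
    (haar A).gnsStarAlgHom x ((haar A).toPreGNS y : (haar A).PreGNS) =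
      ((haar A).toPreGNS (x * y) : (haar A).PreGNS) := by
  exact PositiveLinearMap.gnsNonUnitalStarAlgHom_apply_coe (haar A)

@[simp]
lemma redRep_vec (a b : A) : redRep A a (vec A b) = vec A (a * b) := by
  rw [redRep_eq, vec_apply, gns_apply_coe, vec_apply, map_mul (toCu A)]

lemma inner_vec (a b : A) : ⟪vec A a, vec A b⟫_ℂ = haarFun A (star a * b) := by
  rw [vec_apply, vec_apply, UniformSpace.Completion.inner_coe, PositiveLinearMap.preGNS_inner_def]
  simp [← map_star, ← map_mul]

lemma norm_vec_one : ‖vec A 1‖ = 1 := by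
  have h := inner_vec (1 : A) 1
  rw [inner_self_eq_norm_sq_to_K, star_one, one_mul, haarFun_one] at h
  have h1 : ‖vec A (1 : A)‖ ^ 2 = 1 := by
    rw [← Complex.ofReal_inj, Complex.ofReal_pow]
    exact h
  exact (pow_eq_one_iff_of_nonneg (norm_nonneg _) two_ne_zero).1 h1

lemma denseRange_vec : DenseRange (vec A) := by
  have hcont : Continuous fun x : Cu A => (haar A).gnsStarAlgHom x (vec A 1) :=
    (map_continuous (haar A).gnsStarAlgHom).clm_apply continuous_const
  have hval : ∀ x : Cu A, (haar A).gnsStarAlgHom x (vec A 1) =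
      ((haar A).toPreGNS x : (haar A).PreGNS) := by
    intro x
    rw [vec_apply, map_one, gns_apply_coe, mul_one]
  intro y
  refine UniformSpace.Completion.induction_on y isClosed_closure fun y => ?_
  obtain ⟨x, rfl⟩ := (haar A).toPreGNS.surjective y
  rw [← hval]
  refine Cu.induction_on (p := fun x => (haar A).gnsStarAlgHom x (vec A 1) ∈
    closure (Set.range (vec A))) x (isClosed_closure.preimage hcont) fun a => ?_
  exact subset_closure ⟨a, by rw [hval]; rfl⟩

lemma redRep_star (a : A) : redRep A (star a) = (redRep A a).adjoint := by
  rw [map_star, ContinuousLinearMap.star_eq_adjoint]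

lemma inner_redRep_right (a : A) (ξ η : L2 A) :
    ⟪redRep A a ξ, η⟫_ℂ = ⟪ξ, redRep A (star a) η⟫_ℂ := by
  rw [redRep_star, ContinuousLinearMap.adjoint_inner_right]

variable {ι : Type*} [Fintype ι] [DecidableEq ι] {U : Matrix ι ι A}

lemma IsUnitaryCorep.sum_norm_sq (hU : IsUnitaryCorep U) (i : ι) (ξ : L2 A) :
    ∑ k, ‖redRep A (U k i) ξ‖ ^ 2 = ‖ξ‖ ^ 2 := by
  have h : ∀ η : L2 A, ((‖η‖ ^ 2 : ℝ) : ℂ) = ⟪η, η⟫_ℂ := fun η => by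
    rw [inner_self_eq_norm_sq_to_K]; norm_cast
  rw [← Complex.ofReal_inj, Complex.ofReal_sum]
  simp only [h]
  simp only [inner_redRep_right]
  rw [← inner_sum]
  congr 1
  have := congrArg (fun a => redRep A a ξ) (hU.sum_star_mul i i)
  simpa using this

lemma IsUnitaryCorep.norm_redRep_le_one (hU : IsUnitaryCorep U) (i j : ι) :
    ‖redRep A (U i j)‖ ≤ 1 := by
  refine ContinuousLinearMap.opNorm_le_bound _ zero_le_one fun ξ => ?_
  rw [one_mul, ← sq_le_sq₀ (norm_nonneg _) (norm_nonneg _), ← hU.sum_norm_sq j ξ]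
  exact Finset.single_le_sum (f := fun k => ‖redRep A (U k j) ξ‖ ^ 2)
    (fun k _ => sq_nonneg _) (Finset.mem_univ i)

/-- A vector almost fixed by a diagonal coefficient is almost invariant under the whole column. -/
lemma IsUnitaryCorep.norm_sub_counit_sq_le (hU : IsUnitaryCorep U) {δ : ℝ} {ξ : L2 A} {i : ι}
    (h : (1 - δ) * ‖ξ‖ ^ 2 ≤ RCLike.re ⟪ξ, redRep A (U i i) ξ⟫_ℂ) (k : ι) :
    ‖redRep A (U k i) ξ - Coalgebra.counit (R := ℂ) (U k i) • ξ‖ ^ 2 ≤ 2 * δ * ‖ξ‖ ^ 2 := by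
  have h1 := norm_sub_sq_le_of_re_inner (hU.norm_redRep_le_one i i) h
  rw [hU.counit_apply]
  by_cases hk : k = i
  · subst hk; simpa using h1
  · rw [if_neg hk, zero_smul, sub_zero]
    have h2 : ‖redRep A (U k i) ξ‖ ^ 2 + ‖redRep A (U i i) ξ‖ ^ 2 ≤ ‖ξ‖ ^ 2 := by
      rw [← hU.sum_norm_sq i ξ, ← Finset.sum_pair (f := fun k => ‖redRep A (U k i) ξ‖ ^ 2) hk]
      exact Finset.sum_le_sum_of_subset_of_nonneg (Finset.subset_univ _) fun _ _ _ => sq_nonneg _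
    have h3 := sq_nonneg ‖ξ - redRep A (U i i) ξ‖
    rw [norm_sub_sq (𝕜 := ℂ)] at h3
    linarith

lemma Irr.norm_redRep_chr_le (j : Irr A) : ‖redRep A j.chr‖ ≤ j.dim := by
  rw [Irr.chr, Matrix.trace, map_sum]
  refine (norm_sum_le _ _).trans ((Finset.sum_le_sum fun i _ =>
    j.rep.isUnitaryCorep.norm_redRep_le_one i i).trans ?_)
  simp [Irr.dim]

end RegularRepresentation

/-! ### The fusion operators inside the regular representation -/

section FusionSpace

open scoped ComplexOrder InnerProductSpace

variable (A : Type u) [Ring A] [StarRing A] [HopfAlgebra ℂ A] [StarModule ℂ A]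
  [CompactQuantumGroup A]

lemma orthonormal_chr : Orthonormal ℂ fun j : Irr A => vec A j.chr := by
  classical
  rw [orthonormal_iff_ite]
  intro i j
  rw [inner_vec, haarFun_star_chr_mul_chr]

/-- The isometry `ℓ²(I) → L²(G)` that sends `δ_j` to the character of `U_j`. -/
def chrIsometry : lp (fun _ : Irr A => ℂ) 2 →ₗᵢ[ℂ] L2 A :=
  (orthonormal_chr A).orthogonalFamily.linearIsometry

/-- The isometry `chrIsometry` as a continuous linear map. -/
def chrMap : lp (fun _ : Irr A => ℂ) 2 →L[ℂ] L2 A := (chrIsometry A).toContinuousLinearMap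

lemma chrMap_apply (ξ : lp (fun _ : Irr A => ℂ) 2) : chrMap A ξ = chrIsometry A ξ := rfl

/-- The compression of the representation of `A` on `L²(G)` to `ℓ²(I)`. -/
def fusionRep : A →ₗ[ℂ] (lp (fun _ : Irr A => ℂ) 2 →L[ℂ] lp (fun _ : Irr A => ℂ) 2) where
  toFun a := (chrMap A).adjoint ∘L redRep A a ∘L chrMap A
  map_add' a b := by
    rw [map_add, ContinuousLinearMap.add_comp, ContinuousLinearMap.comp_add]
  map_smul' c a := by
    rw [map_smul, ContinuousLinearMap.smul_comp, ContinuousLinearMap.comp_smul]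
    rfl

variable {A}

lemma fusionRep_apply (a : A) : fusionRep A a = (chrMap A).adjoint ∘L redRep A a ∘L chrMap A := rfl

open Classical in
@[simp]
lemma chrIsometry_single (j : Irr A) :
    chrIsometry A (lp.single 2 j (1 : ℂ)) = vec A j.chr := by
  rw [chrIsometry, OrthogonalFamily.linearIsometry_apply_single]
  simp

lemma inner_fusionRep (a : A) (ξ η : lp (fun _ : Irr A => ℂ) 2) :
    ⟪ξ, fusionRep A a η⟫_ℂ = ⟪chrIsometry A ξ, redRep A a (chrIsometry A η)⟫_ℂ := by
  rw [fusionRep_apply, ContinuousLinearMap.comp_apply, ContinuousLinearMap.comp_apply,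
    ContinuousLinearMap.adjoint_inner_right, chrMap_apply, chrMap_apply]

lemma norm_fusionRep_le (a : A) : ‖fusionRep A a‖ ≤ ‖redRep A a‖ := by
  have h1 : ‖chrMap A‖ ≤ 1 :=
    (chrIsometry A).norm_toContinuousLinearMap_le
  have h2 : ‖(chrMap A).adjoint‖ ≤ 1 := by
    rwa [LinearIsometryEquiv.norm_map]
  calc ‖fusionRep A a‖ ≤ 1 * (‖redRep A a‖ * 1) :=
        (ContinuousLinearMap.opNorm_comp_le _ _).trans (mul_le_mul h2
          ((ContinuousLinearMap.opNorm_comp_le _ _).trans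
            (mul_le_mul_of_nonneg_left h1 (norm_nonneg _))) (norm_nonneg _) zero_le_one)
    _ = _ := by ring

lemma fusionRep_star (a : A) : fusionRep A (star a) = (fusionRep A a).adjoint := by
  rw [ContinuousLinearMap.eq_adjoint_iff]
  intro ξ η
  rw [← inner_conj_symm, inner_fusionRep, inner_conj_symm, inner_redRep_right, star_star,
    inner_fusionRep]

@[simp]
lemma fusionRep_one : fusionRep A 1 = 1 := by
  refine ContinuousLinearMap.ext fun ξ => ext_inner_left ℂ fun η => ?_
  rw [inner_fusionRep, map_one, one_apply_eq_self, LinearIsometry.inner_map_map]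
  rfl

lemma isLeftMul_fusionRep_chr (j : Irr A) :
    IsLeftMul (fusionMult (A := A)) j (fusionRep A j.chr) := by
  classical
  intro k i
  have h := inner_fusionRep j.chr (lp.single 2 i (1 : ℂ)) (lp.single 2 k (1 : ℂ))
  rw [chrIsometry_single, chrIsometry_single, redRep_vec, inner_vec,
    haarFun_star_chr_mul_chr_mul_chr, lp.inner_single_left] at h
  have h' : (fusionRep A j.chr (lp.single 2 k (1 : ℂ)) : Irr A → ℂ) i = fusionMult j k i := by
    simpa using h
  convert h'

lemma clm_ext_single {I : Type*} {E : Type*} [NormedAddCommGroup E] [NormedSpace ℂ E]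
    [DecidableEq I] {S T : lp (fun _ : I => ℂ) 2 →L[ℂ] E}
    (h : ∀ k, S (lp.single 2 k (1 : ℂ)) = T (lp.single 2 k (1 : ℂ))) : S = T := by
  ext ξ
  have hs := lp.hasSum_single (E := fun _ : I => ℂ) (by simp : (2 : ENNReal) ≠ ⊤) ξ
  have h1 := S.hasSum hs
  have h2 := T.hasSum hs
  have h3 : ∀ k, S (lp.single 2 k (ξ k)) = T (lp.single 2 k (ξ k)) := by
    intro k
    have : (lp.single 2 k (ξ k) : lp (fun _ : I => ℂ) 2) = (ξ k) • lp.single 2 k (1 : ℂ) := by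
      rw [← lp.single_smul]; simp
    rw [this, map_smul, map_smul, h]
  simp only [h3] at h1
  exact h1.unique h2

lemma IsLeftMul.unique {I : Type*} {m : I → I → I → ℕ} {j : I}
    {S T : lp (fun _ : I => ℂ) 2 →L[ℂ] lp (fun _ : I => ℂ) 2}
    (hS : IsLeftMul m j S) (hT : IsLeftMul m j T) : S = T := by
  classical
  refine clm_ext_single fun k => lp.ext (funext fun i => ?_)
  have h1 := hS k i
  have h2 := hT k i
  convert h1.trans h2.symm

lemma vec_mem_range_chrIsometry {a : A} (ha : a ∈ cocomm A) :
    ∃ ξ, chrIsometry A ξ = vec A a := by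
  classical
  have h : Submodule.span ℂ (Set.range (Irr.chr (A := A))) ≤
      (LinearMap.range (chrIsometry A).toLinearMap).comap (vec A) := by
    rw [Submodule.span_le]
    rintro _ ⟨j, rfl⟩
    exact ⟨_, chrIsometry_single j⟩
  exact h (mem_span_chr_of_mem_cocomm ha)

/-- The range of the isometry is invariant under cocommutative elements. -/
lemma chrIsometry_fusionRep {a : A} (ha : a ∈ cocomm A) (ξ : lp (fun _ : Irr A => ℂ) 2) :
    chrIsometry A (fusionRep A a ξ) = redRep A a (chrIsometry A ξ) := by
  classical
  have : chrMap A ∘L fusionRep A a = redRep A a ∘L chrMap A := by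
    refine clm_ext_single fun k => ?_
    obtain ⟨η, hη⟩ := vec_mem_range_chrIsometry (mul_mem ha k.chr_mem_cocomm)
    have h1 : fusionRep A a (lp.single 2 k (1 : ℂ)) = η := by
      refine ext_inner_left ℂ fun ζ => ?_
      rw [inner_fusionRep, chrIsometry_single, redRep_vec, ← hη, LinearIsometry.inner_map_map]
    change chrIsometry A (fusionRep A a (lp.single 2 k (1 : ℂ))) =
      redRep A a (chrIsometry A (lp.single 2 k (1 : ℂ)))
    rw [h1, hη, chrIsometry_single, redRep_vec]
  exact congrArg (fun S : lp (fun _ : Irr A => ℂ) 2 →L[ℂ] L2 A => S ξ) this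

lemma fusionRep_mul {a b : A} (hb : b ∈ cocomm A) :
    fusionRep A (a * b) = fusionRep A a * fusionRep A b := by
  refine ContinuousLinearMap.ext fun ξ => ext_inner_left ℂ fun η => ?_
  rw [inner_fusionRep, map_mul, mul_apply_eq_comp, mul_apply_eq_comp,
    inner_fusionRep, chrIsometry_fusionRep hb]

/-- On cocommutative elements the compression to `ℓ²(I)` does not decrease the norm. For
`c = b* b` and `x ∈ A`, moving `x` past the Haar functional bounds `‖cⁿ x‖` by a constant times
`‖cⁿ 1‖`, a norm computed in `ℓ²(I)`; logarithmic convexity then removes the constant. -/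
lemma norm_redRep_le_norm_fusionRep {b : A} (hb : b ∈ cocomm A) :
    ‖redRep A b‖ ≤ ‖fusionRep A b‖ := by
  set c := star b * b with hc
  have hcm : c ∈ cocomm A := mul_mem (star_mem hb) hb
  have hcs : star c = c := by rw [hc, star_mul, star_star]
  have hone : ∀ n : ℕ, ‖vec A (c ^ n)‖ ≤ ‖fusionRep A c‖ ^ n := by
    obtain ⟨ω, hω⟩ := vec_mem_range_chrIsometry (one_mem (cocomm A))
    have hω1 : ‖ω‖ = 1 := by rw [← (chrIsometry A).norm_map, hω, norm_vec_one]
    have hpow : ∀ n : ℕ, vec A (c ^ n) = chrIsometry A ((fusionRep A c ^ n) ω) := by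
      intro n
      induction n with
      | zero => simp [hω]
      | succ n ih =>
        rw [pow_succ', ← redRep_vec, ih, ← chrIsometry_fusionRep hcm, pow_succ']
        rfl
    intro n
    rw [hpow, LinearIsometry.norm_map]
    calc _ ≤ ‖fusionRep A c ^ n‖ * ‖ω‖ := ContinuousLinearMap.le_opNorm _ _
      _ ≤ ‖fusionRep A c‖ ^ n := by
        rw [hω1, mul_one]
        rcases Nat.eq_zero_or_pos n with rfl | hn
        · simp only [pow_zero]; exact ContinuousLinearMap.norm_id_le
        · exact norm_pow_le' _ hn
  have hsa : IsSelfAdjoint (redRep A c) := by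
    rw [IsSelfAdjoint, ← map_star, hcs]
  have hT : ‖redRep A c‖ ≤ ‖fusionRep A c‖ := by
    refine ContinuousLinearMap.opNorm_le_bound _ (norm_nonneg _) fun ξ => ?_
    refine denseRange_vec.induction_on (p := fun ξ => ‖redRep A c ξ‖ ≤ ‖fusionRep A c‖ * ‖ξ‖) ξ
      (isClosed_le (by fun_prop) (by fun_prop)) fun x => ?_
    obtain ⟨z, hz⟩ := exists_haarFun_mul_comm (star x)
    refine norm_apply_le_of_forall_pow hsa (norm_nonneg _) (K := √‖vec A (x * z)‖) fun n => ?_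
    have h1 : ⟪vec A (c ^ n * x), vec A (c ^ n * x)⟫_ℂ = ⟪vec A (c ^ (2 * n)), vec A (x * z)⟫_ℂ := by
      rw [inner_vec, inner_vec, star_mul, star_pow, star_pow, hcs, mul_assoc, hz, two_mul, pow_add]
      simp only [mul_assoc]
    have h2 : ‖vec A (c ^ n * x)‖ ^ 2 ≤ ‖fusionRep A c‖ ^ (2 * n) * ‖vec A (x * z)‖ := by
      have h3 := norm_inner_le_norm (𝕜 := ℂ) (vec A (c ^ (2 * n))) (vec A (x * z))
      rw [← h1, inner_self_eq_norm_sq_to_K] at h3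
      have h4 : ‖vec A (c ^ n * x)‖ ^ 2 ≤ ‖vec A (c ^ (2 * n))‖ * ‖vec A (x * z)‖ := by
        simpa using h3
      exact h4.trans (by gcongr; exact hone _)
    rw [← map_pow, redRep_vec, ← sq_le_sq₀ (norm_nonneg _) (by positivity), mul_pow,
      Real.sq_sqrt (norm_nonneg _), ← pow_mul, mul_comm n 2, mul_comm ‖vec A _‖]
    exact h2
  have h5 : ‖redRep A b‖ * ‖redRep A b‖ = ‖redRep A c‖ := by
    rw [hc, map_mul, map_star]
    exact (CStarRing.norm_star_mul_self (x := redRep A b)).symm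
  have h6 : ‖fusionRep A b‖ * ‖fusionRep A b‖ = ‖fusionRep A c‖ := by
    rw [hc, fusionRep_mul hb, fusionRep_star, ← ContinuousLinearMap.star_eq_adjoint]
    exact (CStarRing.norm_star_mul_self (x := fusionRep A b)).symm
  rw [← h5, ← h6] at hT
  exact (mul_self_le_mul_self_iff (norm_nonneg _) (norm_nonneg _)).2 hT

end FusionSpace

/-! ### Almost invariant vectors -/

section AlmostInvariant

open scoped ComplexOrder InnerProductSpace

variable (A : Type u) [Ring A] [StarRing A] [HopfAlgebra ℂ A] [StarModule ℂ A]
  [CompactQuantumGroup A]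

/-- The regular representation almost has invariant vectors. -/
def HasAlmostInvariantVectors : Prop :=
  ∀ (S : Finset A) (δ : ℝ), 0 < δ → ∃ ξ : L2 A, ξ ≠ 0 ∧
    ∀ a ∈ S, ‖redRep A a ξ - Coalgebra.counit (R := ℂ) a • ξ‖ ≤ δ * ‖ξ‖

variable {A}

/-- The map `a ↦ π(a) ξ - ε(a) ξ`. -/
def defect (ξ : L2 A) : A →ₗ[ℂ] L2 A where
  toFun a := redRep A a ξ - Coalgebra.counit (R := ℂ) a • ξ
  map_add' a b := by simp only [map_add, add_smul, add_apply]; abel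
  map_smul' c a := by
    simp only [map_smul, smul_assoc, smul_apply, smul_sub, RingHom.id_apply]

lemma defect_apply (ξ : L2 A) (a : A) :
    defect ξ a = redRep A a ξ - Coalgebra.counit (R := ℂ) a • ξ := rfl

lemma continuous_defect (a : A) : Continuous fun ξ : L2 A => defect ξ a := by
  exact (redRep A a).continuous.sub (continuous_const_smul _)

lemma exists_norm_defect_le (a : A) : ∃ (F : Finset (Irr A)) (C : ℝ), 0 ≤ C ∧
    ∀ (ξ : L2 A) (η : ℝ), (∀ j ∈ F, ∀ p q, ‖defect ξ (j.rep.mat p q)‖ ≤ η) →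
      ‖defect ξ a‖ ≤ C * η := by
  obtain ⟨F, c, rfl⟩ := exists_eq_sum_coeff a
  refine ⟨F, ∑ j ∈ F, ∑ p, ∑ q, ‖c j p q‖, by positivity, fun ξ η h => ?_⟩
  simp only [map_sum, map_smul, Finset.sum_mul]
  refine (norm_sum_le _ _).trans (Finset.sum_le_sum fun j hj => ?_)
  refine (norm_sum_le _ _).trans (Finset.sum_le_sum fun p _ => ?_)
  refine (norm_sum_le _ _).trans (Finset.sum_le_sum fun q _ => ?_)
  rw [norm_smul]
  exact mul_le_mul_of_nonneg_left (h j hj p q) (norm_nonneg _)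

variable (A) in
lemma nonempty_irr : Nonempty (Irr A) := by
  obtain ⟨F, c, h⟩ := exists_eq_sum_coeff (1 : A)
  rcases F.eq_empty_or_nonempty with rfl | ⟨j, _⟩
  · have h1 := haarFun_one (A := A)
    rw [h] at h1
    simp at h1
  · exact ⟨j⟩

/-- The combination `∑ (w_j / dim U_j) χ_j` over a finite set. -/
def weightedChr (F : Finset (Irr A)) (w : Irr A → ℝ) : A :=
  ∑ j ∈ F, ((w j / j.dim : ℝ) : ℂ) • j.chr

lemma weightedChr_mem_cocomm (F : Finset (Irr A)) (w : Irr A → ℝ) :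
    weightedChr F w ∈ cocomm A :=
  sum_mem fun j _ => SMulMemClass.smul_mem _ j.chr_mem_cocomm

lemma counit_weightedChr (F : Finset (Irr A)) (w : Irr A → ℝ) :
    Coalgebra.counit (R := ℂ) (weightedChr F w) = ((∑ j ∈ F, w j : ℝ) : ℂ) := by
  rw [weightedChr, map_sum, Complex.ofReal_sum]
  refine Finset.sum_congr rfl fun j _ => ?_
  rw [map_smul, Irr.counit_chr, smul_eq_mul, ← Complex.ofReal_mul, div_mul_cancel₀ _ j.dim_pos.ne']

lemma norm_smul_redRep_chr_le {j : Irr A} {w : ℝ} (hw : 0 ≤ w) :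
    ‖((w / j.dim : ℝ) : ℂ) • redRep A j.chr‖ ≤ w := by
  have hd := j.dim_pos
  rw [norm_smul, Complex.norm_real, Real.norm_of_nonneg (by positivity)]
  calc w / j.dim * ‖redRep A j.chr‖ ≤ w / j.dim * j.dim := by
        gcongr; exact j.norm_redRep_chr_le
    _ = w := div_mul_cancel₀ _ hd.ne'

lemma norm_redRep_weightedChr_le {F : Finset (Irr A)} {w : Irr A → ℝ} (hw : ∀ j, 0 ≤ w j) :
    ‖redRep A (weightedChr F w)‖ ≤ ∑ j ∈ F, w j := by
  rw [weightedChr, map_sum]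
  refine (norm_sum_le _ _).trans (Finset.sum_le_sum fun j _ => ?_)
  rw [map_smul]
  exact norm_smul_redRep_chr_le (hw j)

/-- Vectors almost fixed by a convex combination of the normalised characters are almost
invariant: each diagonal coefficient is a contraction and so must almost fix them. -/
lemma exists_norm_defect_le_of_weightedChr {F : Finset (Irr A)} {w : Irr A → ℝ}
    (hw : ∀ j ∈ F, 0 < w j) (hw1 : ∑ j ∈ F, w j = 1)
    (h : ∀ δ : ℝ, 0 < δ → ∃ ξ : L2 A,
      (1 - δ) * ‖ξ‖ ^ 2 < RCLike.re ⟪ξ, redRep A (weightedChr F w) ξ⟫_ℂ)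
    {η : ℝ} (hη : 0 < η) :
    ∃ ξ : L2 A, ξ ≠ 0 ∧ ∀ j ∈ F, ∀ p q, ‖defect ξ (j.rep.mat p q)‖ ≤ η * ‖ξ‖ := by
  have hD : 0 ≤ ∑ j ∈ F, j.dim / w j :=
    Finset.sum_nonneg fun j hj => div_nonneg j.dim_pos.le (hw j hj).le
  set D := ∑ j ∈ F, j.dim / w j
  obtain ⟨ξ, hξ⟩ := h (η ^ 2 / (2 * (D + 1))) (by positivity)
  set δ := η ^ 2 / (2 * (D + 1)) with hδ
  have hξ0 : ξ ≠ 0 := by rintro rfl; simp at hξ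
  refine ⟨ξ, hξ0, fun j hj p q => ?_⟩
  -- the deficiency of each diagonal coefficient is nonnegative
  have hnn : ∀ (j : Irr A) (i), 0 ≤ ‖ξ‖ ^ 2 - RCLike.re ⟪ξ, redRep A (j.rep.mat i i) ξ⟫_ℂ := by
    intro j i
    have h1 := (re_inner_le_norm (𝕜 := ℂ) ξ (redRep A (j.rep.mat i i) ξ))
    have h2 : ‖redRep A (j.rep.mat i i) ξ‖ ≤ ‖ξ‖ := by
      simpa using (redRep A (j.rep.mat i i)).le_of_opNorm_le
        (j.rep.isUnitaryCorep.norm_redRep_le_one i i) ξ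
    nlinarith [norm_nonneg ξ]
  have hre : ‖ξ‖ ^ 2 - RCLike.re ⟪ξ, redRep A (weightedChr F w) ξ⟫_ℂ =
      ∑ j ∈ F, w j / j.dim * ∑ i, (‖ξ‖ ^ 2 - RCLike.re ⟪ξ, redRep A (j.rep.mat i i) ξ⟫_ℂ) := by
    have e1 : RCLike.re ⟪ξ, redRep A (weightedChr F w) ξ⟫_ℂ =
        ∑ j ∈ F, w j / j.dim * ∑ i, RCLike.re ⟪ξ, redRep A (j.rep.mat i i) ξ⟫_ℂ := by
      simp only [weightedChr, map_sum, map_smul, sum_apply,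
        smul_apply, inner_sum, inner_smul_right]
      refine Finset.sum_congr rfl fun j _ => ?_
      rw [Irr.chr, Matrix.trace, map_sum, sum_apply, inner_sum, ← map_sum]
      exact Complex.re_ofReal_mul _ _
    have e2 : ‖ξ‖ ^ 2 = ∑ j ∈ F, w j / j.dim * ∑ _i : Fin j.rep.dim, ‖ξ‖ ^ 2 := by
      have : ∀ j ∈ F, w j / j.dim * ∑ _i : Fin j.rep.dim, ‖ξ‖ ^ 2 = w j * ‖ξ‖ ^ 2 := by
        intro j _
        rw [Finset.sum_const, Finset.card_univ, Fintype.card_fin, nsmul_eq_mul]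
        change w j / j.dim * (j.dim * ‖ξ‖ ^ 2) = _
        rw [← mul_assoc, div_mul_cancel₀ _ j.dim_pos.ne']
      rw [Finset.sum_congr rfl this, ← Finset.sum_mul, hw1, one_mul]
    rw [e1]
    conv_lhs => rw [e2]
    rw [← Finset.sum_sub_distrib]
    exact Finset.sum_congr rfl fun j _ => by rw [Finset.sum_sub_distrib, mul_sub]
  have hq : w j / j.dim * (‖ξ‖ ^ 2 - RCLike.re ⟪ξ, redRep A (j.rep.mat q q) ξ⟫_ℂ) ≤
      δ * ‖ξ‖ ^ 2 := by
    have h1 : w j / j.dim * (‖ξ‖ ^ 2 - RCLike.re ⟪ξ, redRep A (j.rep.mat q q) ξ⟫_ℂ) ≤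
        w j / j.dim * ∑ i, (‖ξ‖ ^ 2 - RCLike.re ⟪ξ, redRep A (j.rep.mat i i) ξ⟫_ℂ) :=
      mul_le_mul_of_nonneg_left (Finset.single_le_sum (fun i _ => hnn j i) (Finset.mem_univ q))
        (div_nonneg (hw j hj).le j.dim_pos.le)
    have h2 := Finset.single_le_sum (f := fun j : Irr A => w j / j.dim *
      ∑ i, (‖ξ‖ ^ 2 - RCLike.re ⟪ξ, redRep A (j.rep.mat i i) ξ⟫_ℂ))
      (fun j hj => mul_nonneg (div_nonneg (hw j hj).le j.dim_pos.le)
        (Finset.sum_nonneg fun i _ => hnn j i)) hj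
    rw [← hre] at h2
    linarith
  have hwj := hw j hj
  have hdj := j.dim_pos
  have hq' : (1 - δ * (j.dim / w j)) * ‖ξ‖ ^ 2 ≤
      RCLike.re ⟪ξ, redRep A (j.rep.mat q q) ξ⟫_ℂ := by
    have := mul_le_mul_of_nonneg_left hq (div_nonneg hdj.le hwj.le)
    rw [← mul_assoc, div_mul_div_cancel₀ hwj.ne', div_self hdj.ne', one_mul] at this
    linarith
  have h3 := j.rep.isUnitaryCorep.norm_sub_counit_sq_le hq' p
  rw [← sq_le_sq₀ (norm_nonneg _) (by positivity), mul_pow]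
  refine h3.trans ?_
  gcongr
  have h4 : j.dim / w j ≤ D := Finset.single_le_sum (f := fun j : Irr A => j.dim / w j)
    (fun j hj => div_nonneg j.dim_pos.le (hw j hj).le) hj
  calc 2 * (δ * (j.dim / w j)) ≤ 2 * (δ * (D + 1)) := by
        gcongr; linarith
    _ = η ^ 2 := by rw [hδ]; field_simp

/-- It suffices to find vectors almost fixed by averages of normalised characters. -/
lemma hasAlmostInvariantVectors_of_average
    (h : ∀ F : Finset (Irr A), F.Nonempty → ∀ δ : ℝ, 0 < δ → ∃ ξ : L2 A, (1 - δ) * ‖ξ‖ ^ 2 <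
      RCLike.re ⟪ξ, redRep A (weightedChr F fun _ => (F.card : ℝ)⁻¹) ξ⟫_ℂ) :
    HasAlmostInvariantVectors A := by
  classical
  intro S δ hδ
  choose F C hC0 hC using exists_norm_defect_le (A := A)
  obtain ⟨j₀⟩ := nonempty_irr A
  set F' := insert j₀ (S.biUnion F)
  have hF' : F'.Nonempty := Finset.insert_nonempty _ _
  have hcard : (0 : ℝ) < F'.card := by exact_mod_cast hF'.card_pos
  have hsum : 0 ≤ ∑ a ∈ S, C a := Finset.sum_nonneg fun a _ => hC0 a
  obtain ⟨ξ, hξ0, hξ⟩ := exists_norm_defect_le_of_weightedChr (F := F')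
    (w := fun _ => (F'.card : ℝ)⁻¹) (fun _ _ => inv_pos.2 hcard)
    (by rw [Finset.sum_const, nsmul_eq_mul, mul_inv_cancel₀ hcard.ne']) (h F' hF')
    (show 0 < δ / (∑ a ∈ S, C a + 1) by positivity)
  refine ⟨ξ, hξ0, fun a ha => ?_⟩
  have h1 := hC a ξ _ fun j hj p q => hξ j (Finset.mem_insert_of_mem
    (Finset.mem_biUnion.2 ⟨a, ha, hj⟩)) p q
  refine h1.trans ?_
  rw [← mul_assoc]
  gcongr
  have h2 : C a ≤ ∑ a ∈ S, C a := Finset.single_le_sum (fun a _ => hC0 a) ha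
  rw [mul_div_assoc', div_le_iff₀ (by positivity), mul_comm]
  gcongr
  linarith

lemma HasAlmostInvariantVectors.exists_vec (h : HasAlmostInvariantVectors A) (S : Finset A)
    {δ : ℝ} (hδ : 0 < δ) : ∃ x : A, vec A x ≠ 0 ∧
      ∀ a ∈ S, ‖defect (vec A x) a‖ ≤ δ * ‖vec A x‖ := by
  obtain ⟨ξ, hξ0, hξ⟩ := h S (δ / 2) (by positivity)
  have hopen : IsOpen ({ξ : L2 A | ξ ≠ 0} ∩ ⋂ a ∈ S, {ξ | ‖defect ξ a‖ < δ * ‖ξ‖}) :=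
    isOpen_ne.inter (isOpen_biInter_finset fun a _ =>
      isOpen_lt (continuous_defect a).norm (by fun_prop))
  obtain ⟨x, hx0, hx⟩ := denseRange_vec.exists_mem_open hopen ⟨ξ, hξ0, by
    refine Set.mem_iInter₂.2 fun a ha => ?_
    have : 0 < ‖ξ‖ := norm_pos_iff.2 hξ0
    refine (hξ a ha).trans_lt ?_
    gcongr
    linarith⟩
  exact ⟨x, hx0, fun a ha => (Set.mem_iInter₂.1 hx a ha).le⟩

end AlmostInvariant

/-! ### Amenability of the fusion ring -/

section Amenability

open scoped ComplexOrder InnerProductSpace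

variable {A : Type u} [Ring A] [StarRing A] [HopfAlgebra ℂ A] [StarModule ℂ A]
  [CompactQuantumGroup A]

lemma norm_smul_fusionRep_chr_le {j : Irr A} {w : ℝ} (hw : 0 ≤ w) :
    ‖((w / j.dim : ℝ) : ℂ) • fusionRep A j.chr‖ ≤ w := by
  refine le_trans ?_ (norm_smul_redRep_chr_le (j := j) hw)
  rw [← map_smul, ← map_smul]
  exact norm_fusionRep_le _

lemma hasAlmostInvariantVectors_of_isAmenableFusion
    (h : IsAmenableFusion (fusionMult (A := A)) Irr.dim) : HasAlmostInvariantVectors A := by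
  classical
  refine hasAlmostInvariantVectors_of_average fun F hF δ hδ => ?_
  have hcard : (0 : ℝ) < F.card := by exact_mod_cast hF.card_pos
  obtain ⟨T, ⟨Λ, hΛ, hsum⟩, hT⟩ := h (PMF.uniformOfFinset F hF)
  have hΛ' : ∀ j, Λ j = fusionRep A j.chr := fun j => (hΛ j).unique (isLeftMul_fusionRep_chr j)
  have hμ : ∀ j ∈ F, (PMF.uniformOfFinset F hF j).toReal = (F.card : ℝ)⁻¹ := by
    intro j hj
    rw [PMF.uniformOfFinset_apply_of_mem hF hj]
    simp
  have hTF : T = fusionRep A (weightedChr F fun _ => (F.card : ℝ)⁻¹) := by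
    refine hsum.unique ?_
    rw [weightedChr, map_sum]
    have : ∑ j ∈ F, fusionRep A ((((F.card : ℝ)⁻¹ / j.dim : ℝ) : ℂ) • j.chr) =
        ∑ j ∈ F, (((PMF.uniformOfFinset F hF j).toReal / j.dim : ℝ) : ℂ) • Λ j :=
      Finset.sum_congr rfl fun j hj => by rw [hμ j hj, map_smul, hΛ']
    rw [this]
    refine hasSum_sum_of_ne_finset_zero fun j hj => ?_
    rw [PMF.uniformOfFinset_apply_of_notMem hF hj]
    simp
  have hw : ∑ _j ∈ F, (F.card : ℝ)⁻¹ = 1 := by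
    rw [Finset.sum_const, nsmul_eq_mul, mul_inv_cancel₀ hcard.ne']
  have hT1 : ‖T‖ ≤ 1 := by
    rw [hTF]
    exact (norm_fusionRep_le _).trans
      ((norm_redRep_weightedChr_le fun _ => (inv_pos.2 hcard).le).trans hw.le)
  obtain ⟨ξ, hξ⟩ := exists_re_inner_gt_of_two_le_norm hT1
    ((one_mem_spectrum_iff_two_le_norm hT1).1 hT) hδ
  refine ⟨chrIsometry A ξ, ?_⟩
  rwa [LinearIsometry.norm_map, ← inner_fusionRep, ← hTF]

lemma isAmenableFusion_of_norm_counit_le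
    (h : ∀ a : A, ‖Coalgebra.counit (R := ℂ) a‖ ≤ ‖redRep A a‖) :
    IsAmenableFusion (fusionMult (A := A)) Irr.dim := by
  intro μ
  have hμ0 : ∀ j, 0 ≤ (μ j).toReal := fun j => ENNReal.toReal_nonneg
  have hμ : HasSum (fun j => (μ j).toReal) 1 := by
    have h1 := ENNReal.hasSum_toReal (f := μ) (by rw [μ.tsum_coe]; exact ENNReal.one_ne_top)
    rwa [← ENNReal.tsum_toReal_eq (fun j => μ.apply_ne_top j), μ.tsum_coe, ENNReal.toReal_one] at h1
  have hs : Summable fun j : Irr A => (((μ j).toReal / j.dim : ℝ) : ℂ) • fusionRep A j.chr :=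
    Summable.of_norm_bounded hμ.summable fun j => norm_smul_fusionRep_chr_le (hμ0 j)
  set T := ∑' j : Irr A, (((μ j).toReal / j.dim : ℝ) : ℂ) • fusionRep A j.chr with hT
  have hsum := hs.hasSum
  rw [← hT] at hsum
  have hT1 : ‖T‖ ≤ 1 := tsum_of_norm_bounded hμ fun j => norm_smul_fusionRep_chr_le (hμ0 j)
  refine ⟨T, ⟨_, isLeftMul_fusionRep_chr, hsum⟩, (one_mem_spectrum_iff_two_le_norm hT1).2 ?_⟩
  have hfin : ∀ F : Finset (Irr A), 1 + ∑ j ∈ F, (μ j).toReal ≤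
      ‖1 + ∑ j ∈ F, (((μ j).toReal / j.dim : ℝ) : ℂ) • fusionRep A j.chr‖ := by
    intro F
    have h1 := (h (1 + weightedChr F fun j => (μ j).toReal)).trans (norm_redRep_le_norm_fusionRep
      (add_mem (one_mem _) (weightedChr_mem_cocomm F _)))
    rw [map_add, Bialgebra.counit_one, counit_weightedChr, map_add, fusionRep_one, weightedChr,
      map_sum, ← Complex.ofReal_one, ← Complex.ofReal_add, Complex.norm_real] at h1
    simp only [map_smul] at h1
    exact (le_abs_self _).trans h1
  have hl : Filter.Tendsto (fun F : Finset (Irr A) => 1 + ∑ j ∈ F, (μ j).toReal) Filter.atTop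
      (nhds (1 + 1)) := tendsto_const_nhds.add hμ
  have hr : Filter.Tendsto (fun F : Finset (Irr A) =>
      ‖1 + ∑ j ∈ F, (((μ j).toReal / j.dim : ℝ) : ℂ) • fusionRep A j.chr‖) Filter.atTop
      (nhds ‖1 + T‖) := (tendsto_const_nhds.add hsum).norm
  have := le_of_tendsto_of_tendsto' hl hr hfin
  norm_num at this
  exact this

end Amenability

/-! ### Positivity in C⋆-algebras -/

section Positivity

open scoped ComplexOrder InnerProductSpace

/-- Complete positivity of a positive form: `∑ ⟨v_i, T v_j⟩ b_i* b_j ≥ 0` in a C⋆-algebra. -/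
lemma sum_inner_smul_star_mul_nonneg {H B ι : Type*} [NormedAddCommGroup H]
    [InnerProductSpace ℂ H] [CompleteSpace H] [CStarAlgebra B] [PartialOrder B] [StarOrderedRing B]
    {T : H →L[ℂ] H} (hT : T.IsPositive) (s : Finset ι) (v : ι → H) (b : ι → B) :
    0 ≤ ∑ i ∈ s, ∑ j ∈ s, ⟪v i, T (v j)⟫_ℂ • (star (b i) * b j) := by
  classical
  set M : Matrix s s ℂ := Matrix.of fun i j => ⟪v i, T (v j)⟫_ℂ with hM
  have hpos : M.PosSemidef := by
    refine Matrix.posSemidef_iff_dotProduct_mulVec.2 ⟨?_, fun c => ?_⟩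
    · ext i j
      change star ⟪v j, T (v i)⟫_ℂ = ⟪v i, T (v j)⟫_ℂ
      exact (inner_conj_symm _ _).trans (hT.isSymmetric (v i) (v j))
    · have h := hT.inner_nonneg_right (∑ i, c i • v i)
      convert h using 1
      simp only [map_sum, map_smul, sum_inner, inner_sum, inner_smul_left, inner_smul_right,
        dotProduct, Matrix.mulVec, hM, Matrix.of_apply, Finset.mul_sum, Pi.star_apply]
      rw [Finset.sum_comm]
      refine Finset.sum_congr rfl fun i _ => Finset.sum_congr rfl fun j _ => ?_
      rw [mul_comm ⟪_, _⟫_ℂ, mul_left_comm]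
      rfl
  obtain ⟨m, w, hw⟩ := Matrix.posSemidef_iff_eq_sum_vecMulVec.1 hpos
  have hij : ∀ i j : s, ⟪v i, T (v j)⟫_ℂ = ∑ k, w k i * star (w k j) := by
    intro i j
    have := congrFun (congrFun hw i) j
    simpa [hM, Matrix.sum_apply, Matrix.vecMulVec_apply] using this
  have hsum : ∑ i ∈ s, ∑ j ∈ s, ⟪v i, T (v j)⟫_ℂ • (star (b i) * b j) =
      ∑ k, star (∑ i : s, star (w k i) • b i) * ∑ j : s, star (w k j) • b j := by
    rw [← Finset.sum_coe_sort s]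
    simp only [← Finset.sum_coe_sort s, hij, star_sum, star_smul, star_star, Finset.sum_mul_sum,
      Finset.sum_smul, smul_mul_smul_comm]
    refine (Finset.sum_congr rfl fun i _ => Finset.sum_comm).trans Finset.sum_comm
  rw [hsum]
  exact Finset.sum_nonneg fun k _ => star_mul_self_nonneg _

end Positivity

/-! ### Absorption and the universal norm -/

section FellAbsorption

open scoped ComplexOrder InnerProductSpace

variable {A : Type u} [Ring A] [StarRing A] [HopfAlgebra ℂ A] [StarModule ℂ A]
  [CompactQuantumGroup A]

variable (A) in
/-- The map `x ⊗ b ↦ Δ(x)(1 ⊗ b)`. -/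
def fellMap : A ⊗[ℂ] A →ₗ[ℂ] A ⊗[ℂ] A :=
  TensorProduct.lift <| LinearMap.mk₂ ℂ
    (fun x b => (Coalgebra.comul (R := ℂ) x : A ⊗[ℂ] A) * (1 : A) ⊗ₜ[ℂ] b)
    (fun x y b => by rw [map_add, add_mul]) (fun c x b => by rw [map_smul, smul_mul_assoc])
    (fun x b b' => by rw [TensorProduct.tmul_add, mul_add])
    (fun c x b => by rw [TensorProduct.tmul_smul, mul_smul_comm])

lemma fellMap_tmul (x b : A) :
    fellMap A (x ⊗ₜ b) = (Coalgebra.comul (R := ℂ) x : A ⊗[ℂ] A) * (1 : A) ⊗ₜ[ℂ] b := rfl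

variable (A) in
/-- The slice map `h ⊗ id : A ⊗ A → C_u(G)`. -/
def haarSlice : A ⊗[ℂ] A →ₗ[ℂ] Cu A :=
  (toCu A).toLinearMap ∘ₗ (TensorProduct.lid ℂ A).toLinearMap ∘ₗ (haarFun A).rTensor A

@[simp]
lemma haarSlice_tmul (x b : A) : haarSlice A (x ⊗ₜ b) = haarFun A x • toCu A b := by
  simp [haarSlice]

lemma haarSlice_comul (x : A) :
    haarSlice A (Coalgebra.comul (R := ℂ) x) = haarFun A x • (1 : Cu A) := by
  change toCu A (TensorProduct.lid ℂ A ((haarFun A).rTensor A (Coalgebra.comul (R := ℂ) x))) = _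
  rw [haarFun_left_inv, map_smul, map_one]

lemma haarSlice_one_tmul_mul (b : A) (t : A ⊗[ℂ] A) (b' : A) :
    haarSlice A ((1 : A) ⊗ₜ[ℂ] b * t * (1 : A) ⊗ₜ[ℂ] b') =
      toCu A b * haarSlice A t * toCu A b' := by
  induction t with
  | zero => simp
  | tmul x y => simp
  | add x y hx hy => simp only [mul_add, add_mul, map_add, hx, hy]

/-- The map `fellMap` is isometric for the `C_u(G)`-valued inner product of `A ⊗ A`. -/
lemma haarSlice_star_fellMap_mul (t s : A ⊗[ℂ] A) :
    haarSlice A (star (fellMap A t) * fellMap A s) = haarSlice A (star t * s) := by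
  induction t with
  | zero => simp
  | add x y hx hy => simp only [map_add, star_add, add_mul, hx, hy]
  | tmul x b =>
    induction s with
    | zero => simp
    | add x y hx hy => simp only [map_add, mul_add, hx, hy]
    | tmul y b' =>
      have h : star (fellMap A (x ⊗ₜ b)) * fellMap A (y ⊗ₜ b') =
          (1 : A) ⊗ₜ[ℂ] star b * Coalgebra.comul (R := ℂ) (star x * y) * (1 : A) ⊗ₜ[ℂ] b' := by
        rw [fellMap_tmul, fellMap_tmul, star_mul, ← CompactQuantumGroup.comul_star,
          TensorProduct.star_tmul, star_one, Bialgebra.comul_mul]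
        simp only [mul_assoc]
      rw [h, haarSlice_one_tmul_mul, haarSlice_comul, TensorProduct.star_tmul,
        Algebra.TensorProduct.tmul_mul_tmul, haarSlice_tmul, map_mul (toCu A)]
      simp

lemma fellMap_tmul_one_mul (a : A) (t : A ⊗[ℂ] A) :
    fellMap A (a ⊗ₜ[ℂ] (1 : A) * t) = Coalgebra.comul (R := ℂ) a * fellMap A t := by
  induction t with
  | zero => simp
  | tmul x y =>
    rw [Algebra.TensorProduct.tmul_mul_tmul, fellMap_tmul, fellMap_tmul, Bialgebra.comul_mul,
      one_mul, mul_assoc]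
  | add x y hx hy => simp only [mul_add, map_add, hx, hy]

/-- A preimage of `x ⊗ 1` under `fellMap` is `(id ⊗ S)Δ(x)`; for a coefficient of a unitary `U`
the antipode is given by `U*`. -/
lemma exists_fellMap_eq (x : A) : ∃ t, fellMap A t = x ⊗ₜ 1 := by
  have hx : x ∈ Submodule.span ℂ {a : A | ∃ (n : ℕ) (U : Matrix (Fin n) (Fin n) A),
      IsUnitaryCorep U ∧ ∃ i j, a = U i j} := by
    rw [CompactQuantumGroup.span_coeff]; trivial
  have hle : Submodule.span ℂ {a : A | ∃ (n : ℕ) (U : Matrix (Fin n) (Fin n) A),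
      IsUnitaryCorep U ∧ ∃ i j, a = U i j} ≤
      (LinearMap.range (fellMap A)).comap ((TensorProduct.mk ℂ A A).flip 1) := by
    rw [Submodule.span_le]
    rintro _ ⟨n, U, hU, i, j, rfl⟩
    refine ⟨∑ k, U i k ⊗ₜ star (U j k), ?_⟩
    simp only [map_sum, fellMap_tmul, hU.comul, Finset.sum_mul,
      Algebra.TensorProduct.tmul_mul_tmul, mul_one]
    rw [Finset.sum_comm]
    simp only [← TensorProduct.tmul_sum, hU.sum_mul_star]
    simp [TensorProduct.tmul_ite]
  exact hle hx

lemma haarSlice_star_mul_sum (a : A) (S : Finset (A × A)) :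
    haarSlice A (star (a ⊗ₜ[ℂ] (1 : A) * ∑ p ∈ S, p.1 ⊗ₜ[ℂ] p.2) *
      (a ⊗ₜ[ℂ] (1 : A) * ∑ p ∈ S, p.1 ⊗ₜ[ℂ] p.2)) =
    ∑ p ∈ S, ∑ q ∈ S, ⟪vec A p.1, (star (redRep A a) * redRep A a) (vec A q.1)⟫_ℂ •
      (star (toCu A p.2) * toCu A q.2) := by
  simp only [Finset.mul_sum, star_sum, Finset.sum_mul, map_sum]
  rw [Finset.sum_comm]
  refine Finset.sum_congr rfl fun p _ => Finset.sum_congr rfl fun q _ => ?_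
  rw [← map_star, ← map_mul, redRep_vec, inner_vec, Algebra.TensorProduct.tmul_mul_tmul,
    Algebra.TensorProduct.tmul_mul_tmul, TensorProduct.star_tmul,
    Algebra.TensorProduct.tmul_mul_tmul, haarSlice_tmul, one_mul, one_mul, star_mul,
    map_mul (toCu A), map_star]
  simp only [mul_assoc]

lemma haarSlice_star_mul_self_nonneg (t : A ⊗[ℂ] A) : 0 ≤ haarSlice A (star t * t) := by
  obtain ⟨S, rfl⟩ := TensorProduct.exists_finset t
  have h := haarSlice_star_mul_sum (1 : A) S
  rw [← Algebra.TensorProduct.one_def, one_mul] at h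
  rw [h]
  refine sum_inner_smul_star_mul_nonneg ?_ S (fun p => vec A p.1) (fun p => toCu A p.2)
  rw [ContinuousLinearMap.star_eq_adjoint]
  exact ContinuousLinearMap.isPositive_adjoint_comp_self _

/-- In the `C_u(G)`-valued inner product of `A ⊗ A`, the element `a ⊗ 1` acts with norm at most
the reduced norm of `a`. -/
lemma haarSlice_star_tmul_one_mul_le (a : A) (t : A ⊗[ℂ] A) :
    haarSlice A (star (a ⊗ₜ[ℂ] (1 : A) * t) * (a ⊗ₜ[ℂ] (1 : A) * t)) ≤
      ((‖redRep A a‖ ^ 2 : ℝ) : ℂ) • haarSlice A (star t * t) := by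
  obtain ⟨S, rfl⟩ := TensorProduct.exists_finset t
  have h1 := haarSlice_star_mul_sum (1 : A) S
  rw [← Algebra.TensorProduct.one_def, one_mul] at h1
  rw [haarSlice_star_mul_sum, h1, ← sub_nonneg, Finset.smul_sum, ← Finset.sum_sub_distrib]
  simp only [Finset.smul_sum, ← Finset.sum_sub_distrib, smul_smul, ← sub_smul]
  have hT : (((‖redRep A a‖ ^ 2 : ℝ) : ℂ) • (1 : L2 A →L[ℂ] L2 A) -
      star (redRep A a) * redRep A a).IsPositive := by
    rw [← ContinuousLinearMap.nonneg_iff_isPositive, sub_nonneg, Complex.coe_smul,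
      ← Algebra.algebraMap_eq_smul_one]
    exact CStarAlgebra.star_mul_le_algebraMap_norm_sq
  convert sum_inner_smul_star_mul_nonneg hT S (fun p => vec A p.1) (fun p => toCu A p.2) using 5
  simp

/-- Fell absorption: almost invariant vectors make the universal norm equal to the reduced one.
Conjugation by `fellMap` turns `a ⊗ 1` into `Δ(a)`, whose slices by almost invariant vectors
approximate `a`. -/
lemma HasAlmostInvariantVectors.norm_toCu_le (h : HasAlmostInvariantVectors A) (a : A) :
    ‖toCu A a‖ ≤ ‖redRep A a‖ := by
  classical
  set c := star a * a with hc
  obtain ⟨S, hS⟩ := TensorProduct.exists_finset (Coalgebra.comul (R := ℂ) c : A ⊗[ℂ] A)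
  set K := ∑ p ∈ S, ‖toCu A p.2‖ with hK
  have hK0 : 0 ≤ K := Finset.sum_nonneg fun _ _ => norm_nonneg _
  have hcc : c = ∑ p ∈ S, Coalgebra.counit (R := ℂ) p.1 • p.2 := by
    have := Coalgebra.rTensor_counit_comul (R := ℂ) c
    rw [hS] at this
    simpa using congrArg (TensorProduct.lid ℂ A) this.symm
  have key : ∀ δ : ℝ, 0 < δ → ‖toCu A c‖ ≤ ‖redRep A a‖ ^ 2 + δ * K := by
    intro δ hδ
    obtain ⟨x, hx0, hx⟩ := h.exists_vec (S.image Prod.fst) hδ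
    obtain ⟨t, ht⟩ := exists_fellMap_eq x
    have hv : 0 < ‖vec A x‖ ^ 2 := by positivity
    have hxx : haarFun A (star x * x) = ((‖vec A x‖ ^ 2 : ℝ) : ℂ) := by
      rw [← inner_vec, inner_self_eq_norm_sq_to_K]; norm_cast
    -- `y` is the slice of `Δ(a* a)` by the vector state of `x`
    set y := haarSlice A (star (Coalgebra.comul (R := ℂ) a * x ⊗ₜ[ℂ] (1 : A)) *
      (Coalgebra.comul (R := ℂ) a * x ⊗ₜ[ℂ] (1 : A))) with hy
    have hy0 : 0 ≤ y := haarSlice_star_mul_self_nonneg _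
    have hy1 : y ≤ ((‖redRep A a‖ ^ 2 * ‖vec A x‖ ^ 2 : ℝ) : ℂ) • (1 : Cu A) := by
      have h1 := haarSlice_star_tmul_one_mul_le a t
      rw [← haarSlice_star_fellMap_mul, fellMap_tmul_one_mul, ht, ← haarSlice_star_fellMap_mul t t,
        ht, TensorProduct.star_tmul, star_one, Algebra.TensorProduct.tmul_mul_tmul, one_mul,
        haarSlice_tmul, map_one, hxx, smul_smul, ← Complex.ofReal_mul] at h1
      exact h1
    have hyn : ‖y‖ ≤ ‖redRep A a‖ ^ 2 * ‖vec A x‖ ^ 2 := by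
      rw [CStarAlgebra.norm_le_iff_le_algebraMap _ (by positivity) hy0,
        Algebra.algebraMap_eq_smul_one, ← Complex.coe_smul]
      exact hy1
    have hyS : y = ∑ p ∈ S, ⟪vec A x, redRep A p.1 (vec A x)⟫_ℂ • toCu A p.2 := by
      rw [hy, star_mul, ← CompactQuantumGroup.comul_star, mul_assoc, ← mul_assoc (Coalgebra.comul _),
        ← Bialgebra.comul_mul, ← hc, hS, TensorProduct.star_tmul, star_one]
      simp only [Finset.sum_mul, Finset.mul_sum, map_sum, Algebra.TensorProduct.tmul_mul_tmul,
        one_mul, mul_one, haarSlice_tmul, redRep_vec, inner_vec]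
    have hdiff : ((‖vec A x‖ ^ 2 : ℝ) : ℂ) • toCu A c - y =
        -∑ p ∈ S, ⟪vec A x, defect (vec A x) p.1⟫_ℂ • toCu A p.2 := by
      rw [hyS, hcc, map_sum, Finset.smul_sum, ← Finset.sum_sub_distrib, ← Finset.sum_neg_distrib]
      refine Finset.sum_congr rfl fun p _ => ?_
      rw [defect_apply, inner_sub_right, inner_smul_right, inner_self_eq_norm_sq_to_K, map_smul,
        smul_smul, ← sub_smul, ← neg_smul, neg_sub]
      congr 2
      push_cast
      exact mul_comm _ _
    have hdn : ‖((‖vec A x‖ ^ 2 : ℝ) : ℂ) • toCu A c - y‖ ≤ δ * K * ‖vec A x‖ ^ 2 := by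
      rw [hdiff, norm_neg, hK, Finset.mul_sum, Finset.sum_mul]
      refine (norm_sum_le _ _).trans (Finset.sum_le_sum fun p hp => ?_)
      rw [norm_smul]
      have h1 := (norm_inner_le_norm (𝕜 := ℂ) (vec A x) (defect (vec A x) p.1)).trans
        (mul_le_mul_of_nonneg_left (hx p.1 (Finset.mem_image_of_mem _ hp)) (norm_nonneg _))
      calc _ ≤ ‖vec A x‖ * (δ * ‖vec A x‖) * ‖toCu A p.2‖ := by gcongr
        _ = _ := by ring
    have h1 : ‖vec A x‖ ^ 2 * ‖toCu A c‖ ≤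
        δ * K * ‖vec A x‖ ^ 2 + ‖redRep A a‖ ^ 2 * ‖vec A x‖ ^ 2 := by
      have h2 : ‖((‖vec A x‖ ^ 2 : ℝ) : ℂ) • toCu A c‖ = ‖vec A x‖ ^ 2 * ‖toCu A c‖ := by
        rw [norm_smul, Complex.norm_real, Real.norm_of_nonneg hv.le]
      rw [← h2]
      exact (norm_le_norm_sub_add _ y).trans (add_le_add hdn hyn)
    nlinarith
  have hlim : ‖toCu A c‖ ≤ ‖redRep A a‖ ^ 2 := by
    refine le_of_forall_pos_le_add fun η hη => ?_
    refine (key (η / (K + 1)) (by positivity)).trans ?_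
    gcongr
    rw [div_mul_eq_mul_div, div_le_iff₀ (by positivity)]
    nlinarith
  rw [hc, map_mul, map_star, CStarRing.norm_star_mul_self, ← sq] at hlim
  exact (sq_le_sq₀ (norm_nonneg _) (norm_nonneg _)).1 hlim

lemma HasAlmostInvariantVectors.bijective_piH (h : HasAlmostInvariantVectors A) :
    Function.Bijective (piH A) := by
  refine ⟨(injective_iff_map_eq_zero _).2 fun x hx => ?_, ?_⟩
  · have hle : ‖x‖ ≤ ‖(haar A).gnsStarAlgHom x‖ :=
      Cu.induction_on (p := fun x => ‖x‖ ≤ ‖(haar A).gnsStarAlgHom x‖) x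
        (isClosed_le continuous_norm (map_continuous (haar A).gnsStarAlgHom).norm)
        h.norm_toCu_le
    rw [← coe_piH, hx] at hle
    exact norm_le_zero_iff.1 (by simpa using hle)
  · rintro ⟨y, x, rfl⟩
    exact ⟨x, rfl⟩

end FellAbsorption

/-! ### Characters of the reduced algebra -/

section Character

variable {A : Type u} [Ring A] [StarRing A] [HopfAlgebra ℂ A] [StarModule ℂ A]
  [CompactQuantumGroup A]

/-- A character of `C_r(G)` is contractive on the image of `A`. The range of `π_h` is not needed
to be closed: the functional calculus is applied in `C_u(G)`. -/
lemma norm_counit_le_of_character {χ : Cr A →⋆ₐ[ℂ] ℂ}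
    (hχ : ∀ a : A, χ (piH A (toCu A a)) = Coalgebra.counit (R := ℂ) a) (a : A) :
    ‖Coalgebra.counit (R := ℂ) a‖ ≤ ‖redRep A a‖ := by
  set x := star (toCu A a) * toCu A a with hx
  have hxs : IsSelfAdjoint x := IsSelfAdjoint.star_mul_self _
  set r := ‖redRep A a‖ ^ 2 with hr
  -- the function vanishes on the spectrum of `π_h(x)`, whose norm is `r`
  set f : ℝ → ℝ := fun t => max (t - r) 0 with hf
  have hfc : Continuous f := by fun_prop
  set ψ : Cu A →⋆ₐ[ℂ] ℂ := χ.comp (piH A) with hψ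
  have h0 : (haar A).gnsStarAlgHom (cfc f x) = 0 := by
    rw [StarAlgHomClass.map_cfc (S := ℂ) (haar A).gnsStarAlgHom f x hfc.continuousOn
      (map_continuous _) hxs (hxs.map _)]
    have : Set.EqOn f (fun _ => 0) (spectrum ℝ ((haar A).gnsStarAlgHom x)) := by
      intro t ht
      have h1 := (le_abs_self t).trans ((spectrum.norm_le_norm_mul_of_mem ht).trans
        (mul_le_of_le_one_right (norm_nonneg _) ContinuousLinearMap.norm_id_le))
      have h2 : ‖(haar A).gnsStarAlgHom x‖ = r := by
        rw [hx, map_mul, map_star]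
        exact (CStarRing.norm_star_mul_self (x := redRep A a)).trans (sq _).symm
      rw [h2] at h1
      exact max_eq_right (by linarith)
    rw [cfc_congr this]
    simp
  have h1 : ψ (cfc f x) = 0 := by
    have : piH A (cfc f x) = 0 := Subtype.ext h0
    rw [hψ, StarAlgHom.comp_apply, this, map_zero]
  have hψx : ψ x = algebraMap ℝ ℂ (‖Coalgebra.counit (R := ℂ) a‖ ^ 2) := by
    rw [hx, map_mul, map_star, hψ, StarAlgHom.comp_apply, hχ]
    exact (Complex.conj_mul' _).trans (Complex.ofReal_pow _ _).symm
  rw [StarAlgHomClass.map_cfc (S := ℂ) ψ f x hfc.continuousOn (map_continuous _) hxs (hxs.map _),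
    hψx, cfc_algebraMap] at h1
  have h2 : f (‖Coalgebra.counit (R := ℂ) a‖ ^ 2) = 0 := by simpa using h1
  have h3 : ‖Coalgebra.counit (R := ℂ) a‖ ^ 2 ≤ r := by
    have := (le_max_left _ _).trans h2.le
    linarith
  exact (sq_le_sq₀ (norm_nonneg _) (norm_nonneg _)).1 h3

lemma exists_character_of_bijective (h : Function.Bijective (piH A)) :
    ∃ χ : Cr A →⋆ₐ[ℂ] ℂ, ∀ a : A, χ (piH A (toCu A a)) = Coalgebra.counit (R := ℂ) a := by
  obtain ⟨e, -, hea⟩ := exists_counit_extension A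
  let φ := StarAlgEquiv.ofBijective (piH A) h
  refine ⟨e.comp (StarAlgHomClass.toStarAlgHom φ.symm), fun a => ?_⟩
  exact (congrArg e (φ.symm_apply_apply (toCu A a))).trans (hea a)

end Character

end CQG

end

theorem mainTheorem9 {A : Type*} [Ring A] [StarRing A] [HopfAlgebra ℂ A] [StarModule ℂ A]
    [CQG.CompactQuantumGroup A] :
    List.TFAE [
      CQG.IsAmenableFusion (CQG.fusionMult (A := A)) CQG.Irr.dim,
      ∃ χ : CQG.Cr A →⋆ₐ[ℂ] ℂ,
        ∀ a : A, χ (CQG.piH A (CQG.toCu A a)) = Coalgebra.counit (R := ℂ) a,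
      Function.Bijective (CQG.piH A)] := by
  tfae_have 1 → 3 := fun h =>
    (CQG.hasAlmostInvariantVectors_of_isAmenableFusion h).bijective_piH
  tfae_have 3 → 2 := CQG.exists_character_of_bijective
  tfae_have 2 → 1 := fun ⟨χ, hχ⟩ =>
    CQG.isAmenableFusion_of_norm_counit_le (CQG.norm_counit_le_of_character hχ)
  tfae_finish
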